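/- \textbf{Setting.} Let $n$ be an even positive integer and let $V$ be a set of $n$ vertices. For $D\subseteq[n-1]=\{1,\dots,n-1\}$ let $\mathcal{G}_D^{\mathrm{col}}$ be the set of pairs $(G,\phi_G)$, where $G$ is a $|D|$-regular graph on $V$ and $\phi_G$ is a $1$-factorization of $G$ with colour set $D$, that is, an edge-colouring $E(G)\to D$ each of whose colour classes is a perfect matching. We write $G$ for $(G,\phi_G)$ and $\phi$ for $\phi_G$. For $A,B\subseteq V$ (not necessarily disjoint or distinct), $e_G(A,B)$ is the number of edges $ab$ of $G$ with $a\in A$, $b\in B$. Fix $D\subseteq[n-1]$, $c\in[n-1]\setminus D$, $x\in V$, and an ordered partition $\mathcal{P}=(D_1,D_2,D_3,D_4)$ of $D$ which is equitable, i.e. $|D_i|\in\{\lfloor |D|/4\rfloor,\lceil |D|/4\rceil\}$ for every $i$. Let $G\in\mathcal{G}_{D\cup\{c\}}^{\mathrm{col}}$. An \emph{$(x,c)$-absorbing gadget} in $G$ is a subgraph $A=T\cup Q$ of $G$, where $T$ is a triangle containing $x$ and $Q$ is a $4$-cycle vertex-disjoint from $T$, such that: exactly one edge $e$ of $Q$ has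 colour $c$; if $e_1,e_2$ are the edges of $T$ at $x$, then there is a matching $\{e_1',e_2'\}$ in $Q$ not containing $e$ with $\phi(e_i)=\phi(e_i')$ for $i\in\{1,2\}$; and if $e_3$ is the third edge of $T$ and $e_3'$ is the edge of $Q$ opposite to $e$, then $\phi(e_3)=\phi(e_3')\neq c$. An \emph{$(x,c,\mathcal{P})$-gadget} in $G$ is a subgraph $J=A\cup\{f\}$ of $G$, where $A$ is an $(x,c)$-absorbing gadget in $G$ whose edges can be named as above with $\phi(e_i)\in D_i$ for $i\in\{1,2,3\}$, and $f=xv$ is an edge of $G$ with $\phi(f)\in D_4$, where $v$ is the unique vertex of $A$ at which the edges of $A$ have exactly the colours $c$ and $\phi(e_1)$. It is \emph{distinguishable} in $G$ if no other $(x,c,\mathcal{P})$-gadget in $G$ contains $e_3$ or $e_3'$. For an edge $e$ of $G$ with $\phi(e)=c$, let $\mathrm{sat}(e)$ be the number of distinguishable $(x,c,\mathcal{P})$-gadgets in $G$ containing $e$. Let $\mathrm{Sat}(G)$ and $\mathrm{Unsat}(G)$ be the sets of edges $e$ of colour $c$ with $\mathrm{sat}(e)\geq|D|$ and $\mathrm{sat}(e)\leq|D|-1$,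 respectively, and put \[ r(G)=|D|\,|\mathrm{Sat}(G)|+\sum_{e\in\mathrm{Unsat}(G)}\mathrm{sat}(e). \] Let $\widetilde{\mathcal{Q}}_{D\cup\{c\}}^{\mathrm{col}}$ be the union, over the integers $0\leq s\leq n|D|/2$, of the sets of all $G\in\mathcal{G}_{D\cup\{c\}}^{\mathrm{col}}$ such that $r(G)=s$ and $e_G(A,B)<8|D|^3/n+6s$ for all $A,B\subseteq V$ with $|A|=|B|=|D|$. \textbf{Lemma.} There is $\mu_0\in(0,1)$ such that for every real $\mu$ with $0<\mu\leq\mu_0$ there is $n_0$ such that the following holds for every even $n\geq n_0$. Let $|V|=n$, and let $D\subseteq[n-1]$ have size $|D|=\mu n$ (or, if $\mu n$ is not an integer, $|D|\in\{\lfloor\mu n\rfloor,\lceil\mu n\rceil\}$). Let $x\in V$, let $c\in[n-1]\setminus D$, and let $\mathcal{P}$ be an equitable ordered partition of $D$ into four parts. Then $\widetilde{\mathcal{Q}}_{D\cup\{c\}}^{\mathrm{col}}$ is non-empty, and if $\mathbf{G}\in\mathcal{G}_{D\cup\{c\}}^{\mathrm{col}}$ is chosen uniformly at random, then \[ \Pr\left[\,r(\mathbf{G})\leq\frac{\mu^4n^2}{2^{23}}\;\middle|\;\mathbf{G}\in\widetilde{\mathcal{Q}}_{D\cup\{c\}}^{\mathrm{col}}\right]\leq\exp\left(-\frac{\mu^4n^2}{2^{24}}\right).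 \] -/

import Mathlib

/-- An element `(G, φ)` of `𝒢_D^col` on the vertex set `V`: a graph `G` on `V` together with a
`1`-factorization `φ` of `G` with colour set `D`, i.e. an edge-colouring with colours in `D` in which
every colour class is a perfect matching of `V` (each vertex is incident to exactly one edge of each
colour). Such a `G` is `|D|`-regular, see `ColouredGraph.regular`. -/
@[ext]
structure ColouredGraph (V : Type*) (D : Finset ℕ) where
  /-- the underlying graph `G` -/
  graph : SimpleGraph V
  /-- the colouring `φ` of the edges of `G` -/
  colour : graph.edgeSet → D
  /-- every colour class is a perfect matching -/
  perfect : ∀ (v : V) (d : D), ∃! w : V, ∃ h : graph.Adj v w, colour ⟨s(v, w), h⟩ = d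

namespace ColouredGraph

variable {V : Type*} {D : Finset ℕ}

/-- The underlying graph of an element of `𝒢_D^col` is `|D|`-regular. -/
theorem regular (G : ColouredGraph V D) (v : V) :
    (G.graph.neighborSet v).ncard = D.card := by
  have hb : Function.Bijective
      (fun w : G.graph.neighborSet v => G.colour ⟨s(v, (w : V)), w.2⟩) := by
    constructor
    · intro w₁ w₂ h
      have hu := (G.perfect v (G.colour ⟨s(v, (w₁ : V)), w₁.2⟩)).unique
        ⟨w₁.2, rfl⟩ ⟨w₂.2, h.symm⟩
      exact Subtype.ext hu
    · intro d
      obtain ⟨w, ⟨h, hw⟩, -⟩ := G.perfect v d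
      exact ⟨⟨w, h⟩, hw⟩
  rw [← Nat.card_coe_set_eq, Nat.card_congr (Equiv.ofBijective _ hb)]
  simp

/-- There are only finitely many elements of `𝒢_D^col`. -/
instance [Finite V] : Finite (ColouredGraph V D) := by
  have hi : Function.Injective
      (fun G : ColouredGraph V D =>
        (⟨G.graph, G.colour⟩ : Σ g : SimpleGraph V, (g.edgeSet → D))) := by
    rintro ⟨g, φ, h⟩ ⟨g', φ', h'⟩ he
    simp only [Sigma.mk.injEq] at he
    obtain ⟨rfl, he⟩ := he
    obtain rfl := eq_of_heq he
    rfl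
  exact Finite.of_injective _ hi

/-- Every set of coloured graphs is an event. -/
instance : MeasurableSpace (ColouredGraph V D) := ⊤

/-- `e` is a `d`-edge of `G`: an edge of `G` whose colour is `d`. -/
def HasColour (G : ColouredGraph V D) (d : ℕ) (e : Sym2 V) : Prop :=
  ∃ h : e ∈ G.graph.edgeSet, (G.colour ⟨e, h⟩ : ℕ) = d

/-- `e_G(A, B)`: the number of edges `ab` of `G` with `a ∈ A` and `b ∈ B`, where `A` and `B` need not
be disjoint (each edge is counted once). -/
noncomputable def edgeCount (G : ColouredGraph V D) (A B : Finset V) : ℕ :=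
  {e : Sym2 V | e ∈ G.graph.edgeSet ∧ ∃ a ∈ A, ∃ b ∈ B, e = s(a, b)}.ncard

end ColouredGraph

/-- `P` is an ordered equitable partition of `D` into four parts: the parts are pairwise disjoint, have
union `D`, and have sizes `⌊|D|/4⌋` or `⌈|D|/4⌉`. -/
def IsEquitableFourPartition (D : Finset ℕ) (P : Fin 4 → Finset ℕ) : Prop :=
  (∀ i j, i ≠ j → Disjoint (P i) (P j)) ∧
  (∀ d, d ∈ D ↔ ∃ i, d ∈ P i) ∧
  ∀ i, (P i).card = ⌊(D.card : ℚ) / 4⌋₊ ∨ (P i).card = ⌈(D.card : ℚ) / 4⌉₊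

/-- The vertices (other than `x`) of an `(x, c)`-absorbing gadget, named by their roles. The triangle
is `x y₁ y₂` and the `4`-cycle is `v₁ v₂ u₂ u₁`. -/
structure GadgetVertices (V : Type*) where
  y₁ : V
  y₂ : V
  v₁ : V
  v₂ : V
  u₁ : V
  u₂ : V

namespace GadgetVertices

variable {V : Type*}

/-- The edge set of the triangle `T` with edges `e₁ = x y₁`, `e₂ = x y₂`, `e₃ = y₁ y₂`. -/
def triangleEdges (g : GadgetVertices V) (x : V) : Set (Sym2 V) :=
  {s(x, g.y₁), s(x, g.y₂), s(g.y₁, g.y₂)}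

/-- The edge set of the `4`-cycle `Q` with edges
`e = v₁ v₂`, `e₁' = u₁ v₁`, `e₂' = u₂ v₂`, `e₃' = u₁ u₂`. -/
def cycleEdges (g : GadgetVertices V) : Set (Sym2 V) :=
  {s(g.v₁, g.v₂), s(g.u₁, g.v₁), s(g.u₂, g.v₂), s(g.u₁, g.u₂)}

variable {D : Finset ℕ}

/-- `T ∪ Q` is an `(x, c)`-absorbing gadget of `G` with the given vertices:
* `T` is a triangle containing `x`, `Q` is a `4`-cycle, they are vertex-disjoint and contained in `G`;
* `e` is the unique edge of `Q` of colour `c`;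
* the edges `e₁, e₂` of `T` at `x` have the same colours as the edges `e₁', e₂'`, respectively, which
  form the matching of `Q` not containing `e`;
* the edge `e₃` of `T` not at `x` has the same colour as the edge `e₃'` of `Q` opposite to `e`, and
  this colour is not `c`.

Renaming vertices, every `(x, c)`-absorbing gadget is of this form. -/
def IsAbsorbing (g : GadgetVertices V) (G : ColouredGraph V D) (x : V) (c : ℕ) : Prop :=
  [x, g.y₁, g.y₂, g.v₁, g.v₂, g.u₁, g.u₂].Nodup ∧
  g.triangleEdges x ⊆ G.graph.edgeSet ∧
  g.cycleEdges ⊆ G.graph.edgeSet ∧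
  (∀ e ∈ g.cycleEdges, G.HasColour c e ↔ e = s(g.v₁, g.v₂)) ∧
  (∃ d, G.HasColour d s(x, g.y₁) ∧ G.HasColour d s(g.u₁, g.v₁)) ∧
  (∃ d, G.HasColour d s(x, g.y₂) ∧ G.HasColour d s(g.u₂, g.v₂)) ∧
  (∃ d, d ≠ c ∧ G.HasColour d s(g.y₁, g.y₂) ∧ G.HasColour d s(g.u₁, g.u₂))

end GadgetVertices

namespace ColouredGraph

variable {V : Type*} {D : Finset ℕ}

/-- `J` is (the edge set of) an `(x, c, P)`-gadget of `G`: the union of an `(x, c)`-absorbing gadget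
with `φ(e₁) ∈ D₁`, `φ(e₂) ∈ D₂`, `φ(e₃) ∈ D₃`, and of an edge `f = x v₁` of `G` with `φ(f) ∈ D₄`, where
`v₁` is the common end of the `c`-edge `e` and of the edge `e₁'` of colour `φ(e₁)`. As gadgets have no
isolated vertices, they are determined by their edge sets. -/
def IsGadget (G : ColouredGraph V D) (x : V) (c : ℕ) (P : Fin 4 → Finset ℕ)
    (J : Set (Sym2 V)) : Prop :=
  ∃ g : GadgetVertices V, g.IsAbsorbing G x c ∧
    (∃ d ∈ P 0, G.HasColour d s(x, g.y₁)) ∧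
    (∃ d ∈ P 1, G.HasColour d s(x, g.y₂)) ∧
    (∃ d ∈ P 2, G.HasColour d s(g.y₁, g.y₂)) ∧
    (∃ d ∈ P 3, G.HasColour d s(x, g.v₁)) ∧
    J = g.triangleEdges x ∪ g.cycleEdges ∪ {s(x, g.v₁)}

/-- `J` is a distinguishable `(x, c, P)`-gadget of `G`: no other `(x, c, P)`-gadget of `G` contains one
of the two edges `e₃, e₃'` of `J` with colour in `D₃`. -/
def IsDistinguishable (G : ColouredGraph V D) (x : V) (c : ℕ) (P : Fin 4 → Finset ℕ)
    (J : Set (Sym2 V)) : Prop :=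
  G.IsGadget x c P J ∧
    ∀ J' : Set (Sym2 V), G.IsGadget x c P J' → J' ≠ J →
      ∀ e ∈ J, (∃ d ∈ P 2, G.HasColour d e) → e ∉ J'

/-- The saturation of an edge `e` of `G`: the number of distinguishable `(x, c, P)`-gadgets of `G`
containing `e`. -/
noncomputable def sat (G : ColouredGraph V D) (x : V) (c : ℕ) (P : Fin 4 → Finset ℕ)
    (e : Sym2 V) : ℕ :=
  {J : Set (Sym2 V) | G.IsDistinguishable x c P J ∧ e ∈ J}.ncard

end ColouredGraph

/-! Below, `G` ranges over `𝒢_{D ∪ {c}}^col`, and saturation is measured against `|D|`. -/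

section Saturation

variable {V : Type*} [Fintype V] {D : Finset ℕ} {c : ℕ}

open Classical in
/-- `Sat(G)`: the `c`-edges `e` of `G` with `sat(e) ≥ |D|`. -/
noncomputable def satEdges (x : V) (P : Fin 4 → Finset ℕ)
    (G : ColouredGraph V (insert c D)) : Finset (Sym2 V) :=
  Finset.univ.filter fun e => G.HasColour c e ∧ D.card ≤ G.sat x c P e

open Classical in
/-- `Unsat(G)`: the remaining `c`-edges of `G`. -/
noncomputable def unsatEdges (x : V) (P : Fin 4 → Finset ℕ)
    (G : ColouredGraph V (insert c D)) : Finset (Sym2 V) :=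
  Finset.univ.filter fun e => G.HasColour c e ∧ ¬ D.card ≤ G.sat x c P e

/-- `r(G) = |D| |Sat(G)| + ∑_{e ∈ Unsat(G)} sat(e)`. -/
noncomputable def gadgetCount (x : V) (P : Fin 4 → Finset ℕ)
    (G : ColouredGraph V (insert c D)) : ℕ :=
  D.card * (satEdges x P G).card + ∑ e ∈ unsatEdges x P G, G.sat x c P e

/-- `Q_s`: the `G` with `e_G(A, B) < 8|D|³/n + 6s` for all `A, B ⊆ V` of size `|D|`. -/
def quasirandomLevel (V : Type*) [Fintype V] (D : Finset ℕ) (c s : ℕ) :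
    Set (ColouredGraph V (insert c D)) :=
  {G | ∀ A B : Finset V, A.card = D.card → B.card = D.card →
    (G.edgeCount A B : ℝ) < 8 * (D.card : ℝ) ^ 3 / (Fintype.card V : ℝ) + 6 * (s : ℝ)}

/-- The relaxed quasirandomness class: the union over `0 ≤ s ≤ n|D|/2` of the sets
`T_s = {G | r(G) = s} ∩ Q_s`. -/
def relaxedQuasirandom (D : Finset ℕ) (c : ℕ) (x : V) (P : Fin 4 → Finset ℕ) :
    Set (ColouredGraph V (insert c D)) :=
  ⋃ s ∈ Finset.range (Fintype.card V * D.card / 2 + 1),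
    {G | gadgetCount x P G = s} ∩ quasirandomLevel V D c s

end Saturation

/-! The relaxed class is the union of the levels T_s = {r(G) = s} ∩ Q_s. Put K = μ⁴n²/2²³ and k =
⌊K⌋. If |T_{s+1}| ≥ 8|T_s| for all s < 2k, then the levels up to k have total size at most 2|T_k| ≤
2·8^(-k)|T_{2k}|, and 2·8^(-k) ≤ exp(-K/2) is the claimed bound.

The factor 8 comes from double counting switchings. Following colours d₄, c, d₁, d₂ from x fixes all
vertices of a potential gadget, and then only the two edges y₁y₂ and u₁u₂ of colour d₃ are missing.
Each is inserted by a rotation inside the matching of colour d₃: three edges are exchanged for three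
others on the same six vertices, with a freely chosen third edge at z, respectively w, absorbing the
old partners. At most six edges are added, exactly the growth of the allowance 6s in Q_s, so the
result lies in T_{s+1} once r rises by exactly 1 (`GoodSwitch.exists_mem_level`).

For r to rise by exactly 1, no other gadget may arise (`GoodSwitch.only`) and the other
distinguishable gadgets must stay the same (`isIsolated_iff_of_remove_insert`). The danger in the
latter is that a removed edge destroys a gadget and thereby makes another one distinguishable. It is
met by removing only edges that are not e₃ of any gadget, and are e₃' only for gadgets whose e₃ lies
in more than 13 gadgets: at most 12 of these die, so the edge e₃ remains shared.

A switching is recovered from its result, the new label, and the four former partners of y₁, y₂, u₁,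
u₂. The label is that of a distinguishable gadget on a c-edge that is not over-saturated, so there
are at most s+1 of them, hence at most (s+1)n⁴ switchings lead to a given graph. In the other
direction there are about |D|⁴/4⁴ labels and n² pairs (z, w), and quasirandomness bounds the bad
choices (`card_goodSwitches`): fixing two of the four colours, a bad label is typically determined
by an adjacent pair between two sets of size at most |D|, of which there are at most Δ = 16|D|³/n +
12s.

Non-emptiness needs one graph that is quasirandom already at s = 0. It is a bipartite Cayley graph
on two copies of ℤ/(n/2), whose connection set, found by averaging, has nearly minimal additive
energy and hence small discrepancy (`diffPairs_discrepancy`). -/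

namespace ColouredGraph

/-! ### Coloured graphs as families of matching involutions -/

variable {V : Type*} {D : Finset ℕ}

/-- A family of perfect matchings indexed by `D` with pairwise disjoint edge sets, each given by the
involution swapping matched vertices; indices outside `D` carry the identity. -/
structure IsMating (D : Finset ℕ) (m : ℕ → V → V) : Prop where
  invol : ∀ d v, m d (m d v) = v
  ne : ∀ d ∈ D, ∀ v, m d v ≠ v
  eq_of_eq : ∀ d ∈ D, ∀ d' ∈ D, ∀ v, m d v = m d' v → d = d'
  eq_self : ∀ d ∉ D, ∀ v, m d v = v

open Classical in
/-- The vertex matched to `v` in colour `d`. -/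
noncomputable def mate (G : ColouredGraph V D) (d : ℕ) (v : V) : V :=
  if h : d ∈ D then (G.perfect v ⟨d, h⟩).choose else v

/-- The dictionary that turns every statement about coloured edges into an equation between iterated
mates. -/
theorem hasColour_iff (G : ColouredGraph V D) {d : ℕ} {v w : V} :
    G.HasColour d s(v, w) ↔ d ∈ D ∧ G.mate d v = w := by
  constructor
  · rintro ⟨h, hd⟩
    have hD : d ∈ D := hd ▸ (G.colour ⟨s(v, w), h⟩).2
    refine ⟨hD, ?_⟩
    rw [mate, dif_pos hD]
    exact (G.perfect v ⟨d, hD⟩).unique (G.perfect v ⟨d, hD⟩).choose_spec.1 ⟨h, Subtype.ext hd⟩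
  · rintro ⟨hD, rfl⟩
    rw [mate, dif_pos hD]
    obtain ⟨h, hd⟩ := (G.perfect v ⟨d, hD⟩).choose_spec.1
    exact ⟨h, by rw [hd]⟩

theorem HasColour.unique {G : ColouredGraph V D} {d d' : ℕ} {e : Sym2 V}
    (h : G.HasColour d e) (h' : G.HasColour d' e) : d = d' := by
  obtain ⟨_, rfl⟩ := h
  obtain ⟨_, rfl⟩ := h'
  rfl

theorem adj_iff (G : ColouredGraph V D) {v w : V} :
    G.graph.Adj v w ↔ ∃ d ∈ D, G.mate d v = w := by
  constructor
  · intro h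
    exact ⟨_, G.hasColour_iff.1 ⟨h, rfl⟩⟩
  · rintro ⟨d, hd, hw⟩
    exact (G.hasColour_iff.2 ⟨hd, hw⟩).1

theorem isMating (G : ColouredGraph V D) : IsMating D G.mate where
  invol d v := by
    by_cases hd : d ∈ D
    · have h : G.HasColour d s(v, G.mate d v) := G.hasColour_iff.2 ⟨hd, rfl⟩
      rw [Sym2.eq_swap] at h
      exact (G.hasColour_iff.1 h).2
    · simp [mate, hd]
  ne d hd v h := by
    have h' : G.graph.Adj v (G.mate d v) := G.adj_iff.2 ⟨d, hd, rfl⟩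
    exact h'.ne h.symm
  eq_of_eq d hd d' hd' v h :=
    (G.hasColour_iff.2 ⟨hd, h⟩).unique (G.hasColour_iff.2 ⟨hd', rfl⟩)
  eq_self d hd v := by simp [mate, hd]

/-- The relation `HasColour` determines both the graph and its colouring. Hence switchings may be
counted on the level of matings. -/
theorem mate_injective : Function.Injective (mate : ColouredGraph V D → ℕ → V → V) := by
  intro G H h
  have key : ∀ d e, G.HasColour d e ↔ H.HasColour d e := by
    intro d e
    induction e with | _ v w => rw [hasColour_iff, hasColour_iff, h]
  obtain ⟨g, φ, hg⟩ := G
  obtain ⟨g', φ', hg'⟩ := H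
  have hgg : g = g' := by
    ext v w
    constructor
    · intro hv
      exact ((key _ s(v, w)).1 ⟨hv, rfl⟩).1
    · intro hv
      exact ((key _ s(v, w)).2 ⟨hv, rfl⟩).1
  subst hgg
  have : φ = φ' := by
    funext ⟨e, he⟩
    obtain ⟨_, h'⟩ := (key _ e).1 ⟨he, rfl⟩
    exact Subtype.ext h'.symm
  subst this
  rfl

namespace IsMating

variable {m : ℕ → V → V}

/-- The graph formed by the matchings of a mating. -/
def toGraph (hm : IsMating D m) : SimpleGraph V where
  Adj v w := ∃ d ∈ D, m d v = w
  symm := ⟨fun v w ⟨d, hd, h⟩ => ⟨d, hd, by rw [← h, hm.invol]⟩⟩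
  loopless := ⟨fun v ⟨d, hd, h⟩ => hm.ne d hd v h⟩

/-- The colour does not depend on the orientation of the edge, because each `m d` is an involution.
-/
theorem exists_colour (hm : IsMating D m) (e : hm.toGraph.edgeSet) :
    ∃ d : D, ∀ v w, e.1 = s(v, w) → m d v = w := by
  obtain ⟨e, he⟩ := e
  induction e with | _ v w
  obtain ⟨d, hd, h⟩ := he
  refine ⟨⟨d, hd⟩, ?_⟩
  intro v' w' h'
  rcases Sym2.eq_iff.1 h' with ⟨rfl, rfl⟩ | ⟨rfl, rfl⟩
  · exact h
  · have h2 : m d v = w := h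
    change m d w = v
    rw [← h2, hm.invol]

/-- The coloured graph with the given matchings as colour classes. -/
noncomputable def toColouredGraph (hm : IsMating D m) : ColouredGraph V D where
  graph := hm.toGraph
  colour e := (hm.exists_colour e).choose
  perfect v d := by
    refine ⟨m d v, ⟨⟨d, d.2, rfl⟩, ?_⟩, ?_⟩
    · have h := (hm.exists_colour ⟨s(v, m d v), ⟨d, d.2, rfl⟩⟩).choose_spec v _ rfl
      exact Subtype.ext (hm.eq_of_eq _ (Subtype.prop _) _ d.2 v h)
    · rintro w ⟨hw, rfl⟩
      exact ((hm.exists_colour ⟨s(v, w), hw⟩).choose_spec v w rfl).symm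

theorem mate_toColouredGraph (hm : IsMating D m) : hm.toColouredGraph.mate = m := by
  funext d v
  by_cases hd : d ∈ D
  · have h : hm.toColouredGraph.graph.Adj v (m d v) := ⟨d, hd, rfl⟩
    have h2 := (hm.exists_colour ⟨s(v, m d v), h⟩).choose_spec v _ rfl
    have h3 := hm.eq_of_eq _ (Subtype.prop _) _ hd v h2
    exact (hm.toColouredGraph.hasColour_iff.1 ⟨h, h3⟩).2
  · rw [hm.eq_self d hd, hm.toColouredGraph.isMating.eq_self d hd]

theorem injective (hm : IsMating D m) (d : ℕ) : Function.Injective (m d) :=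
  (show Function.Involutive (m d) from hm.invol d).injective

theorem eq_iff (hm : IsMating D m) {d : ℕ} {v w : V} : m d v = w ↔ m d w = v :=
  ⟨fun h => by rw [← h, hm.invol], fun h => by rw [← h, hm.invol]⟩

end IsMating

end ColouredGraph

/-! ### Gadgets encoded by four colours -/

namespace ColouredGraph

variable {V : Type*} {D : Finset ℕ} {c : ℕ} {P : Fin 4 → Finset ℕ}

/-- The colours in the parts `P i` are distinct colours in `D`, and `c` is not in `D`. -/
structure IsPalette (D : Finset ℕ) (c : ℕ) (P : Fin 4 → Finset ℕ) : Prop where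
  notMem : c ∉ D
  subset : ∀ i, P i ⊆ D
  disjoint : ∀ i j, i ≠ j → Disjoint (P i) (P j)

namespace IsPalette

theorem ne (hP : IsPalette D c P) {i j : Fin 4} (hij : i ≠ j) {a b : ℕ} (ha : a ∈ P i)
    (hb : b ∈ P j) : a ≠ b :=
  Finset.disjoint_iff_ne.1 (hP.disjoint i j hij) a ha b hb

theorem ne_c (hP : IsPalette D c P) {i : Fin 4} {a : ℕ} (ha : a ∈ P i) : a ≠ c := by
  rintro rfl
  exact hP.notMem (hP.subset i ha)

theorem mem (hP : IsPalette D c P) {i : Fin 4} {a : ℕ} (ha : a ∈ P i) : a ∈ insert c D :=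
  Finset.mem_insert_of_mem (hP.subset i ha)

end IsPalette

/-- The colours `(d₁, d₂, d₃, d₄)` of the edges `e₁, e₂, e₃, f` of a potential gadget. -/
abbrev Label := ℕ × ℕ × ℕ × ℕ

/-- The labels with `dᵢ` in the `i`-th part. -/
def labelBox (P : Fin 4 → Finset ℕ) : Finset Label := P 0 ×ˢ P 1 ×ˢ P 2 ×ˢ P 3

theorem mem_labelBox {l : Label} :
    l ∈ labelBox P ↔ l.1 ∈ P 0 ∧ l.2.1 ∈ P 1 ∧ l.2.2.1 ∈ P 2 ∧ l.2.2.2 ∈ P 3 := by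
  simp [labelBox]

/-- The vertices reached from `x` along the colours of a label. -/
def verts (m : ℕ → V → V) (x : V) (c : ℕ) (l : Label) : GadgetVertices V where
  y₁ := m l.1 x
  y₂ := m l.2.1 x
  v₁ := m l.2.2.2 x
  v₂ := m c (m l.2.2.2 x)
  u₁ := m l.1 (m l.2.2.2 x)
  u₂ := m l.2.1 (m c (m l.2.2.2 x))

/-- The label spans a gadget. -/
def IsGadgetLabel (m : ℕ → V → V) (x : V) (c : ℕ) (P : Fin 4 → Finset ℕ) (l : Label) : Prop :=
  l ∈ labelBox P ∧
  [x, (verts m x c l).y₁, (verts m x c l).y₂, (verts m x c l).v₁, (verts m x c l).v₂,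
    (verts m x c l).u₁, (verts m x c l).u₂].Nodup ∧
  m l.2.2.1 (verts m x c l).y₁ = (verts m x c l).y₂ ∧
  m l.2.2.1 (verts m x c l).u₁ = (verts m x c l).u₂

/-- The edge set of the gadget with a given label. -/
def gadgetEdges (m : ℕ → V → V) (x : V) (c : ℕ) (l : Label) : Set (Sym2 V) :=
  (verts m x c l).triangleEdges x ∪ (verts m x c l).cycleEdges ∪ {s(x, (verts m x c l).v₁)}

/-- The edge `e₃ = y₁ y₂`. -/
def topEdge (m : ℕ → V → V) (x : V) (c : ℕ) (l : Label) : Sym2 V :=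
  s((verts m x c l).y₁, (verts m x c l).y₂)

/-- The edge `e₃' = u₁ u₂`. -/
def farEdge (m : ℕ → V → V) (x : V) (c : ℕ) (l : Label) : Sym2 V :=
  s((verts m x c l).u₁, (verts m x c l).u₂)

/-- The `c`-edge `e = v₁ v₂`. -/
def baseEdge (m : ℕ → V → V) (x : V) (c : ℕ) (l : Label) : Sym2 V :=
  s((verts m x c l).v₁, (verts m x c l).v₂)

theorem mem_gadgetEdges {m : ℕ → V → V} {x : V} {l : Label} {e : Sym2 V} :
    e ∈ gadgetEdges m x c l ↔
      e = s(x, m l.1 x) ∨ e = s(x, m l.2.1 x) ∨ e = topEdge m x c l ∨ e = baseEdge m x c l ∨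
      e = s(m l.1 (m l.2.2.2 x), m l.2.2.2 x) ∨
      e = s(m l.2.1 (m c (m l.2.2.2 x)), m c (m l.2.2.2 x)) ∨ e = farEdge m x c l ∨
      e = s(x, m l.2.2.2 x) := by
  simp only [gadgetEdges, GadgetVertices.triangleEdges, GadgetVertices.cycleEdges, verts, topEdge,
    baseEdge, farEdge, Set.mem_union, Set.mem_insert_iff, Set.mem_singleton_iff]
  tauto

variable {G : ColouredGraph V (insert c D)} {x : V}

/-- The colour of every edge of a gadget. -/
theorem IsGadgetLabel.hasColour (hP : IsPalette D c P) {l : Label}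
    (hl : IsGadgetLabel G.mate x c P l) {e : Sym2 V} (he : e ∈ gadgetEdges G.mate x c l) :
    (G.HasColour l.1 e ∧ (e = s(x, G.mate l.1 x) ∨
      e = s(G.mate l.1 (G.mate l.2.2.2 x), G.mate l.2.2.2 x))) ∨
    (G.HasColour l.2.1 e ∧ (e = s(x, G.mate l.2.1 x) ∨
      e = s(G.mate l.2.1 (G.mate c (G.mate l.2.2.2 x)), G.mate c (G.mate l.2.2.2 x)))) ∨
    (G.HasColour l.2.2.1 e ∧ (e = topEdge G.mate x c l ∨ e = farEdge G.mate x c l)) ∨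
    (G.HasColour l.2.2.2 e ∧ e = s(x, G.mate l.2.2.2 x)) ∨
    (G.HasColour c e ∧ e = baseEdge G.mate x c l) := by
  obtain ⟨hb, -, h3, h3'⟩ := hl
  obtain ⟨h1, h2, h3m, h4⟩ := mem_labelBox.1 hb
  rcases mem_gadgetEdges.1 he with rfl | rfl | rfl | rfl | rfl | rfl | rfl | rfl
  · exact Or.inl ⟨G.hasColour_iff.2 ⟨hP.mem h1, rfl⟩, Or.inl rfl⟩
  · exact Or.inr (Or.inl ⟨G.hasColour_iff.2 ⟨hP.mem h2, rfl⟩, Or.inl rfl⟩)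
  · exact Or.inr (Or.inr (Or.inl ⟨G.hasColour_iff.2 ⟨hP.mem h3m, h3⟩, Or.inl rfl⟩))
  · exact Or.inr (Or.inr (Or.inr (Or.inr
      ⟨G.hasColour_iff.2 ⟨Finset.mem_insert_self _ _, rfl⟩, rfl⟩)))
  · exact Or.inl ⟨G.hasColour_iff.2 ⟨hP.mem h1, G.isMating.invol _ _⟩, Or.inr rfl⟩
  · exact Or.inr (Or.inl ⟨G.hasColour_iff.2 ⟨hP.mem h2, G.isMating.invol _ _⟩, Or.inr rfl⟩)
  · exact Or.inr (Or.inr (Or.inl ⟨G.hasColour_iff.2 ⟨hP.mem h3m, h3'⟩, Or.inr rfl⟩))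
  · exact Or.inr (Or.inr (Or.inr (Or.inl ⟨G.hasColour_iff.2 ⟨hP.mem h4, rfl⟩, rfl⟩)))

/-- The parts are disjoint and avoid `c`, so a colour from the third part can only sit on e₃ and
e₃'. This turns distinguishability into the absence of a `Clash`. -/
theorem IsGadgetLabel.mem_and_part_two (hP : IsPalette D c P) {l : Label}
    (hl : IsGadgetLabel G.mate x c P l) {e : Sym2 V} :
    (e ∈ gadgetEdges G.mate x c l ∧ ∃ d ∈ P 2, G.HasColour d e) ↔
      e = topEdge G.mate x c l ∨ e = farEdge G.mate x c l := by
  obtain ⟨h1, h2, h3, h4⟩ := mem_labelBox.1 hl.1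
  constructor
  · rintro ⟨he, d, hd, hc⟩
    rcases hl.hasColour hP he with ⟨h, -⟩ | ⟨h, -⟩ | ⟨-, h⟩ | ⟨h, -⟩ | ⟨h, -⟩
    · exact absurd (hc.unique h) (hP.ne (by decide) hd h1)
    · exact absurd (hc.unique h) (hP.ne (by decide) hd h2)
    · exact h
    · exact absurd (hc.unique h) (hP.ne (by decide) hd h4)
    · exact absurd (hc.unique h) (hP.ne_c hd)
  · rintro (rfl | rfl)
    · exact ⟨mem_gadgetEdges.2 (by tauto), _, h3, G.hasColour_iff.2 ⟨hP.mem h3, hl.2.2.1⟩⟩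
    · exact ⟨mem_gadgetEdges.2 (by tauto), _, h3, G.hasColour_iff.2 ⟨hP.mem h3, hl.2.2.2⟩⟩

theorem IsGadgetLabel.mem_of_hasColour (hP : IsPalette D c P) {l : Label}
    (hl : IsGadgetLabel G.mate x c P l) {e : Sym2 V} (hc : G.HasColour c e) :
    e ∈ gadgetEdges G.mate x c l ↔ e = baseEdge G.mate x c l := by
  obtain ⟨h1, h2, h3, h4⟩ := mem_labelBox.1 hl.1
  constructor
  · intro he
    rcases hl.hasColour hP he with ⟨h, -⟩ | ⟨h, -⟩ | ⟨h, -⟩ | ⟨h, -⟩ | ⟨-, h⟩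
    · exact absurd (hc.unique h).symm (hP.ne_c h1)
    · exact absurd (hc.unique h).symm (hP.ne_c h2)
    · exact absurd (hc.unique h).symm (hP.ne_c h3)
    · exact absurd (hc.unique h).symm (hP.ne_c h4)
    · exact h
  · rintro rfl
    exact mem_gadgetEdges.2 (by tauto)

theorem IsGadgetLabel.colour_mem (hP : IsPalette D c P) {l : Label}
    (hl : IsGadgetLabel G.mate x c P l) {e : Sym2 V} (he : e ∈ gadgetEdges G.mate x c l) {d : ℕ}
    (hd : G.HasColour d e) :
    (d ∈ P 0 → d = l.1) ∧ (d ∈ P 1 → d = l.2.1) ∧ (d ∈ P 2 → d = l.2.2.1) ∧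
      (d ∈ P 3 → d = l.2.2.2) := by
  obtain ⟨h1, h2, h3, h4⟩ := mem_labelBox.1 hl.1
  have n01 := fun {a b} => @IsPalette.ne D c P hP 0 1 (by decide) a b
  have n02 := fun {a b} => @IsPalette.ne D c P hP 0 2 (by decide) a b
  have n03 := fun {a b} => @IsPalette.ne D c P hP 0 3 (by decide) a b
  have n12 := fun {a b} => @IsPalette.ne D c P hP 1 2 (by decide) a b
  have n13 := fun {a b} => @IsPalette.ne D c P hP 1 3 (by decide) a b
  have n23 := fun {a b} => @IsPalette.ne D c P hP 2 3 (by decide) a b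
  have n0 := fun {a} => @IsPalette.ne_c D c P hP 0 a
  have n1 := fun {a} => @IsPalette.ne_c D c P hP 1 a
  have n2 := fun {a} => @IsPalette.ne_c D c P hP 2 a
  have n3 := fun {a} => @IsPalette.ne_c D c P hP 3 a
  rcases hl.hasColour hP he with ⟨h, -⟩ | ⟨h, -⟩ | ⟨h, -⟩ | ⟨h, -⟩ | ⟨h, -⟩ <;>
    obtain rfl := hd.unique h
  · exact ⟨fun _ => rfl, fun h => absurd rfl (n01 h1 h), fun h => absurd rfl (n02 h1 h),
      fun h => absurd rfl (n03 h1 h)⟩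
  · exact ⟨fun h => absurd rfl (n01 h h2), fun _ => rfl, fun h => absurd rfl (n12 h2 h),
      fun h => absurd rfl (n13 h2 h)⟩
  · exact ⟨fun h => absurd rfl (n02 h h3), fun h => absurd rfl (n12 h h3), fun _ => rfl,
      fun h => absurd rfl (n23 h3 h)⟩
  · exact ⟨fun h => absurd rfl (n03 h h4), fun h => absurd rfl (n13 h h4),
      fun h => absurd rfl (n23 h h4), fun _ => rfl⟩
  · exact ⟨fun h => absurd rfl (n0 h), fun h => absurd rfl (n1 h), fun h => absurd rfl (n2 h),
      fun h => absurd rfl (n3 h)⟩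

/-- The label is read off from the edge set: in each part exactly one colour occurs on the edges of
a gadget. Counting edge sets is therefore counting labels. -/
theorem IsGadgetLabel.eq_of_edges_eq (hP : IsPalette D c P) {l l' : Label}
    (hl : IsGadgetLabel G.mate x c P l) (hl' : IsGadgetLabel G.mate x c P l')
    (h : gadgetEdges G.mate x c l = gadgetEdges G.mate x c l') : l = l' := by
  obtain ⟨h1, h2, h3, h4⟩ := mem_labelBox.1 hl.1
  have e1 : s(x, G.mate l.1 x) ∈ gadgetEdges G.mate x c l := mem_gadgetEdges.2 (by tauto)
  have e2 : s(x, G.mate l.2.1 x) ∈ gadgetEdges G.mate x c l := mem_gadgetEdges.2 (by tauto)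
  have e3 : topEdge G.mate x c l ∈ gadgetEdges G.mate x c l := mem_gadgetEdges.2 (by tauto)
  have e4 : s(x, G.mate l.2.2.2 x) ∈ gadgetEdges G.mate x c l := mem_gadgetEdges.2 (by tauto)
  rw [h] at e1 e2 e3 e4
  have k1 := (hl'.colour_mem hP e1 (G.hasColour_iff.2 ⟨hP.mem h1, rfl⟩)).1 h1
  have k2 := (hl'.colour_mem hP e2 (G.hasColour_iff.2 ⟨hP.mem h2, rfl⟩)).2.1 h2
  have k3 := (hl'.colour_mem hP e3 (G.hasColour_iff.2 ⟨hP.mem h3, hl.2.2.1⟩)).2.2.1 h3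
  have k4 := (hl'.colour_mem hP e4 (G.hasColour_iff.2 ⟨hP.mem h4, rfl⟩)).2.2.2 h4
  exact Prod.ext k1 (Prod.ext k2 (Prod.ext k3 k4))

/-- The colours of e₁, e₂, f and `c` force all vertices, leaving only distinctness and the two edges
in the third colour as conditions. -/
theorem isGadget_iff (hP : IsPalette D c P) {J : Set (Sym2 V)} :
    G.IsGadget x c P J ↔ ∃ l, IsGadgetLabel G.mate x c P l ∧ J = gadgetEdges G.mate x c l := by
  constructor
  · rintro ⟨g, ⟨hnd, -, -, hc, ⟨a, ha, ha'⟩, ⟨b, hb, hb'⟩, ⟨d, -, hd, hd'⟩⟩, ⟨d1, h1, h1'⟩,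
      ⟨d2, h2, h2'⟩, ⟨d3, h3, h3'⟩, ⟨d4, h4, h4'⟩, rfl⟩
    obtain rfl := ha.unique h1'
    obtain rfl := hb.unique h2'
    obtain rfl := hd.unique h3'
    have hbase : G.HasColour c s(g.v₁, g.v₂) :=
      (hc _ (by simp [GadgetVertices.cycleEdges])).2 rfl
    -- The edges e₁', e₂' are turned round so that u₁, u₂ appear as the mates of v₁, v₂, as in
    -- `verts`.
    rw [Sym2.eq_swap] at ha' hb'
    have t1 := (G.hasColour_iff.1 ha).2
    have t2 := (G.hasColour_iff.1 hb).2
    have t3 := (G.hasColour_iff.1 h4').2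
    have t4 := (G.hasColour_iff.1 hbase).2
    have t5 := (G.hasColour_iff.1 ha').2
    have t6 := (G.hasColour_iff.1 hb').2
    have hg : verts G.mate x c (a, b, d, d4) = g := by
      simp only [verts, t1, t2, t3, t4, t5, t6]
    refine ⟨(a, b, d, d4), ⟨mem_labelBox.2 ⟨h1, h2, h3, h4⟩, ?_, ?_, ?_⟩, ?_⟩
    · rw [hg]; exact hnd
    · rw [hg]; exact (G.hasColour_iff.1 hd).2
    · rw [hg]; exact (G.hasColour_iff.1 hd').2
    · rw [gadgetEdges, hg]
  · rintro ⟨l, hl, rfl⟩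
    obtain ⟨h1, h2, h3, h4⟩ := mem_labelBox.1 hl.1
    have c1 : G.HasColour l.1 s(x, (verts G.mate x c l).y₁) :=
      G.hasColour_iff.2 ⟨hP.mem h1, rfl⟩
    have c2 : G.HasColour l.2.1 s(x, (verts G.mate x c l).y₂) :=
      G.hasColour_iff.2 ⟨hP.mem h2, rfl⟩
    have c3 : G.HasColour l.2.2.1 s((verts G.mate x c l).y₁, (verts G.mate x c l).y₂) :=
      G.hasColour_iff.2 ⟨hP.mem h3, hl.2.2.1⟩
    have c4 : G.HasColour l.2.2.2 s(x, (verts G.mate x c l).v₁) :=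
      G.hasColour_iff.2 ⟨hP.mem h4, rfl⟩
    have c1' : G.HasColour l.1 s((verts G.mate x c l).u₁, (verts G.mate x c l).v₁) :=
      G.hasColour_iff.2 ⟨hP.mem h1, G.isMating.invol _ _⟩
    have c2' : G.HasColour l.2.1 s((verts G.mate x c l).u₂, (verts G.mate x c l).v₂) :=
      G.hasColour_iff.2 ⟨hP.mem h2, G.isMating.invol _ _⟩
    have c3' : G.HasColour l.2.2.1 s((verts G.mate x c l).u₁, (verts G.mate x c l).u₂) :=
      G.hasColour_iff.2 ⟨hP.mem h3, hl.2.2.2⟩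
    have cc : G.HasColour c s((verts G.mate x c l).v₁, (verts G.mate x c l).v₂) :=
      G.hasColour_iff.2 ⟨Finset.mem_insert_self _ _, rfl⟩
    refine ⟨verts G.mate x c l, ⟨hl.2.1, ?_, ?_, ?_, ⟨_, c1, c1'⟩, ⟨_, c2, c2'⟩,
      ⟨_, hP.ne_c h3, c3, c3'⟩⟩, ⟨_, h1, c1⟩, ⟨_, h2, c2⟩, ⟨_, h3, c3⟩, ⟨_, h4, c4⟩, rfl⟩
    · rintro e (rfl | rfl | rfl)
      exacts [c1.1, c2.1, c3.1]
    · rintro e (rfl | rfl | rfl | rfl)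
      exacts [cc.1, c1'.1, c2'.1, c3'.1]
    · intro e he
      refine ⟨fun hc => (hl.mem_of_hasColour hP hc).1 (Or.inl (Or.inr he)), ?_⟩
      rintro rfl
      exact cc

/-- Two labels span gadgets that share an edge with colour in the third part. -/
def Clash (m : ℕ → V → V) (x : V) (c : ℕ) (l l' : Label) : Prop :=
  topEdge m x c l = topEdge m x c l' ∨ topEdge m x c l = farEdge m x c l' ∨
    farEdge m x c l = topEdge m x c l' ∨ farEdge m x c l = farEdge m x c l'

/-- The label spans a distinguishable gadget. -/
def IsDistLabel (m : ℕ → V → V) (x : V) (c : ℕ) (P : Fin 4 → Finset ℕ) (l : Label) : Prop :=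
  IsGadgetLabel m x c P l ∧ ∀ l', IsGadgetLabel m x c P l' → l' ≠ l → ¬ Clash m x c l l'

theorem isDistinguishable_iff (hP : IsPalette D c P) {J : Set (Sym2 V)} :
    G.IsDistinguishable x c P J ↔
      ∃ l, IsDistLabel G.mate x c P l ∧ J = gadgetEdges G.mate x c l := by
  constructor
  · rintro ⟨hJ, hd⟩
    obtain ⟨l, hl, rfl⟩ := (isGadget_iff hP).1 hJ
    refine ⟨l, ⟨hl, fun l' hl' hne hcl => ?_⟩, rfl⟩
    have hno := fun e he => hd _ ((isGadget_iff hP).2 ⟨l', hl', rfl⟩)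
      (fun h => hne (hl'.eq_of_edges_eq hP hl h)) e ((hl.mem_and_part_two hP).2 he).1
      ((hl.mem_and_part_two hP).2 he).2
    have hin := fun e he => ((hl'.mem_and_part_two (e := e) hP).2 he).1
    rcases hcl with h | h | h | h
    · exact hno _ (Or.inl rfl) (hin _ (Or.inl h))
    · exact hno _ (Or.inl rfl) (hin _ (Or.inr h))
    · exact hno _ (Or.inr rfl) (hin _ (Or.inl h))
    · exact hno _ (Or.inr rfl) (hin _ (Or.inr h))
  · rintro ⟨l, ⟨hl, hd⟩, rfl⟩
    refine ⟨(isGadget_iff hP).2 ⟨l, hl, rfl⟩, ?_⟩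
    intro J' hJ' hne e he hc he'
    obtain ⟨l', hl', rfl⟩ := (isGadget_iff hP).1 hJ'
    refine hd l' hl' (fun h => hne (by rw [h])) ?_
    have k := (hl.mem_and_part_two hP).1 ⟨he, hc⟩
    have k' := (hl'.mem_and_part_two hP).1 ⟨he', hc⟩
    rcases k with rfl | rfl <;> rcases k' with h | h
    · exact Or.inl h
    · exact Or.inr (Or.inl h)
    · exact Or.inr (Or.inr (Or.inl h))
    · exact Or.inr (Or.inr (Or.inr h))

open Classical in
/-- The labels of distinguishable gadgets with a given `c`-edge. -/
noncomputable def satLabels (m : ℕ → V → V) (x : V) (c : ℕ) (P : Fin 4 → Finset ℕ)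
    (e : Sym2 V) : Finset Label :=
  (labelBox P).filter fun l => IsDistLabel m x c P l ∧ baseEdge m x c l = e

theorem mem_satLabels {m : ℕ → V → V} {e : Sym2 V} {l : Label} :
    l ∈ satLabels m x c P e ↔ IsDistLabel m x c P l ∧ baseEdge m x c l = e := by
  simp only [satLabels, Finset.mem_filter, and_iff_right_iff_imp]
  exact fun h => h.1.1.1

theorem sat_eq (hP : IsPalette D c P) {e : Sym2 V} (he : G.HasColour c e) :
    G.sat x c P e = (satLabels G.mate x c P e).card := by
  rw [sat, ← Set.ncard_coe_finset, ← Set.InjOn.ncard_image (f := gadgetEdges G.mate x c)]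
  · congr 1
    ext J
    simp only [Set.mem_ofPred_eq, Set.mem_image, Finset.mem_coe, mem_satLabels]
    constructor
    · rintro ⟨hJ, heJ⟩
      obtain ⟨l, hl, rfl⟩ := (isDistinguishable_iff hP).1 hJ
      exact ⟨l, ⟨hl, ((hl.1.mem_of_hasColour hP he).1 heJ).symm⟩, rfl⟩
    · rintro ⟨l, ⟨hl, rfl⟩, rfl⟩
      exact ⟨(isDistinguishable_iff hP).2 ⟨l, hl, rfl⟩, (hl.1.mem_of_hasColour hP he).2 rfl⟩
  · intro l hl l' hl' h
    exact (mem_satLabels.1 hl).1.1.eq_of_edges_eq hP (mem_satLabels.1 hl').1.1 h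

open Classical in
/-- The `c`-edges of a mating. -/
noncomputable def colourEdges [Fintype V] (m : ℕ → V → V) (c : ℕ) : Finset (Sym2 V) :=
  Finset.univ.image fun v => s(v, m c v)

theorem mem_colourEdges [Fintype V] {e : Sym2 V} :
    e ∈ colourEdges G.mate c ↔ G.HasColour c e := by
  classical
  simp only [colourEdges, Finset.mem_image, Finset.mem_univ, true_and]
  constructor
  · rintro ⟨v, rfl⟩
    exact G.hasColour_iff.2 ⟨Finset.mem_insert_self _ _, rfl⟩
  · intro h
    induction e with | _ v w
    exact ⟨v, by rw [(G.hasColour_iff.1 h).2]⟩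

/-- The capped number of distinguishable gadgets, in terms of labels. -/
noncomputable def labelCount [Fintype V] (D : Finset ℕ) (m : ℕ → V → V) (x : V) (c : ℕ)
    (P : Fin 4 → Finset ℕ) : ℕ :=
  ∑ e ∈ colourEdges m c, min D.card (satLabels m x c P e).card

/-- Saturated edges contribute |D| and the others their saturation, so r(G) is a single sum of
minima. -/
theorem gadgetCount_eq [Fintype V] (hP : IsPalette D c P) :
    gadgetCount x P G = labelCount D G.mate x c P := by
  classical
  have h1 : satEdges x P G =
      (colourEdges G.mate c).filter fun e => D.card ≤ (satLabels G.mate x c P e).card := by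
    ext e
    simp only [satEdges, Finset.mem_filter, Finset.mem_univ, true_and, mem_colourEdges]
    exact and_congr_right fun h => by rw [sat_eq hP h]
  have h2 : unsatEdges x P G =
      (colourEdges G.mate c).filter fun e => ¬ D.card ≤ (satLabels G.mate x c P e).card := by
    ext e
    simp only [unsatEdges, Finset.mem_filter, Finset.mem_univ, true_and, mem_colourEdges]
    exact and_congr_right fun h => by rw [sat_eq hP h]
  rw [gadgetCount, labelCount, h1, h2, ← Finset.sum_filter_add_sum_filter_not (colourEdges G.mate c)
    (fun e => D.card ≤ (satLabels G.mate x c P e).card)]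
  congr 1
  · rw [mul_comm, ← smul_eq_mul, ← Finset.sum_const]
    refine Finset.sum_congr rfl fun e he => ?_
    rw [min_eq_left (Finset.mem_filter.1 he).2]
  · refine Finset.sum_congr rfl fun e he => ?_
    obtain ⟨he, h⟩ := Finset.mem_filter.1 he
    rw [sat_eq hP (mem_colourEdges.1 he), min_eq_right (by omega)]

end ColouredGraph

/-! ### Stability of isolated elements under removal and insertion -/

section Isolated

variable {L E : Type*} [DecidableEq E]

/-- `l` belongs to `S` and no other element of `S` shares one of the two values `t` and `f` with
it. -/
def IsIsolated (S : Finset L) (t f : L → E) (l : L) : Prop :=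
  l ∈ S ∧ ∀ l' ∈ S, l' ≠ l → ¬ (t l = t l' ∨ t l = f l' ∨ f l = t l' ∨ f l = f l')

/-- The values `t`, together with the values `f` of those elements which share their value `t` with
at most `k` elements. -/
def fragile (S : Finset L) (t f : L → E) (k : ℕ) : Finset E :=
  S.image t ∪ (S.filter fun l => (S.filter fun l' => t l' = t l).card ≤ k).image f

/-- Each value of `t` is taken by at most `k` of the elements contributing a value `f`, so there are
at most `k` such contributions per value of `t`, besides that value itself. -/
theorem card_fragile_le (S : Finset L) (t f : L → E) (k : ℕ) :
    (fragile S t f k).card ≤ (k + 1) * (S.image t).card := by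
  refine (Finset.card_union_le _ _).trans ?_
  have h : ((S.filter fun l => (S.filter fun l' => t l' = t l).card ≤ k).image f).card ≤
      k * (S.image t).card := by
    refine Finset.card_image_le.trans ?_
    refine Finset.card_le_mul_card_image_of_maps_to (f := t)
      (fun l hl => Finset.mem_image_of_mem t (Finset.mem_filter.1 hl).1) k ?_
    intro b _
    by_cases hb : ∃ l ∈ S, (S.filter fun l' => t l' = t l).card ≤ k ∧ t l = b
    · obtain ⟨l, hl, hk, rfl⟩ := hb
      refine (Finset.card_le_card ?_).trans hk
      intro a ha
      simp only [Finset.mem_filter] at ha ⊢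
      exact ⟨ha.1.1, ha.2⟩
    · rw [Finset.card_eq_zero.2]
      · exact Nat.zero_le _
      · refine Finset.filter_eq_empty_iff.2 fun l hl h => hb ?_
        exact ⟨l, (Finset.mem_filter.1 hl).1, (Finset.mem_filter.1 hl).2, h⟩
  linarith

/-- Removing a few values that are not fragile and adding one element with new values preserves all
other isolated elements. -/
theorem isIsolated_iff_of_remove_insert [DecidableEq L] {S S' : Finset L} {t f : L → E}
    {R : Finset E} {l₀ : L}
    {k r : ℕ} (hR : R.card ≤ r) (hk : 2 * r + 1 ≤ k) (hk0 : 1 ≤ k)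
    (htwo : ∀ a b, (S.filter fun l => t l = a ∧ f l = b).card ≤ 2)
    (hfrag : ∀ e ∈ R, e ∉ fragile S t f k)
    (hS' : ∀ l, l ∈ S' ↔ l = l₀ ∨ (l ∈ S ∧ t l ∉ R ∧ f l ∉ R))
    (hl₀ : ∀ l ∈ S, t l₀ ≠ t l ∧ t l₀ ≠ f l ∧ f l₀ ≠ t l ∧ f l₀ ≠ f l) (l : L) :
    IsIsolated S' t f l ↔ l = l₀ ∨ IsIsolated S t f l := by
  have hlight : ∀ l ∈ S, (S.filter fun l' => t l' = t l).card ≤ k → t l ∉ R ∧ f l ∉ R := by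
    intro l hl hc
    constructor
    · exact fun h => hfrag _ h (Finset.mem_union_left _ (Finset.mem_image_of_mem _ hl))
    · exact fun h => hfrag _ h (Finset.mem_union_right _ (Finset.mem_image_of_mem _
        (Finset.mem_filter.2 ⟨hl, hc⟩)))
  have htR : ∀ l ∈ S, t l ∉ R := fun l hl h =>
    hfrag _ h (Finset.mem_union_left _ (Finset.mem_image_of_mem _ hl))
  constructor
  · rintro ⟨hl, hiso⟩
    rcases (hS' l).1 hl with rfl | ⟨hlS, -, hfl⟩
    · exact Or.inl rfl
    refine Or.inr ⟨hlS, fun l' hl' hne hsh => ?_⟩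
    -- If `l` is isolated only after the change, its partner `l'` was deleted. As no value of `t` is
    -- removed, `f l'` lies in `R`, so the value shared with `l` is `t l'`.
    have hl'S' : l' ∉ S' := fun h => hiso l' h hne hsh
    have hfl' : f l' ∈ R := by
      by_contra h
      exact hl'S' ((hS' l').2 (Or.inr ⟨hl', htR _ hl', h⟩))
    have hshare : t l' = t l ∨ t l' = f l := by
      rcases hsh with h | h | h | h
      · exact Or.inl h.symm
      · exact absurd (h ▸ hfl') (htR _ hlS)
      · exact Or.inr h.symm
      · exact absurd (h ▸ hfl') hfl
    refine absurd hfl' (hlight l' hl' (le_trans ?_ hk)).2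
    -- All elements with value `t l'`, except possibly `l`, must have been deleted too, so their
    -- values `f` lie in `R`. There are then at most 2|R| + 1 ≤ k of them, which makes `f l'`
    -- fragile, a contradiction.
    have hsub : (S.filter fun l'' => t l'' = t l') ⊆
        insert l (R.biUnion fun b => S.filter fun l'' => t l'' = t l' ∧ f l'' = b) := by
      intro a ha
      obtain ⟨haS, hta⟩ := Finset.mem_filter.1 ha
      by_cases hal : a = l
      · exact hal ▸ Finset.mem_insert_self _ _
      refine Finset.mem_insert_of_mem ?_
      simp only [Finset.mem_biUnion, Finset.mem_filter]
      refine ⟨f a, ?_, haS, hta, rfl⟩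
      by_contra h
      refine hiso a ((hS' a).2 (Or.inr ⟨haS, htR _ haS, h⟩)) hal ?_
      rcases hshare with h | h
      · exact Or.inl (by rw [hta, h])
      · exact Or.inr (Or.inr (Or.inl (by rw [hta, h])))
    refine (Finset.card_le_card hsub).trans ((Finset.card_insert_le _ _).trans ?_)
    have := Finset.card_biUnion_le_card_mul R
      (fun b => S.filter fun l'' => t l'' = t l' ∧ f l'' = b) 2 (fun b _ => htwo _ b)
    omega
  · rintro (rfl | ⟨hl, hiso⟩)
    · refine ⟨(hS' l).2 (Or.inl rfl), fun l' hl' hne h => ?_⟩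
      rcases (hS' l').1 hl' with rfl | ⟨hlS, -, -⟩
      · exact hne rfl
      · have := hl₀ l' hlS
        tauto
    · have hcard : (S.filter fun l' => t l' = t l).card ≤ k := by
        refine le_trans ?_ hk0
        refine Finset.card_le_one.2 fun a ha b hb => ?_
        have : ∀ a ∈ S.filter fun l' => t l' = t l, a = l := by
          intro a ha
          by_contra h
          exact hiso a (Finset.mem_filter.1 ha).1 h (Or.inl (Finset.mem_filter.1 ha).2.symm)
        rw [this a ha, this b hb]
      obtain ⟨h1, h2⟩ := hlight l hl hcard
      refine ⟨(hS' l).2 (Or.inr ⟨hl, h1, h2⟩), fun l' hl' hne h => ?_⟩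
      rcases (hS' l').1 hl' with rfl | ⟨hlS, -, -⟩
      · have := hl₀ l hl
        rcases h with h | h | h | h
        · exact this.1 h.symm
        · exact this.2.2.1 h.symm
        · exact this.2.1 h.symm
        · exact this.2.2.2 h.symm
      · exact hiso l' hlS hne h

end Isolated

/-! ### Rotations of a perfect matching -/

namespace ColouredGraph

section Rotation

variable {V : Type*}

open Classical in
/-- Replace the pairs `{a, f a}, {b, f b}, {z, f z}` of the perfect matching `f` by
`{a, b}, {f a, z}, {f b, f z}`. -/
noncomputable def rot (f : V → V) (a b z v : V) : V :=
  if v = a then b else if v = b then a else if v = f a then z else if v = z then f a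
    else if v = f b then f z else if v = f z then f b else f v

/-- The six vertices involved in a rotation are distinct. -/
def RotNodup (f : V → V) (a b z : V) : Prop := [a, b, f a, f b, z, f z].Nodup

variable {f : V → V} {a b z : V}

theorem rot_of_notMem {v : V} (hv : v ∉ [a, b, f a, f b, z, f z]) : rot f a b z v = f v := by
  simp only [List.mem_cons, List.not_mem_nil, or_false, not_or] at hv
  simp [rot, hv]

theorem RotNodup.values (hn : RotNodup f a b z) :
    rot f a b z a = b ∧ rot f a b z b = a ∧ rot f a b z (f a) = z ∧ rot f a b z z = f a ∧
      rot f a b z (f b) = f z ∧ rot f a b z (f z) = f b := by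
  simp only [RotNodup, List.nodup_cons, List.mem_cons, List.not_mem_nil, or_false, not_or] at hn
  obtain ⟨⟨h1, h2, h3, h4, h5⟩, ⟨h6, h7, h8, h9⟩, ⟨h10, h11, h12⟩, ⟨h13, h14⟩, h15, -⟩ := hn
  simp [rot, Ne.symm h1, Ne.symm h2, Ne.symm h3,
    Ne.symm h4, Ne.symm h5, Ne.symm h6, Ne.symm h7, Ne.symm h8,
    Ne.symm h9, Ne.symm h10, Ne.symm h11, Ne.symm h12, h13, Ne.symm h14, Ne.symm h15]

theorem apply_notMem_of_notMem (hf : ∀ v, f (f v) = v) {v : V}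
    (hv : v ∉ [a, b, f a, f b, z, f z]) : f v ∉ [a, b, f a, f b, z, f z] := by
  have k : ∀ p, f v = p → v = f p := fun p h => by rw [← h, hf]
  have k' : ∀ p, f v = f p → v = p := fun p h => by rw [← hf v, h, hf]
  simp only [List.mem_cons, List.not_mem_nil, or_false, not_or] at hv ⊢
  exact ⟨fun h => hv.2.2.1 (k _ h), fun h => hv.2.2.2.1 (k _ h), fun h => hv.1 (k' _ h),
    fun h => hv.2.1 (k' _ h), fun h => hv.2.2.2.2.2 (k _ h), fun h => hv.2.2.2.2.1 (k' _ h)⟩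

theorem rot_invol (hf : ∀ v, f (f v) = v) (hn : RotNodup f a b z) (v : V) :
    rot f a b z (rot f a b z v) = v := by
  obtain ⟨h1, h2, h3, h4, h5, h6⟩ := hn.values
  by_cases hv : v ∈ [a, b, f a, f b, z, f z]
  · simp only [List.mem_cons, List.not_mem_nil, or_false] at hv
    rcases hv with rfl | rfl | rfl | rfl | rfl | rfl
    · rw [h1, h2]
    · rw [h2, h1]
    · rw [h3, h4]
    · rw [h5, h6]
    · rw [h4, h3]
    · rw [h6, h5]
  · rw [rot_of_notMem hv, rot_of_notMem (apply_notMem_of_notMem hf hv), hf]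

theorem rot_ne (hne : ∀ v, f v ≠ v) (hn : RotNodup f a b z) (v : V) :
    rot f a b z v ≠ v := by
  obtain ⟨h1, h2, h3, h4, h5, h6⟩ := hn.values
  simp only [RotNodup, List.nodup_cons, List.mem_cons, List.not_mem_nil, or_false, not_or] at hn
  by_cases hv : v ∈ [a, b, f a, f b, z, f z]
  · simp only [List.mem_cons, List.not_mem_nil, or_false] at hv
    rcases hv with h | h | h | h | h | h <;> rw [h]
    · rw [h1]; exact Ne.symm hn.1.1
    · rw [h2]; exact hn.1.1
    · rw [h3]; exact Ne.symm hn.2.2.1.2.1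
    · rw [h5]; exact Ne.symm hn.2.2.2.1.2
    · rw [h4]; exact hn.2.2.1.2.1
    · rw [h6]; exact hn.2.2.2.1.2
  · rw [rot_of_notMem hv]
    exact hne v

/-- The inverse of a rotation is again a rotation: in the new matching a, f a, f b have mates b, z,
f z, and rotating these three pairs restores {a, f a}, {b, f b}, {z, f z}. -/
theorem rot_rot (hf : ∀ v, f (f v) = v) (hn : RotNodup f a b z) :
    rot (rot f a b z) a (f a) (f b) = f := by
  have hv0 := hn.values
  obtain ⟨h1, h2, h3, h4, h5, h6⟩ := hv0
  have hn' : RotNodup (rot f a b z) a (f a) (f b) := by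
    rw [RotNodup, h1, h3, h5]
    simp only [RotNodup, List.nodup_cons, List.mem_cons, List.not_mem_nil, or_false, not_or] at hn ⊢
    obtain ⟨⟨h1, h2, h3, h4, h5⟩, ⟨h6, h7, h8, h9⟩, ⟨h10, h11, h12⟩, ⟨h13, h14⟩, h15, -⟩ := hn
    refine ⟨⟨h2, h1, h4, h3, h5⟩, ⟨Ne.symm h6, h11, h10, h12⟩, ⟨h8, h7, h9⟩,
      ⟨Ne.symm h13, h15⟩, h14, not_false, List.nodup_nil⟩
  obtain ⟨k1, k2, k3, k4, k5, k6⟩ := hn'.values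
  rw [h1] at k3 k4
  rw [h3] at k5 k6
  rw [h5] at k5 k6
  funext v
  by_cases hv : v ∈ [a, b, f a, f b, z, f z]
  · simp only [List.mem_cons, List.not_mem_nil, or_false] at hv
    rcases hv with h | h | h | h | h | h <;> rw [h]
    · exact k1
    · exact k3
    · rw [k2, hf]
    · rw [k4, hf]
    · exact k5
    · rw [k6, hf]
  · rw [rot_of_notMem, rot_of_notMem hv]
    rw [h1, h3, h5]
    simp only [List.mem_cons, List.not_mem_nil, or_false] at hv ⊢
    tauto

/-- The description by removed and added edges, used from here on in place of the case distinction
on vertices. -/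
theorem rot_eq_iff (hf : ∀ v, f (f v) = v) (hn : RotNodup f a b z) {v w : V} :
    rot f a b z v = w ↔
      (f v = w ∧ s(v, w) ≠ s(a, f a) ∧ s(v, w) ≠ s(b, f b) ∧ s(v, w) ≠ s(z, f z)) ∨
      s(v, w) = s(a, b) ∨ s(v, w) = s(f a, z) ∨ s(v, w) = s(f b, f z) := by
  obtain ⟨h1, h2, h3, h4, h5, h6⟩ := hn.values
  constructor
  · rintro rfl
    by_cases hv : v ∈ [a, b, f a, f b, z, f z]
    · right
      simp only [List.mem_cons, List.not_mem_nil, or_false] at hv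
      rcases hv with h | h | h | h | h | h <;> rw [h]
      · rw [h1]; exact Or.inl rfl
      · rw [h2]; exact Or.inl Sym2.eq_swap
      · rw [h3]; exact Or.inr (Or.inl rfl)
      · rw [h5]; exact Or.inr (Or.inr rfl)
      · rw [h4]; exact Or.inr (Or.inl Sym2.eq_swap)
      · rw [h6]; exact Or.inr (Or.inr Sym2.eq_swap)
    · left
      rw [rot_of_notMem hv]
      simp only [List.mem_cons, List.not_mem_nil, or_false, not_or] at hv
      refine ⟨rfl, fun h => ?_, fun h => ?_, fun h => ?_⟩ <;>
        rcases Sym2.eq_iff.1 h with h | h <;> have := h.1 <;> tauto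
  · rintro (⟨rfl, k1, k2, k3⟩ | h | h | h)
    · refine rot_of_notMem fun hv => ?_
      simp only [List.mem_cons, List.not_mem_nil, or_false] at hv
      rcases hv with h | h | h | h | h | h <;> rw [h] at k1 k2 k3
      · exact k1 rfl
      · exact k2 rfl
      · exact k1 (by rw [hf, Sym2.eq_swap])
      · exact k2 (by rw [hf, Sym2.eq_swap])
      · exact k3 rfl
      · exact k3 (by rw [hf, Sym2.eq_swap])
    all_goals rcases Sym2.eq_iff.1 h with ⟨rfl, rfl⟩ | ⟨rfl, rfl⟩
    all_goals assumption

end Rotation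

variable {V : Type*} {D : Finset ℕ}

open Function in
/-- Rotate the matching of colour `d`. -/
noncomputable def rotate (m : ℕ → V → V) (d : ℕ) (a b z : V) : ℕ → V → V :=
  update m d (rot (m d) a b z)

theorem rotate_self (m : ℕ → V → V) (d : ℕ) (a b z : V) :
    rotate m d a b z d = rot (m d) a b z := by simp [rotate]

theorem rotate_of_ne (m : ℕ → V → V) {d d' : ℕ} (h : d' ≠ d) (a b z : V) :
    rotate m d a b z d' = m d' := by simp [rotate, h]

theorem rotate_rotate {m : ℕ → V → V} (hm : IsMating D m) {d : ℕ} {a b z : V}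
    (hn : RotNodup (m d) a b z) :
    rotate (rotate m d a b z) d a (m d a) (m d b) = m := by
  funext d'
  by_cases h : d' = d
  · subst h
    rw [rotate_self, rotate_self, rot_rot (hm.invol _) hn]
  · rw [rotate_of_ne _ h, rotate_of_ne _ h]

/-- `v` and `w` are matched in some colour. -/
def MAdj (D : Finset ℕ) (m : ℕ → V → V) (v w : V) : Prop := ∃ d ∈ D, m d v = w

theorem IsMating.mAdj_symm {m : ℕ → V → V} (hm : IsMating D m) {v w : V} (h : MAdj D m v w) :
    MAdj D m w v := by
  obtain ⟨d, hd, rfl⟩ := h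
  exact ⟨d, hd, hm.invol _ _⟩

/-- The matchings stay edge-disjoint because the three added edges are absent in every colour. -/
theorem isMating_rotate {m : ℕ → V → V} (hm : IsMating D m) {d : ℕ} (hd : d ∈ D) {a b z : V}
    (hn : RotNodup (m d) a b z) (h1 : ¬ MAdj D m a b) (h2 : ¬ MAdj D m (m d a) z)
    (h3 : ¬ MAdj D m (m d b) (m d z)) : IsMating D (rotate m d a b z) := by
  have key : ∀ d' ∈ D, d' ≠ d → ∀ v, m d' v ≠ rot (m d) a b z v := by
    intro d' hd' hne v h
    have hadj : MAdj D m v (m d' v) := ⟨d', hd', rfl⟩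
    rcases (rot_eq_iff (hm.invol d) hn).1 h.symm with h | h | h | h
    · exact hne (hm.eq_of_eq _ hd' _ hd v h.1.symm)
    all_goals
      rcases Sym2.eq_iff.1 h with ⟨hv, hw⟩ | ⟨hv, hw⟩ <;> rw [hw, hv] at hadj
    · exact h1 hadj
    · exact h1 (hm.mAdj_symm hadj)
    · exact h2 hadj
    · exact h2 (hm.mAdj_symm hadj)
    · exact h3 hadj
    · exact h3 (hm.mAdj_symm hadj)
  refine ⟨?_, ?_, ?_, ?_⟩
  · intro d' v
    by_cases h : d' = d
    · subst h; rw [rotate_self, rot_invol (hm.invol _) hn]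
    · rw [rotate_of_ne _ h, hm.invol]
  · intro d' hd' v
    by_cases h : d' = d
    · subst h; rw [rotate_self]; exact rot_ne (hm.ne _ hd) hn v
    · rw [rotate_of_ne _ h]; exact hm.ne _ hd' v
  · intro d₁ hd₁ d₂ hd₂ v h
    by_cases e1 : d₁ = d <;> by_cases e2 : d₂ = d
    · rw [e1, e2]
    · subst e1
      rw [rotate_self, rotate_of_ne _ e2] at h
      exact absurd h.symm (key d₂ hd₂ e2 v)
    · subst e2
      rw [rotate_self, rotate_of_ne _ e1] at h
      exact absurd h (key d₁ hd₁ e1 v)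
    · rw [rotate_of_ne _ e1, rotate_of_ne _ e2] at h
      exact hm.eq_of_eq _ hd₁ _ hd₂ v h
  · intro d' hd' v
    rw [rotate_of_ne _ (by rintro rfl; exact hd' hd), hm.eq_self _ hd']

/-- Two disjoint rotations in the same colour `d`. -/
noncomputable def rotateTwice (m : ℕ → V → V) (d : ℕ) (a b z a' b' z' : V) : ℕ → V → V :=
  rotate (rotate m d a b z) d a' b' z'

/-- The twelve vertices involved in two rotations are distinct, and no new edge is present. -/
structure CanRotateTwice (D : Finset ℕ) (m : ℕ → V → V) (d : ℕ) (a b z a' b' z' : V) : Prop where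
  nodup : [a, b, m d a, m d b, z, m d z, a', b', m d a', m d b', z', m d z'].Nodup
  ab : ¬ MAdj D m a b
  az : ¬ MAdj D m (m d a) z
  bz : ¬ MAdj D m (m d b) (m d z)
  ab' : ¬ MAdj D m a' b'
  az' : ¬ MAdj D m (m d a') z'
  bz' : ¬ MAdj D m (m d b') (m d z')

open Classical in
/-- The edges removed by two rotations. -/
noncomputable def removedEdges (f : V → V) (a b z a' b' z' : V) : Finset (Sym2 V) :=
  {s(a, f a), s(b, f b), s(z, f z), s(a', f a'), s(b', f b'), s(z', f z')}

open Classical in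
/-- The edges added by two rotations. -/
noncomputable def addedEdges (f : V → V) (a b z a' b' z' : V) : Finset (Sym2 V) :=
  {s(a, b), s(f a, z), s(f b, f z), s(a', b'), s(f a', z'), s(f b', f z')}

section

variable {m : ℕ → V → V} {d : ℕ} {a b z a' b' z' : V}

theorem CanRotateTwice.first (h : CanRotateTwice D m d a b z a' b' z') :
    RotNodup (m d) a b z := by
  have := h.nodup
  simp only [RotNodup, List.nodup_cons, List.mem_cons, List.not_mem_nil, or_false, not_or] at this ⊢
  tauto

theorem CanRotateTwice.rot_eq (h : CanRotateTwice D m d a b z a' b' z') :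
    rot (m d) a b z a' = m d a' ∧ rot (m d) a b z b' = m d b' ∧
      rot (m d) a b z z' = m d z' := by
  have := h.nodup
  simp only [List.nodup_cons, List.mem_cons, List.not_mem_nil, or_false, not_or] at this
  refine ⟨?_, ?_, ?_⟩ <;> apply rot_of_notMem <;>
    simp only [List.mem_cons, List.not_mem_nil, or_false, not_or] <;> grind

theorem CanRotateTwice.second (h : CanRotateTwice D m d a b z a' b' z') :
    RotNodup (rotate m d a b z d) a' b' z' := by
  rw [rotate_self, RotNodup, h.rot_eq.1, h.rot_eq.2.1, h.rot_eq.2.2]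
  have := h.nodup
  simp only [List.nodup_cons, List.mem_cons, List.not_mem_nil, or_false, not_or] at this ⊢
  tauto

theorem CanRotateTwice.rotateTwice_eq_iff (hm : IsMating D m)
    (h : CanRotateTwice D m d a b z a' b' z') {v w : V} :
    rotateTwice m d a b z a' b' z' d v = w ↔
      (m d v = w ∧ s(v, w) ∉ removedEdges (m d) a b z a' b' z') ∨
        s(v, w) ∈ addedEdges (m d) a b z a' b' z' := by
  have h2 := h.second
  rw [rotate_self] at h2
  rw [rotateTwice, rotate_self, rotate_self,
    rot_eq_iff (rot_invol (hm.invol d) h.first) h2, rot_eq_iff (hm.invol d) h.first,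
    h.rot_eq.1, h.rot_eq.2.1, h.rot_eq.2.2]
  have hn := h.nodup
  simp only [List.nodup_cons, List.mem_cons, List.not_mem_nil, or_false, not_or] at hn
  simp only [removedEdges, addedEdges, Finset.mem_insert, Finset.mem_singleton, not_or]
  have k : ∀ p q r t : V, p ≠ r → p ≠ t → s(p, q) ≠ s(r, t) := by
    intro p q r t h1 h2 h3
    rcases Sym2.eq_iff.1 h3 with h | h
    · exact h1 h.1
    · exact h2 h.1
  -- The second rotation does not remove an edge that the first one added, so removals and additions
  -- of the two rotations can be collected.
  have hdis : ∀ e, (e = s(a, b) ∨ e = s(m d a, z) ∨ e = s(m d b, m d z)) →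
      (e ≠ s(a', m d a') ∧ e ≠ s(b', m d b') ∧ e ≠ s(z', m d z')) := by
    obtain ⟨n1, -, n3, n4, -⟩ := hn
    rintro e (rfl | rfl | rfl)
    · exact ⟨k _ _ _ _ n1.2.2.2.2.2.1 n1.2.2.2.2.2.2.2.1,
        k _ _ _ _ n1.2.2.2.2.2.2.1 n1.2.2.2.2.2.2.2.2.1,
        k _ _ _ _ n1.2.2.2.2.2.2.2.2.2.1 n1.2.2.2.2.2.2.2.2.2.2⟩
    · exact ⟨k _ _ _ _ n3.2.2.2.1 n3.2.2.2.2.2.1,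
        k _ _ _ _ n3.2.2.2.2.1 n3.2.2.2.2.2.2.1,
        k _ _ _ _ n3.2.2.2.2.2.2.2.1 n3.2.2.2.2.2.2.2.2⟩
    · exact ⟨k _ _ _ _ n4.2.2.1 n4.2.2.2.2.1,
        k _ _ _ _ n4.2.2.2.1 n4.2.2.2.2.2.1,
        k _ _ _ _ n4.2.2.2.2.2.2.1 n4.2.2.2.2.2.2.2⟩
  have logic : ∀ {A R₁ R₂ N₁ N₂ : Prop}, (N₁ → R₂) →
      ((((A ∧ R₁) ∨ N₁) ∧ R₂) ∨ N₂ ↔ (A ∧ (R₁ ∧ R₂)) ∨ (N₁ ∨ N₂)) := by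
    intros; tauto
  have := logic (A := m d v = w) (N₂ := s(v, w) = s(a', b') ∨ s(v, w) = s(m d a', z') ∨
    s(v, w) = s(m d b', m d z')) (R₁ := s(v, w) ≠ s(a, m d a) ∧ s(v, w) ≠ s(b, m d b) ∧
    s(v, w) ≠ s(z, m d z)) (hdis s(v, w))
  simpa only [and_assoc, or_assoc] using this

theorem CanRotateTwice.isMating (hm : IsMating D m) (hd : d ∈ D)
    (h : CanRotateTwice D m d a b z a' b' z') :
    IsMating D (rotateTwice m d a b z a' b' z') := by
  have hn := h.nodup
  simp only [List.nodup_cons, List.mem_cons, List.not_mem_nil, or_false, not_or] at hn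
  have h1 := isMating_rotate hm hd h.first h.ab h.az h.bz
  -- Non-adjacency survives the first rotation for pairs with an end outside its six vertices, as is
  -- the case for every edge added by the second.
  have key : ∀ p q : V, ¬ MAdj D m p q → p ∉ [a, b, m d a, m d b, z, m d z] →
      ¬ MAdj D (rotate m d a b z) p q := by
    rintro p q hpq hp ⟨d', hd', h'⟩
    by_cases e : d' = d
    · subst e
      rw [rotate_self, rot_of_notMem hp] at h'
      exact hpq ⟨d', hd', h'⟩
    · rw [rotate_of_ne _ e] at h'
      exact hpq ⟨d', hd', h'⟩
  have e1 := h.rot_eq.1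
  have e2 := h.rot_eq.2.1
  have e3 := h.rot_eq.2.2
  refine isMating_rotate h1 hd h.second ?_ ?_ ?_
  · exact key _ _ h.ab' (by simp only [List.mem_cons, List.not_mem_nil, or_false, not_or]; grind)
  · rw [rotate_self, e1]
    exact key _ _ h.az' (by simp only [List.mem_cons, List.not_mem_nil, or_false, not_or]; grind)
  · rw [rotate_self, e2, e3]
    exact key _ _ h.bz' (by simp only [List.mem_cons, List.not_mem_nil, or_false, not_or]; grind)

theorem rotateTwice_of_ne {d' : ℕ} (hne : d' ≠ d) :
    rotateTwice m d a b z a' b' z' d' = m d' := by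
  rw [rotateTwice, rotate_of_ne _ hne, rotate_of_ne _ hne]

/-- Two rotations can be undone, knowing the vertices `m d a, m d b, m d a', m d b'`. -/
theorem CanRotateTwice.undo (hm : IsMating D m) (hd : d ∈ D)
    (h : CanRotateTwice D m d a b z a' b' z') :
    rotateTwice (rotateTwice m d a b z a' b' z') d a' (m d a') (m d b') a (m d a) (m d b) = m := by
  have h1 := isMating_rotate hm hd h.first h.ab h.az h.bz
  have h3 := rotate_rotate h1 h.second
  rw [rotate_self, h.rot_eq.1, h.rot_eq.2.1] at h3
  rw [rotateTwice, rotateTwice, h3, rotate_rotate hm h.first]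

theorem card_removedEdges_le (f : V → V) : (removedEdges f a b z a' b' z').card ≤ 6 := by
  classical
  exact Finset.card_le_six

theorem card_addedEdges_le (f : V → V) : (addedEdges f a b z a' b' z').card ≤ 6 := by
  classical
  exact Finset.card_le_six

end

/-- With at most six added edges this is why the relaxation 6s per level suffices. -/
theorem edgeCount_le_of_added [Finite V] {G H : ColouredGraph V D} {S : Finset (Sym2 V)}
    (h : ∀ e ∈ H.graph.edgeSet, e ∈ G.graph.edgeSet ∨ e ∈ S) (A B : Finset V) :
    H.edgeCount A B ≤ G.edgeCount A B + S.card := by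
  rw [edgeCount, edgeCount, ← Set.ncard_coe_finset S]
  refine (Set.ncard_le_ncard ?_ (Set.toFinite _)).trans (Set.ncard_union_le _ _)
  rintro e ⟨he, hab⟩
  rcases h e he with h | h
  · exact Or.inl ⟨h, hab⟩
  · exact Or.inr h

end ColouredGraph

/-! ### Effect of a switching on the capped gadget count -/

namespace ColouredGraph

variable {V : Type*} {D : Finset ℕ} {c : ℕ} {P : Fin 4 → Finset ℕ} {x : V}

open Classical in
/-- The labels of gadgets. -/
noncomputable def gadgetLabels (m : ℕ → V → V) (x : V) (c : ℕ) (P : Fin 4 → Finset ℕ) :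
    Finset Label :=
  (labelBox P).filter (IsGadgetLabel m x c P)

theorem mem_gadgetLabels {m : ℕ → V → V} {l : Label} :
    l ∈ gadgetLabels m x c P ↔ IsGadgetLabel m x c P l := by
  simp only [gadgetLabels, Finset.mem_filter, and_iff_right_iff_imp]
  exact fun h => h.1

theorem isDistLabel_iff_isIsolated {m : ℕ → V → V} {l : Label} :
    IsDistLabel m x c P l ↔
      IsIsolated (gadgetLabels m x c P) (topEdge m x c) (farEdge m x c) l := by
  simp only [IsDistLabel, IsIsolated, mem_gadgetLabels, Clash]

/-- A label is determined by its edge `e₃`, up to the last colour. -/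
theorem IsGadgetLabel.eq_of_topEdge_eq {m : ℕ → V → V} (hm : IsMating (insert c D) m)
    (hP : IsPalette D c P) {l l' : Label} (hl : l ∈ labelBox P) (hl' : l' ∈ labelBox P)
    (h : topEdge m x c l = topEdge m x c l') : l.1 = l'.1 ∧ l.2.1 = l'.2.1 := by
  obtain ⟨h1, h2, h3, h4⟩ := mem_labelBox.1 hl
  obtain ⟨h1', h2', h3', h4'⟩ := mem_labelBox.1 hl'
  rcases Sym2.eq_iff.1 h with ⟨e1, e2⟩ | ⟨e1, e2⟩
  · exact ⟨hm.eq_of_eq _ (hP.mem h1) _ (hP.mem h1') _ e1,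
      hm.eq_of_eq _ (hP.mem h2) _ (hP.mem h2') _ e2⟩
  · exact absurd (hm.eq_of_eq _ (hP.mem h1) _ (hP.mem h2') _ e1) (hP.ne (by decide) h1 h2')

/-- The edge e₃ fixes d₁, d₂, d₃. The only remaining freedom is which end of e₃' is u₁, and this
fixes d₄. -/
theorem card_gadgetLabels_filter_le_two {m : ℕ → V → V} [DecidableEq (Sym2 V)]
    (hm : IsMating (insert c D) m)
    (hP : IsPalette D c P) (a b : Sym2 V) :
    ((gadgetLabels m x c P).filter
      fun l => topEdge m x c l = a ∧ farEdge m x c l = b).card ≤ 2 := by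
  classical
  refine (Finset.card_le_card_of_injOn (t := b.toFinset) (fun l => (verts m x c l).u₁)
    ?_ ?_).trans (by rw [Sym2.card_toFinset]; split_ifs <;> norm_num)
  · intro l hl
    have hl := (Finset.mem_filter.1 hl).2.2
    simp only [Finset.mem_coe, Sym2.mem_toFinset, ← hl, farEdge]
    exact Sym2.mem_mk_left _ _
  · intro l hl l' hl' h
    obtain ⟨hg, ht, -⟩ := Finset.mem_filter.1 hl
    obtain ⟨hg', ht', -⟩ := Finset.mem_filter.1 hl'
    have hg := mem_gadgetLabels.1 hg
    have hg' := mem_gadgetLabels.1 hg'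
    obtain ⟨e1, e2⟩ := IsGadgetLabel.eq_of_topEdge_eq hm hP hg.1 hg'.1 (ht.trans ht'.symm)
    obtain ⟨-, -, h3, h4⟩ := mem_labelBox.1 hg.1
    obtain ⟨-, -, h3', h4'⟩ := mem_labelBox.1 hg'.1
    simp only [verts, ← e1] at h
    have e4 := hm.eq_of_eq _ (hP.mem h4) _ (hP.mem h4') x (hm.injective _ h)
    have k := hg.2.2.1
    have k' := hg'.2.2.1
    simp only [verts, ← e1, ← e2] at k k'
    have e3 := hm.eq_of_eq _ (hP.mem h3) _ (hP.mem h3') _ (k.trans k'.symm)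
    exact Prod.ext e1 (Prod.ext e2 (Prod.ext e3 e4))

variable {m m' : ℕ → V → V}

/-- The vertices of a label never use its third colour, so changing a matching in the third part
leaves them all in place. This is the reason for switching in that colour. -/
theorem verts_congr (hP : IsPalette D c P) {d : ℕ} (hd : d ∈ P 2) (h : ∀ d' ≠ d, m' d' = m d')
    {l : Label} (hl : l ∈ labelBox P) : verts m' x c l = verts m x c l := by
  obtain ⟨h1, h2, h3, h4⟩ := mem_labelBox.1 hl
  have k1 := h _ (hP.ne (i := 0) (j := 2) (by decide) h1 hd)
  have k2 := h _ (hP.ne (i := 1) (j := 2) (by decide) h2 hd)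
  have k4 := h _ (hP.ne (i := 3) (j := 2) (by decide) h4 hd)
  have kc := h _ (hP.ne_c hd).symm
  simp only [verts, k1, k2, k4, kc]

/-- Switching a few edges that are not fragile so that the only new gadget is the one with label
`l₀` increases the capped number of distinguishable gadgets by one. -/
theorem labelCount_of_switch [Fintype V] [DecidableEq (Sym2 V)] (hP : IsPalette D c P)
    (hm : IsMating (insert c D) m)
    {d : ℕ} (hd : d ∈ P 2) (h : ∀ d' ≠ d, m' d' = m d') {R N : Finset (Sym2 V)}
    (hR : R.card ≤ 6)
    (hm' : ∀ v w, m' d v = w ↔ (m d v = w ∧ s(v, w) ∉ R) ∨ s(v, w) ∈ N)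
    (hRd : ∀ v w, s(v, w) ∈ R → m d v = w)
    (hN : ∀ v w, s(v, w) ∈ N → ∀ d' ∈ insert c D, m d' v ≠ w)
    {l₀ : Label} (hl₀ : l₀ ∈ labelBox P) (hl₀d : l₀.2.2.1 = d)
    (hnd : [x, (verts m x c l₀).y₁, (verts m x c l₀).y₂, (verts m x c l₀).v₁, (verts m x c l₀).v₂,
      (verts m x c l₀).u₁, (verts m x c l₀).u₂].Nodup)
    (htop : topEdge m x c l₀ ∈ N) (hfar : farEdge m x c l₀ ∈ N)
    (hfrag : ∀ e ∈ R, e ∉ fragile (gadgetLabels m x c P) (topEdge m x c) (farEdge m x c) 13)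
    (honly : ∀ l, IsGadgetLabel m' x c P l → l.2.2.1 = d →
      topEdge m x c l ∈ N ∨ farEdge m x c l ∈ N → l = l₀)
    (hsat : (satLabels m x c P (baseEdge m x c l₀)).card < D.card) :
    labelCount D m' x c P = labelCount D m x c P + 1 ∧ IsDistLabel m' x c P l₀ ∧
      (satLabels m' x c P (baseEdge m' x c l₀)).card ≤ D.card := by
  classical
  have hv := fun {l} hl => verts_congr (x := x) (l := l) hP hd h hl
  have hgad' : ∀ l, l ∈ gadgetLabels m' x c P ↔ l = l₀ ∨ (l ∈ gadgetLabels m x c P ∧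
      topEdge m x c l ∉ R ∧ farEdge m x c l ∉ R) := by
    intro l
    rw [mem_gadgetLabels, mem_gadgetLabels]
    constructor
    · intro hl
      by_cases hl0 : l = l₀
      · exact Or.inl hl0
      refine Or.inr ?_
      by_cases hld : l.2.2.1 = d
      · have hno := mt (honly l hl hld) hl0
        rw [not_or] at hno
        obtain ⟨hb, hn, e1, e2⟩ := hl
        rw [hv hb, hld] at e1 e2
        rw [hv hb] at hn
        obtain ⟨f1, f1'⟩ := ((hm' _ _).1 e1).resolve_right hno.1
        obtain ⟨f2, f2'⟩ := ((hm' _ _).1 e2).resolve_right hno.2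
        exact ⟨⟨hb, hn, by rw [hld, f1], by rw [hld, f2]⟩, f1', f2'⟩
      · obtain ⟨hb, hn, e1, e2⟩ := hl
        rw [hv hb, h _ hld] at e1 e2
        rw [hv hb] at hn
        have hd3 := hP.mem (mem_labelBox.1 hb).2.2.1
        have hdE := hP.mem hd
        exact ⟨⟨hb, hn, e1, e2⟩,
          fun hr => hld (hm.eq_of_eq _ hd3 _ hdE _ (e1.trans (hRd _ _ hr).symm)),
          fun hr => hld (hm.eq_of_eq _ hd3 _ hdE _ (e2.trans (hRd _ _ hr).symm))⟩
    · rintro (rfl | ⟨⟨hb, hn, e1, e2⟩, r1, r2⟩)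
      · refine ⟨hl₀, ?_, ?_, ?_⟩
        · rw [hv hl₀]; exact hnd
        · rw [hv hl₀, hl₀d]; exact (hm' _ _).2 (Or.inr htop)
        · rw [hv hl₀, hl₀d]; exact (hm' _ _).2 (Or.inr hfar)
      · refine ⟨hb, ?_, ?_, ?_⟩
        · rw [hv hb]; exact hn
        · rw [hv hb]
          by_cases hld : l.2.2.1 = d
          · rw [hld] at e1 ⊢
            exact (hm' _ _).2 (Or.inl ⟨e1, r1⟩)
          · rw [h _ hld]; exact e1
        · rw [hv hb]
          by_cases hld : l.2.2.1 = d
          · rw [hld] at e2 ⊢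
            exact (hm' _ _).2 (Or.inl ⟨e2, r2⟩)
          · rw [h _ hld]; exact e2
  have hdist : ∀ l, IsDistLabel m' x c P l ↔ l = l₀ ∨ IsDistLabel m x c P l := by
    intro l
    -- The threshold 13 is 2·6 + 1: at most six edges are removed, and each pair (e₃, e₃') belongs
    -- to at most two labels.
    rw [isDistLabel_iff_isIsolated, isDistLabel_iff_isIsolated,
      ← isIsolated_iff_of_remove_insert hR (k := 13) (by norm_num) (by norm_num)
        (fun a b => card_gadgetLabels_filter_le_two hm hP a b) hfrag hgad' ?_ l]
    · have hb : ∀ l ∈ gadgetLabels m' x c P, l ∈ labelBox P := fun l hl =>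
        (mem_gadgetLabels.1 hl).1
      unfold IsIsolated
      refine and_congr_right fun hl => forall₂_congr fun l' hl' => ?_
      simp only [topEdge, farEdge, hv (hb l hl), hv (hb l' hl')]
    · intro l hl
      obtain ⟨hb, hn, e1, e2⟩ := mem_gadgetLabels.1 hl
      have hd3 := hP.mem (mem_labelBox.1 hb).2.2.1
      have k1 : topEdge m x c l ∉ N := fun hr => hN _ _ hr _ hd3 e1
      have k2 : farEdge m x c l ∉ N := fun hr => hN _ _ hr _ hd3 e2
      exact ⟨fun hh => k1 (hh ▸ htop), fun hh => k2 (hh ▸ htop), fun hh => k1 (hh ▸ hfar),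
        fun hh => k2 (hh ▸ hfar)⟩
  have hl₀not : ¬ IsDistLabel m x c P l₀ := by
    rintro ⟨⟨hb, hn, e1, e2⟩, -⟩
    exact hN _ _ htop _ (hP.mem (mem_labelBox.1 hb).2.2.1) e1
  have hbase : ∀ l ∈ labelBox P, baseEdge m' x c l = baseEdge m x c l := fun l hl => by
    rw [baseEdge, hv hl, baseEdge]
  have hsatL : ∀ e, satLabels m' x c P e =
      if e = baseEdge m x c l₀ then insert l₀ (satLabels m x c P e) else satLabels m x c P e := by
    intro e
    ext l
    have : l ∈ satLabels m' x c P e ↔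
        (l = l₀ ∧ e = baseEdge m x c l₀) ∨ l ∈ satLabels m x c P e := by
      rw [mem_satLabels, mem_satLabels, hdist]
      constructor
      · rintro ⟨rfl | hl, rfl⟩
        · exact Or.inl ⟨rfl, hbase _ hl₀⟩
        · exact Or.inr ⟨hl, (hbase _ hl.1.1).symm⟩
      · rintro (⟨rfl, rfl⟩ | ⟨hl, rfl⟩)
        · exact ⟨Or.inl rfl, hbase _ hl₀⟩
        · exact ⟨Or.inr hl, hbase _ hl.1.1⟩
    rw [this]
    split_ifs with he
    · simp [he]
    · simp [he]
  have hcol : colourEdges m' c = colourEdges m c := by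
    rw [colourEdges, colourEdges, h _ (hP.ne_c hd).symm]
  have hmem : baseEdge m x c l₀ ∈ colourEdges m c := by
    simp only [colourEdges, Finset.mem_image, Finset.mem_univ, true_and]
    exact ⟨_, rfl⟩
  refine ⟨?_, (hdist l₀).2 (Or.inl rfl), ?_⟩
  swap
  · rw [hbase _ hl₀, hsatL, if_pos rfl, Finset.card_insert_of_notMem
      (fun hh => hl₀not (mem_satLabels.1 hh).1)]
    exact hsat
  -- Only the term of the base edge of `l₀` changes. It was strictly below |D|, so the cap does not
  -- swallow the increment.
  rw [labelCount, labelCount, hcol, ← Finset.add_sum_erase _ _ hmem,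
    ← Finset.add_sum_erase _ _ hmem, hsatL, if_pos rfl, Finset.card_insert_of_notMem
      (fun hh => hl₀not (mem_satLabels.1 hh).1), min_eq_right (by omega),
    min_eq_right hsat.le, Finset.sum_congr rfl fun e he => by
      rw [hsatL, if_neg (Finset.ne_of_mem_erase he)]]
  ring

end ColouredGraph

/-! ### Good switchings create exactly one gadget -/

namespace ColouredGraph

variable {V : Type*} {D : Finset ℕ} {c : ℕ} {P : Fin 4 → Finset ℕ} {x : V} {m : ℕ → V → V}

theorem nodup_twelve {f : V → V} (hf : ∀ v, f (f v) = v) (hne : ∀ v, f v ≠ v)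
    {p q r s t u : V} (pq : p ≠ q ∧ p ≠ f q) (pr : p ≠ r ∧ p ≠ f r) (ps : p ≠ s ∧ p ≠ f s)
    (pt : p ≠ t ∧ p ≠ f t) (pu : p ≠ u ∧ p ≠ f u) (qr : q ≠ r ∧ q ≠ f r) (qs : q ≠ s ∧ q ≠ f s)
    (qt : q ≠ t ∧ q ≠ f t) (qu : q ≠ u ∧ q ≠ f u) (rs : r ≠ s ∧ r ≠ f s) (rt : r ≠ t ∧ r ≠ f t)
    (ru : r ≠ u ∧ r ≠ f u) (st : s ≠ t ∧ s ≠ f t) (su : s ≠ u ∧ s ≠ f u) (tu : t ≠ u ∧ t ≠ f u) :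
    [p, q, f p, f q, r, f r, s, t, f s, f t, u, f u].Nodup := by
  have i : ∀ {a b : V}, (a ≠ b ∧ a ≠ f b) → f a ≠ f b := fun {a b} h h' =>
    h.1 (by rw [← hf a, h', hf])
  have j : ∀ {a b : V}, (a ≠ b ∧ a ≠ f b) → f a ≠ b := fun {a b} h h' =>
    h.2 (by rw [← h', hf])
  have k : ∀ {a b : V}, (a ≠ b ∧ a ≠ f b) → b ≠ f a := fun h h' => j h h'.symm
  simp only [List.nodup_cons, List.mem_cons, List.not_mem_nil, or_false, not_or]
  exact ⟨⟨pq.1, (hne p).symm, pq.2, pr.1, pr.2, ps.1, pt.1, ps.2, pt.2, pu.1, pu.2⟩,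
    ⟨k pq, (hne q).symm, qr.1, qr.2, qs.1, qt.1, qs.2, qt.2, qu.1, qu.2⟩,
    ⟨i pq, j pr, i pr, j ps, j pt, i ps, i pt, j pu, i pu⟩,
    ⟨j qr, i qr, j qs, j qt, i qs, i qt, j qu, i qu⟩,
    ⟨(hne r).symm, rs.1, rt.1, rs.2, rt.2, ru.1, ru.2⟩,
    ⟨j rs, j rt, i rs, i rt, j ru, i ru⟩,
    ⟨st.1, (hne s).symm, st.2, su.1, su.2⟩,
    ⟨k st, (hne t).symm, tu.1, tu.2⟩,
    ⟨i st, j su, i su⟩, ⟨j tu, i tu⟩, (hne u).symm, not_false, List.nodup_nil⟩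

open Classical in
/-- The neighbours of `x` along colours in `D`. -/
noncomputable def nbrs (D : Finset ℕ) (m : ℕ → V → V) (x : V) : Finset V := D.image fun d => m d x

theorem mem_nbrs (hP : IsPalette D c P) {i : Fin 4} {d : ℕ} (hd : d ∈ P i) :
    m d x ∈ nbrs D m x := by
  classical
  exact Finset.mem_image_of_mem _ (hP.subset i hd)

open Classical in
/-- The possible vertices `u₁, u₂` of gadgets whose first two colours are given. -/
noncomputable def sideVerts (m : ℕ → V → V) (x : V) (c : ℕ) (P : Fin 4 → Finset ℕ) (d₁ d₂ : ℕ) :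
    Finset V :=
  (P 3).image (fun d => m d₁ (m d x)) ∪ (P 3).image (fun d => m d₂ (m c (m d x)))

/-- Joining `a` and `b` in colour `d` would complete a gadget whose edge `e₃` is present. -/
def Completes (m : ℕ → V → V) (x : V) (c : ℕ) (P : Fin 4 → Finset ℕ) (d : ℕ) (a b : V) : Prop :=
  ∃ l ∈ labelBox P, l.2.2.1 = d ∧ m d (verts m x c l).y₁ = (verts m x c l).y₂ ∧
    farEdge m x c l = s(a, b)

/-- Rerouting the `d`-edge at `z` through `a` and `b` is harmless for gadgets. -/
structure Avoids (D : Finset ℕ) (m : ℕ → V → V) (x : V) (c : ℕ) (P : Fin 4 → Finset ℕ)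
    (d d₁ d₂ : ℕ) (a b z : V) : Prop where
  ne : z ≠ a ∧ z ≠ b ∧ z ≠ m d a ∧ z ≠ m d b
  adj : ¬ MAdj (insert c D) m a z
  adj' : ¬ MAdj (insert c D) m b (m d z)
  notMem : z ∉ nbrs D m x
  notMem' : m d z ∉ nbrs D m x
  side : z ∉ sideVerts m x c P d₁ d₂
  side' : m d z ∉ sideVerts m x c P d₁ d₂
  completes : ¬ Completes m x c P d a z
  completes' : ¬ Completes m x c P d b (m d z)

/-- The edges whose removal might change which gadgets are distinguishable. -/
noncomputable def fragileEdges [DecidableEq (Sym2 V)] (m : ℕ → V → V) (x : V) (c : ℕ)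
    (P : Fin 4 → Finset ℕ) : Finset (Sym2 V) :=
  fragile (gadgetLabels m x c P) (topEdge m x c) (farEdge m x c) 13

/-- The conditions on a label under which a gadget with this label can be created. -/
structure GoodLabel [DecidableEq (Sym2 V)] (D : Finset ℕ) (m : ℕ → V → V) (x : V) (c : ℕ)
    (P : Fin 4 → Finset ℕ) (l : Label) : Prop where
  top : ¬ MAdj (insert c D) m (verts m x c l).y₁ (verts m x c l).y₂
  far : ¬ MAdj (insert c D) m (verts m x c l).u₁ (verts m x c l).u₂
  u₁_notMem : (verts m x c l).u₁ ∉ nbrs D m x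
  u₂_ne_y₁ : (verts m x c l).u₂ ≠ (verts m x c l).y₁
  u₁_ne_u₂ : (verts m x c l).u₁ ≠ (verts m x c l).u₂
  v₂_ne_y₁ : (verts m x c l).v₂ ≠ (verts m x c l).y₁
  v₂_ne_y₂ : (verts m x c l).v₂ ≠ (verts m x c l).y₂
  u₁_ne : (verts m x c l).u₁ ≠ m l.2.2.1 (verts m x c l).y₁ ∧
    (verts m x c l).u₁ ≠ m l.2.2.1 (verts m x c l).y₂
  u₂_ne : (verts m x c l).u₂ ≠ m l.2.2.1 (verts m x c l).y₁ ∧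
    (verts m x c l).u₂ ≠ m l.2.2.1 (verts m x c l).y₂
  frag_y₁ : s((verts m x c l).y₁, m l.2.2.1 (verts m x c l).y₁) ∉ fragileEdges m x c P
  frag_y₂ : s((verts m x c l).y₂, m l.2.2.1 (verts m x c l).y₂) ∉ fragileEdges m x c P
  frag_u₁ : s((verts m x c l).u₁, m l.2.2.1 (verts m x c l).u₁) ∉ fragileEdges m x c P
  frag_u₂ : s((verts m x c l).u₂, m l.2.2.1 (verts m x c l).u₂) ∉ fragileEdges m x c P
  side : ∀ d ∈ P 3, m l.2.2.1 (m l.1 (m d x)) ≠ m l.2.1 (m c (m d x))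
  swap : m c (m l.2.1 (verts m x c l).u₁) ∉ nbrs D m x
  completes_u : ¬ Completes m x c P l.2.2.1 (verts m x c l).u₁ (verts m x c l).u₂
  completes_y : ¬ Completes m x c P l.2.2.1 (verts m x c l).y₁ (verts m x c l).y₂
  sat : (satLabels m x c P (baseEdge m x c l)).card < D.card

/-- The conditions under which a gadget can be created by two rotations through the vertices
`z` and `w`. -/
structure GoodSwitch [DecidableEq (Sym2 V)] (D : Finset ℕ) (m : ℕ → V → V) (x : V) (c : ℕ)
    (P : Fin 4 → Finset ℕ) (l : Label) (z w : V) : Prop where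
  label : GoodLabel D m x c P l
  avoids_z : Avoids D m x c P l.2.2.1 l.1 l.2.1 (m l.2.2.1 (verts m x c l).y₁)
    (m l.2.2.1 (verts m x c l).y₂) z
  avoids_w : Avoids D m x c P l.2.2.1 l.1 l.2.1 (m l.2.2.1 (verts m x c l).u₁)
    (m l.2.2.1 (verts m x c l).u₂) w
  frag_z : s(z, m l.2.2.1 z) ∉ fragileEdges m x c P
  frag_w : s(w, m l.2.2.1 w) ∉ fragileEdges m x c P
  w_ne : w ≠ (verts m x c l).y₁ ∧ w ≠ m l.2.2.1 (verts m x c l).y₁ ∧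
    w ≠ (verts m x c l).y₂ ∧ w ≠ m l.2.2.1 (verts m x c l).y₂ ∧ w ≠ z ∧ w ≠ m l.2.2.1 z

/-- Create a gadget by two rotations. -/
noncomputable def switchAt (m : ℕ → V → V) (x : V) (c : ℕ) (l : Label) (z w : V) : ℕ → V → V :=
  rotateTwice m l.2.2.1 (verts m x c l).y₁ (verts m x c l).y₂ z (verts m x c l).u₁
    (verts m x c l).u₂ w

section

variable {l : Label} {z w : V}

/-- Distinctness that holds for every label, because different colours at a vertex lead to different
mates. -/
theorem verts_ne (hm : IsMating (insert c D) m) (hP : IsPalette D c P) (hl : l ∈ labelBox P) :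
    (verts m x c l).v₂ ≠ x ∧ (verts m x c l).y₁ ≠ (verts m x c l).y₂ ∧
      (verts m x c l).y₂ ≠ (verts m x c l).u₂ := by
  obtain ⟨h1, h2, h3, h4⟩ := mem_labelBox.1 hl
  have hc := Finset.mem_insert_self c D
  have a : (verts m x c l).v₂ ≠ x := fun h =>
    hP.ne_c h4 (hm.eq_of_eq _ (hP.mem h4) _ hc x (hm.eq_iff.1 h).symm)
  exact ⟨a, fun h => hP.ne (by decide) h1 h2 (hm.eq_of_eq _ (hP.mem h1) _ (hP.mem h2) x h),
    fun h => a (hm.injective _ h).symm⟩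

theorem GoodLabel.nodup [DecidableEq (Sym2 V)] (hm : IsMating (insert c D) m) (hP : IsPalette D c P)
    (hl : l ∈ labelBox P) (h : GoodLabel D m x c P l) :
    [x, (verts m x c l).y₁, (verts m x c l).y₂, (verts m x c l).v₁, (verts m x c l).v₂,
      (verts m x c l).u₁, (verts m x c l).u₂].Nodup := by
  obtain ⟨h1, h2, h3, h4⟩ := mem_labelBox.1 hl
  have hc := Finset.mem_insert_self c D
  obtain ⟨a1, a2, a3⟩ := verts_ne (x := x) hm hP hl
  have n1 := hm.ne _ (hP.mem h1)
  have n2 := hm.ne _ (hP.mem h2)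
  have n4 := hm.ne _ (hP.mem h4)
  have nc := hm.ne _ hc
  have y1 : (verts m x c l).y₁ ∈ nbrs D m x := mem_nbrs hP h1
  have y2 : (verts m x c l).y₂ ∈ nbrs D m x := mem_nbrs hP h2
  have ne_of : ∀ {p q : V}, q ∉ nbrs D m x → p ∈ nbrs D m x → p ≠ q := fun hq hp h => hq (h ▸ hp)
  simp only [List.nodup_cons, List.mem_cons, List.not_mem_nil, or_false, not_or]
  refine ⟨⟨(n1 x).symm, (n2 x).symm, (n4 x).symm, a1.symm, ?_, ?_⟩,
    ⟨a2, ?_, h.v₂_ne_y₁.symm, ne_of h.u₁_notMem y1, h.u₂_ne_y₁.symm⟩,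
    ⟨?_, h.v₂_ne_y₂.symm, ne_of h.u₁_notMem y2, a3⟩,
    ⟨(nc _).symm, (n1 _).symm, ?_⟩, ⟨?_, (n2 _).symm⟩, h.u₁_ne_u₂, not_false, List.nodup_nil⟩
  · intro hh
    exact hP.ne (by decide) h1 h4 (hm.eq_of_eq _ (hP.mem h1) _ (hP.mem h4) x
      (hm.eq_iff.1 hh.symm))
  · intro hh
    exact h.v₂_ne_y₂ (hm.eq_iff.1 hh.symm).symm
  · intro hh
    exact hP.ne (by decide) h1 h4 (hm.eq_of_eq _ (hP.mem h1) _ (hP.mem h4) x hh)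
  · intro hh
    exact hP.ne (by decide) h2 h4 (hm.eq_of_eq _ (hP.mem h2) _ (hP.mem h4) x hh)
  · intro hh
    exact hP.ne_c h2 (hm.eq_of_eq _ (hP.mem h2) _ hc _ (hm.eq_iff.1 hh.symm))
  · intro hh
    exact hP.ne_c h1 (hm.eq_of_eq _ (hP.mem h1) _ hc _ hh.symm)

theorem GoodSwitch.canRotateTwice [DecidableEq (Sym2 V)] (hm : IsMating (insert c D) m)
    (hP : IsPalette D c P)
    (hl : l ∈ labelBox P) (h : GoodSwitch D m x c P l z w) :
    CanRotateTwice (insert c D) m l.2.2.1 (verts m x c l).y₁ (verts m x c l).y₂ z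
      (verts m x c l).u₁ (verts m x c l).u₂ w := by
  classical
  obtain ⟨h1, h2, h3, h4⟩ := mem_labelBox.1 hl
  obtain ⟨a1, a2, a3⟩ := verts_ne (x := x) hm hP hl
  have y1 : (verts m x c l).y₁ ∈ nbrs D m x := mem_nbrs hP h1
  have y2 : (verts m x c l).y₂ ∈ nbrs D m x := mem_nbrs hP h2
  have u1 : (verts m x c l).u₁ ∈ sideVerts m x c P l.1 l.2.1 :=
    Finset.mem_union_left _ (Finset.mem_image_of_mem (fun d => m l.1 (m d x)) h4)
  have u2 : (verts m x c l).u₂ ∈ sideVerts m x c P l.1 l.2.1 :=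
    Finset.mem_union_right _ (Finset.mem_image_of_mem (fun d => m l.2.1 (m c (m d x))) h4)
  have hd := hP.mem h3
  have hf := hm.invol l.2.2.1
  have sw : ∀ {p q : V}, q ≠ m l.2.2.1 p → p ≠ m l.2.2.1 q := fun hq hh =>
    hq (by rw [hh, hf])
  have hz := h.avoids_z.ne
  have hw := h.avoids_w.ne
  rw [hf, hf] at hz hw
  refine ⟨?_, h.label.top, h.avoids_z.adj, h.avoids_z.adj', h.label.far, h.avoids_w.adj,
      h.avoids_w.adj'⟩
  refine nodup_twelve hf (hm.ne _ hd) ⟨a2, ?_⟩ ⟨hz.2.2.1.symm, sw hz.1⟩ ⟨?_, sw h.label.u₁_ne.1⟩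
    ⟨h.label.u₂_ne_y₁.symm, sw h.label.u₂_ne.1⟩ ⟨h.w_ne.1.symm, sw h.w_ne.2.1⟩
    ⟨hz.2.2.2.symm, sw hz.2.1⟩ ⟨?_, sw h.label.u₁_ne.2⟩ ⟨a3, sw h.label.u₂_ne.2⟩
    ⟨h.w_ne.2.2.1.symm, sw h.w_ne.2.2.2.1⟩ ⟨?_, sw ?_⟩ ⟨?_, sw ?_⟩
    ⟨h.w_ne.2.2.2.2.1.symm, sw h.w_ne.2.2.2.2.2⟩ ⟨h.label.u₁_ne_u₂, ?_⟩
    ⟨hw.2.2.1.symm, sw hw.1⟩ ⟨hw.2.2.2.symm, sw hw.2.1⟩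
  · exact fun hh => h.label.top ⟨_, hd, hm.eq_iff.1 hh.symm⟩
  · exact fun hh => h.label.u₁_notMem (hh ▸ y1)
  · exact fun hh => h.label.u₁_notMem (hh ▸ y2)
  · exact fun hh => h.avoids_z.side (hh ▸ u1)
  · exact fun hh => h.avoids_z.side' (hh ▸ u1)
  · exact fun hh => h.avoids_z.side (hh ▸ u2)
  · exact fun hh => h.avoids_z.side' (hh ▸ u2)
  · exact fun hh => h.label.far ⟨_, hd, hm.eq_iff.1 hh.symm⟩

/-- An edge e₃ has both ends in the neighbourhood of x, and y₁y₂ is the only added edge with this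
property. If e₃ is new, the first two colours are thus those of `l`, and the conditions on
`sideVerts` leave u₁u₂ as the only e₃'. If e₃ is old, then e₃' is new and completes a gadget, which
the `Completes` conditions forbid. -/
theorem GoodSwitch.only [DecidableEq (Sym2 V)] (hm : IsMating (insert c D) m) (hP : IsPalette D c P)
    (hl : l ∈ labelBox P) (h : GoodSwitch D m x c P l z w) {l' : Label}
    (hl' : l' ∈ labelBox P)
    (hnd : [x, (verts m x c l').y₁, (verts m x c l').y₂, (verts m x c l').v₁, (verts m x c l').v₂,
      (verts m x c l').u₁, (verts m x c l').u₂].Nodup)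
    (hd : l'.2.2.1 = l.2.2.1)
    (h1 : m l.2.2.1 (verts m x c l').y₁ = (verts m x c l').y₂ ∨
      topEdge m x c l' ∈ addedEdges (m l.2.2.1) (verts m x c l).y₁ (verts m x c l).y₂ z
        (verts m x c l).u₁ (verts m x c l).u₂ w)
    (h2 : m l.2.2.1 (verts m x c l').u₁ = (verts m x c l').u₂ ∨
      farEdge m x c l' ∈ addedEdges (m l.2.2.1) (verts m x c l).y₁ (verts m x c l).y₂ z
        (verts m x c l).u₁ (verts m x c l).u₂ w)
    (h3 : topEdge m x c l' ∈ addedEdges (m l.2.2.1) (verts m x c l).y₁ (verts m x c l).y₂ z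
        (verts m x c l).u₁ (verts m x c l).u₂ w ∨
      farEdge m x c l' ∈ addedEdges (m l.2.2.1) (verts m x c l).y₁ (verts m x c l).y₂ z
        (verts m x c l).u₁ (verts m x c l).u₂ w) : l' = l := by
  classical
  obtain ⟨p1, p2, p3, p4⟩ := mem_labelBox.1 hl
  obtain ⟨q1, q2, q3, q4⟩ := mem_labelBox.1 hl'
  have y1 : (verts m x c l').y₁ ∈ nbrs D m x := mem_nbrs hP q1
  have y2 : (verts m x c l').y₂ ∈ nbrs D m x := mem_nbrs hP q2
  have mem_top : ∀ {p q}, topEdge m x c l' = s(p, q) → p ∈ nbrs D m x ∧ q ∈ nbrs D m x := by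
    intro p q hpq
    rcases Sym2.eq_iff.1 hpq with ⟨rfl, rfl⟩ | ⟨rfl, rfl⟩
    exacts [⟨y1, y2⟩, ⟨y2, y1⟩]
  by_cases ht : topEdge m x c l' ∈ addedEdges (m l.2.2.1) (verts m x c l).y₁ (verts m x c l).y₂ z
      (verts m x c l).u₁ (verts m x c l).u₂ w
  · simp only [addedEdges, Finset.mem_insert, Finset.mem_singleton] at ht
    rcases ht with ht | ht | ht | ht | ht | ht
    · obtain ⟨e1, e2⟩ := IsGadgetLabel.eq_of_topEdge_eq hm hP hl' hl ht
      have e4 : l'.2.2.2 = l.2.2.2 := by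
        have mem_far : ∀ {p q}, farEdge m x c l' = s(p, q) →
            q ∈ sideVerts m x c P l.1 l.2.1 := by
          intro p q hpq
          rw [← e1, ← e2]
          rcases Sym2.eq_iff.1 hpq with ⟨rfl, rfl⟩ | ⟨rfl, rfl⟩
          · exact Finset.mem_union_right _
              (Finset.mem_image_of_mem (fun d => m l'.2.1 (m c (m d x))) q4)
          · exact Finset.mem_union_left _
              (Finset.mem_image_of_mem (fun d => m l'.1 (m d x)) q4)
        rcases h2 with h2 | h2
        -- An old edge e₃' together with the new edge y₁y₂ would give a second gadget with the same
        -- first three colours. The field `side` excludes it for every choice of the fourth.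
        · refine absurd ?_ (h.label.side _ q4)
          simpa only [verts, e1, e2] using h2
        · simp only [addedEdges, Finset.mem_insert, Finset.mem_singleton] at h2
          rcases h2 with h2 | h2 | h2 | h2 | h2 | h2
          · simp only [List.nodup_cons, List.mem_cons, List.not_mem_nil, or_false, not_or] at hnd
            rw [topEdge, ← h2, farEdge] at ht
            rcases Sym2.eq_iff.1 ht with h' | h'
            · exact absurd h'.1 hnd.2.1.2.2.2.1
            · exact absurd h'.1 hnd.2.1.2.2.2.2
          · exact absurd (mem_far h2) h.avoids_z.side
          · exact absurd (mem_far h2) h.avoids_z.side'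
          · rcases Sym2.eq_iff.1 h2 with h' | h'
            · have := h'.1
              simp only [verts, e1] at this
              exact hm.eq_of_eq _ (hP.mem q4) _ (hP.mem p4) x (hm.injective _ this)
            -- If u₁u₂ were used in the reverse direction, going back from u₁ along d₂ and `c` would
            -- end at a neighbour of x.
            · refine absurd ?_ h.label.swap
              rw [← h'.2]
              simp only [verts, e2, hm.invol]
              exact mem_nbrs hP q4
          · exact absurd (mem_far h2) h.avoids_w.side
          · exact absurd (mem_far h2) h.avoids_w.side'
      exact Prod.ext e1 (Prod.ext e2 (Prod.ext hd e4))
    · exact absurd (mem_top ht).2 h.avoids_z.notMem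
    · exact absurd (mem_top ht).2 h.avoids_z.notMem'
    · exact absurd (mem_top ht).1 h.label.u₁_notMem
    · exact absurd (mem_top ht).2 h.avoids_w.notMem
    · exact absurd (mem_top ht).2 h.avoids_w.notMem'
  · have h1 := h1.resolve_right ht
    have h3 := h3.resolve_left ht
    have hcomp : ∀ {p q}, farEdge m x c l' = s(p, q) → Completes m x c P l.2.2.1 p q :=
      fun hpq => ⟨l', hl', hd, h1, hpq⟩
    simp only [addedEdges, Finset.mem_insert, Finset.mem_singleton] at h3
    rcases h3 with h3 | h3 | h3 | h3 | h3 | h3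
    · exact absurd (hcomp h3) h.label.completes_y
    · exact absurd (hcomp h3) h.avoids_z.completes
    · exact absurd (hcomp h3) h.avoids_z.completes'
    · exact absurd (hcomp h3) h.label.completes_u
    · exact absurd (hcomp h3) h.avoids_w.completes
    · exact absurd (hcomp h3) h.avoids_w.completes'

theorem GoodSwitch.isMating [DecidableEq (Sym2 V)] (hm : IsMating (insert c D) m)
    (hP : IsPalette D c P)
    (hl : l ∈ labelBox P) (h : GoodSwitch D m x c P l z w) :
    IsMating (insert c D) (switchAt m x c l z w) :=
  (h.canRotateTwice hm hP hl).isMating hm (hP.mem (mem_labelBox.1 hl).2.2.1)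

/-- The last two conclusions put the new label into `cappedLabels`, which makes the reverse count
work. -/
theorem GoodSwitch.labelCount_switchAt [DecidableEq (Sym2 V)] [Fintype V]
    (hm : IsMating (insert c D) m) (hP : IsPalette D c P)
    (hl : l ∈ labelBox P) (h : GoodSwitch D m x c P l z w) :
    labelCount D (switchAt m x c l z w) x c P = labelCount D m x c P + 1 ∧
      IsDistLabel (switchAt m x c l z w) x c P l ∧
      (satLabels (switchAt m x c l z w) x c P (baseEdge (switchAt m x c l z w) x c l)).card ≤
        D.card := by
  classical
  have hr := h.canRotateTwice hm hP hl
  have h3 := (mem_labelBox.1 hl).2.2.1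
  have hR : ∀ v w', s(v, w') ∈ removedEdges (m l.2.2.1) (verts m x c l).y₁ (verts m x c l).y₂ z
      (verts m x c l).u₁ (verts m x c l).u₂ w → m l.2.2.1 v = w' := by
    intro v w' hvw
    simp only [removedEdges, Finset.mem_insert, Finset.mem_singleton] at hvw
    rcases hvw with h | h | h | h | h | h <;>
      rcases Sym2.eq_iff.1 h with ⟨rfl, rfl⟩ | ⟨rfl, rfl⟩ <;> simp only [hm.invol]
  refine labelCount_of_switch (m' := switchAt m x c l z w) hP hm h3
      (fun d' hd' => rotateTwice_of_ne hd')
    (R := removedEdges (m l.2.2.1) (verts m x c l).y₁ (verts m x c l).y₂ z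
      (verts m x c l).u₁ (verts m x c l).u₂ w)
    (N := addedEdges (m l.2.2.1) (verts m x c l).y₁ (verts m x c l).y₂ z
      (verts m x c l).u₁ (verts m x c l).u₂ w) (card_removedEdges_le _)
    (fun v w' => hr.rotateTwice_eq_iff hm) hR ?_ hl rfl (h.label.nodup hm hP hl) ?_ ?_ ?_ ?_
    h.label.sat
  · intro v w' hvw d' hd' hh
    have hadj : MAdj (insert c D) m v w' := ⟨d', hd', hh⟩
    simp only [addedEdges, Finset.mem_insert, Finset.mem_singleton] at hvw
    have key : ∀ {p q}, s(v, w') = s(p, q) → MAdj (insert c D) m p q := by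
      intro p q hpq
      rcases Sym2.eq_iff.1 hpq with ⟨rfl, rfl⟩ | ⟨rfl, rfl⟩
      exacts [hadj, hm.mAdj_symm hadj]
    rcases hvw with h | h | h | h | h | h
    exacts [hr.ab (key h), hr.az (key h), hr.bz (key h), hr.ab' (key h), hr.az' (key h),
      hr.bz' (key h)]
  · simp [addedEdges, topEdge]
  · simp [addedEdges, farEdge]
  · intro e he
    simp only [removedEdges, Finset.mem_insert, Finset.mem_singleton] at he
    rcases he with rfl | rfl | rfl | rfl | rfl | rfl
    exacts [h.label.frag_y₁, h.label.frag_y₂, h.frag_z, h.label.frag_u₁, h.label.frag_u₂, h.frag_w]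
  · rintro l' ⟨hb, hn, e1, e2⟩ hd hN
    have hv := verts_congr (x := x) hP h3 (m := m) (m' := switchAt m x c l z w)
      (fun d' hd' => rotateTwice_of_ne hd') hb
    rw [hv] at hn e1 e2
    rw [hd] at e1 e2
    refine h.only hm hP hl hb hn hd ?_ ?_ hN
    · exact ((hr.rotateTwice_eq_iff hm).1 e1).imp And.left id
    · exact ((hr.rotateTwice_eq_iff hm).1 e2).imp And.left id

/-- A switching can be recovered from its result, its label and four further vertices. -/
theorem GoodSwitch.recover [DecidableEq (Sym2 V)] (hm : IsMating (insert c D) m)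
    (hP : IsPalette D c P) {l : Label} {z w : V}
    (hl : l ∈ labelBox P) (h : GoodSwitch D m x c P l z w) :
    let m' := switchAt m x c l z w
    verts m' x c l = verts m x c l ∧
    rotateTwice m' l.2.2.1 (verts m x c l).u₁ (m l.2.2.1 (verts m x c l).u₁)
      (m l.2.2.1 (verts m x c l).u₂) (verts m x c l).y₁ (m l.2.2.1 (verts m x c l).y₁)
      (m l.2.2.1 (verts m x c l).y₂) = m ∧
    m' l.2.2.1 (m l.2.2.1 (verts m x c l).y₁) = z ∧
    m' l.2.2.1 (m l.2.2.1 (verts m x c l).u₁) = w := by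
  have hr := h.canRotateTwice hm hP hl
  have h3 := (mem_labelBox.1 hl).2.2.1
  refine ⟨verts_congr hP h3 (fun d' hd' => rotateTwice_of_ne hd') hl,
    hr.undo hm (hP.mem h3), ?_, ?_⟩
  · exact (hr.rotateTwice_eq_iff hm).2 (Or.inr (by simp [addedEdges]))
  · exact (hr.rotateTwice_eq_iff hm).2 (Or.inr (by simp [addedEdges]))

end

end ColouredGraph

/-! ### Double counting between consecutive levels -/

namespace ColouredGraph

variable {V : Type*} {D : Finset ℕ} {c : ℕ} {P : Fin 4 → Finset ℕ} {x : V} {m : ℕ → V → V}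

open Classical in
/-- The labels of distinguishable gadgets whose `c`-edge is in at most `|D|` of them. -/
noncomputable def cappedLabels (D : Finset ℕ) (m : ℕ → V → V) (x : V) (c : ℕ)
    (P : Fin 4 → Finset ℕ) : Finset Label :=
  (labelBox P).filter fun l =>
    IsDistLabel m x c P l ∧ (satLabels m x c P (baseEdge m x c l)).card ≤ D.card

/-- On c-edges lying in at most |D| distinguishable gadgets the cap in `labelCount` is inactive, so
every such gadget is counted. Without this restriction the number of distinguishable gadgets could
exceed r(G). -/
theorem card_cappedLabels_le [Fintype V] :
    (cappedLabels D m x c P).card ≤ labelCount D m x c P := by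
  classical
  have h : cappedLabels D m x c P ⊆
      ((colourEdges m c).filter fun e => (satLabels m x c P e).card ≤ D.card).biUnion
        (satLabels m x c P) := by
    intro l hl
    obtain ⟨hb, hd, hc⟩ := Finset.mem_filter.1 hl
    simp only [Finset.mem_biUnion, Finset.mem_filter]
    refine ⟨_, ⟨?_, hc⟩, mem_satLabels.2 ⟨hd, rfl⟩⟩
    simp only [colourEdges, Finset.mem_image, Finset.mem_univ, true_and]
    exact ⟨_, rfl⟩
  refine (Finset.card_le_card h).trans (Finset.card_biUnion_le.trans ?_)
  rw [labelCount]
  refine (Finset.sum_le_sum fun e he => ?_).trans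
    (Finset.sum_le_sum_of_subset (Finset.filter_subset _ _))
  rw [min_eq_right (Finset.mem_filter.1 he).2]

section

variable [Fintype V]

/-- The coloured graphs with `r(G) = s` and the matching quasirandomness level. -/
def level (x : V) (P : Fin 4 → Finset ℕ) (s : ℕ) : Set (ColouredGraph V (insert c D)) :=
  {G | gadgetCount x P G = s} ∩ quasirandomLevel V D c s

open Classical in
/-- The parameters of the switchings that create a gadget. -/
noncomputable def goodSwitches (D : Finset ℕ) (m : ℕ → V → V) (x : V) (c : ℕ)
    (P : Fin 4 → Finset ℕ) : Finset (Label × V × V) :=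
  (labelBox P ×ˢ Finset.univ ×ˢ Finset.univ).filter fun t =>
    GoodSwitch D m x c P t.1 t.2.1 t.2.2

open Classical in
-- Both conditions defining the level advance in step: r grows by one, and edge counts by at most
-- six.
theorem GoodSwitch.exists_mem_level (hP : IsPalette D c P) {s : ℕ}
    {G : ColouredGraph V (insert c D)} (hG : G ∈ level x P s) {l : Label} {z w : V}
    (hl : l ∈ labelBox P) (h : GoodSwitch D G.mate x c P l z w) :
    ∃ H : ColouredGraph V (insert c D), H ∈ level x P (s + 1) ∧
      H.mate = switchAt G.mate x c l z w := by
  have hM := h.isMating G.isMating hP hl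
  refine ⟨hM.toColouredGraph, ⟨?_, ?_⟩, hM.mate_toColouredGraph⟩
  · have h1 : gadgetCount x P G = s := hG.1
    have h2 := (h.labelCount_switchAt G.isMating hP hl).1
    rw [Set.mem_ofPred_eq, gadgetCount_eq hP, hM.mate_toColouredGraph, h2, ← gadgetCount_eq hP, h1]
  · intro A B hA hB
    have h1 := hG.2 A B hA hB
    have h2 := edgeCount_le_of_added (G := G) (H := hM.toColouredGraph)
      (S := addedEdges (G.mate l.2.2.1) (verts G.mate x c l).y₁ (verts G.mate x c l).y₂ z
        (verts G.mate x c l).u₁ (verts G.mate x c l).u₂ w) ?_ A B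
    · have h3 : (hM.toColouredGraph.edgeCount A B : ℝ) ≤ G.edgeCount A B + 6 := by
        exact_mod_cast h2.trans (Nat.add_le_add_left (card_addedEdges_le _) _)
      push_cast
      linarith
    · intro e he
      induction e with | _ v v'
      obtain ⟨d, hd, hdv⟩ := hM.toColouredGraph.adj_iff.1 he
      rw [hM.mate_toColouredGraph] at hdv
      by_cases hdl : d = l.2.2.1
      · subst hdl
        rcases ((h.canRotateTwice G.isMating hP hl).rotateTwice_eq_iff G.isMating).1 hdv with k | k
        · exact Or.inl (G.adj_iff.2 ⟨_, hd, k.1⟩)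
        · exact Or.inr k
      · rw [switchAt, rotateTwice_of_ne hdl] at hdv
        exact Or.inl (G.adj_iff.2 ⟨_, hd, hdv⟩)

/-- Double counting of switchings between consecutive levels. -/
theorem ncard_level_mul_le (hP : IsPalette D c P) {s F : ℕ}
    (hF : ∀ G ∈ level (c := c) (D := D) x P s, F ≤ (goodSwitches D G.mate x c P).card) :
    (level (c := c) (D := D) x P s).ncard * F ≤
      (level (c := c) (D := D) x P (s + 1)).ncard * ((s + 1) * Fintype.card V ^ 4) := by
  classical
  have : Fintype (ColouredGraph V (insert c D)) := Fintype.ofFinite _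
  rw [Set.ncard_eq_toFinset_card', Set.ncard_eq_toFinset_card']
  set T := (level (c := c) (D := D) x P s).toFinset with hT
  set T' := (level (c := c) (D := D) x P (s + 1)).toFinset with hT'
  let X : Finset (Σ _ : ColouredGraph V (insert c D), Label × V × V) :=
    T.sigma fun G => goodSwitches D G.mate x c P
  let Y : Finset (Σ _ : ColouredGraph V (insert c D), Label × V × V × V × V) :=
    T'.sigma fun H => cappedLabels D H.mate x c P ×ˢ Finset.univ
  have hX : T.card * F ≤ X.card := by
    rw [Finset.card_sigma, ← smul_eq_mul, ← Finset.sum_const]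
    exact Finset.sum_le_sum fun G hG => hF G (Set.mem_toFinset.1 hG)
  have hY : Y.card ≤ T'.card * ((s + 1) * Fintype.card V ^ 4) := by
    rw [Finset.card_sigma, ← smul_eq_mul, ← Finset.sum_const]
    refine Finset.sum_le_sum fun H hH => ?_
    have hH : gadgetCount x P H = s + 1 := (Set.mem_toFinset.1 hH).1
    rw [Finset.card_product, Finset.card_univ]
    simp only [Fintype.card_prod]
    refine (Nat.mul_le_mul_right _ card_cappedLabels_le).trans ?_
    rw [← gadgetCount_eq hP, hH]
    exact le_of_eq (by ring)
  refine hX.trans (le_trans ?_ hY)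
  -- The former partners of y₁, y₂, u₁, u₂: together with the result and the label they allow both
  -- rotations to be undone, and z, w are then the new partners of the first and third of them.
  let g : Label → (ℕ → V → V) → V × V × V × V := fun l m =>
    (m l.2.2.1 (verts m x c l).y₁, m l.2.2.1 (verts m x c l).y₂, m l.2.2.1 (verts m x c l).u₁,
      m l.2.2.1 (verts m x c l).u₂)
  refine Finset.card_le_card_of_forall_subsingleton (fun a b =>
    b.1.mate = switchAt a.1.mate x c a.2.1 a.2.2.1 a.2.2.2 ∧ b.2 = (a.2.1, g a.2.1 a.1.mate)) ?_ ?_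
  · rintro ⟨G, l, z, w⟩ ha
    obtain ⟨hG, hg⟩ := Finset.mem_sigma.1 ha
    obtain ⟨hb, hg⟩ := Finset.mem_filter.1 hg
    have hl := (Finset.mem_product.1 hb).1
    obtain ⟨H, hH, hm⟩ := GoodSwitch.exists_mem_level hP (Set.mem_toFinset.1 hG) hl hg
    refine ⟨⟨H, l, g l G.mate⟩, ?_, hm, rfl⟩
    refine Finset.mem_sigma.2 ⟨Set.mem_toFinset.2 hH, Finset.mem_product.2 ⟨?_, Finset.mem_univ _⟩⟩
    refine Finset.mem_filter.2 ⟨hl, ?_⟩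
    rw [hm]
    exact (hg.labelCount_switchAt G.isMating hP hl).2
  · rintro ⟨H, l, p⟩ - ⟨G, l₁, z, w⟩ ⟨ha, hm, hp⟩ ⟨G', l₂, z', w'⟩ ⟨ha', hm', hp'⟩
    obtain ⟨hG, hg⟩ := Finset.mem_sigma.1 ha
    obtain ⟨hb, hg⟩ := Finset.mem_filter.1 hg
    have hl := (Finset.mem_product.1 hb).1
    obtain ⟨hG', hg'⟩ := Finset.mem_sigma.1 ha'
    obtain ⟨hb', hg'⟩ := Finset.mem_filter.1 hg'
    have hl' := (Finset.mem_product.1 hb').1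
    obtain ⟨rfl, hp⟩ := Prod.ext_iff.1 hp
    obtain ⟨hll, hp'⟩ := Prod.ext_iff.1 hp'
    dsimp only at hm hm' hp hp' hl hl' hg hg' hll
    subst hll
    obtain ⟨r1, r2, r3, r4⟩ := hg.recover G.isMating hP hl
    obtain ⟨r1', r2', r3', r4'⟩ := hg'.recover G'.isMating hP hl'
    rw [← hm] at r1 r2 r3 r4
    rw [← hm'] at r1' r2' r3' r4'
    have hgg := hp.symm.trans hp'
    simp only [g, Prod.ext_iff] at hgg
    obtain ⟨e1, e2, e3, e4⟩ := hgg
    have hGG : G = G' := by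
      apply mate_injective
      rw [← r2, ← r2', ← r1, ← r1']
      rw [← r1] at e1 e2 e3 e4
      rw [← r1'] at e1 e2 e3 e4
      rw [e1, e2, e3, e4]
    subst hGG
    rw [← r3, ← r4, ← r3', ← r4']

end

end ColouredGraph

/-! ### Bad labels: adjacency and coincidence conditions -/

namespace ColouredGraph

variable {V : Type*} {D : Finset ℕ} {c : ℕ} {P : Fin 4 → Finset ℕ} {x : V} {m : ℕ → V → V}

open Classical in
/-- The ordered adjacent pairs between two sets. -/
noncomputable def adjPairs (E : Finset ℕ) (m : ℕ → V → V) (A B : Finset V) : Finset (V × V) :=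
  (A ×ˢ B).filter fun p => MAdj E m p.1 p.2

theorem mem_adjPairs {E : Finset ℕ} {A B : Finset V} {a b : V} :
    (a, b) ∈ adjPairs E m A B ↔ a ∈ A ∧ b ∈ B ∧ MAdj E m a b := by
  simp [adjPairs, and_assoc]

/-- Between any two sets of at most `|D|` vertices there are at most `Δ` ordered adjacent pairs,
where `Δ` is not too small. -/
structure IsSparse (D : Finset ℕ) (c : ℕ) (m : ℕ → V → V) (Δ : ℕ) : Prop where
  pairs : ∀ A B : Finset V, A.card ≤ D.card → B.card ≤ D.card →
    (adjPairs (insert c D) m A B).card ≤ Δ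
  le : D.card ≤ Δ

theorem card_nbrs_le (v : V) : (nbrs D m v).card ≤ D.card := by
  classical
  exact Finset.card_image_le

theorem mAdj_of_mem {E : Finset ℕ} {d : ℕ} (hd : d ∈ E) (v : V) : MAdj E m v (m d v) :=
  ⟨d, hd, rfl⟩

/-- If every choice of two of the four colours leaves at most `K` labels, there are at most
`K|D|²` labels. -/
theorem card_le_of_fibres {T : Finset Label} (f : Label → ℕ × ℕ) (hf : ∀ l ∈ T, f l ∈ D ×ˢ D)
    {K : ℕ}
    (hK : ∀ a b, (T.filter fun l => f l = (a, b)).card ≤ K) : T.card ≤ K * D.card ^ 2 := by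
  have h := Finset.card_le_mul_card_image_of_maps_to hf K (fun p _ => hK p.1 p.2)
  rwa [Finset.card_product, ← sq] at h

/-- The standard bound for a bad property: `f` picks two colours, at most |D|² choices, and the
other two are recovered from an adjacent pair between two sets depending only on `f`, at most Δ
choices. -/
theorem card_le_of_pairs {T : Finset Label} {Δ : ℕ} (hs : IsSparse D c m Δ) (f : Label → ℕ × ℕ)
    (hf : ∀ l ∈ T, f l ∈ D ×ˢ D)
    (A B : ℕ × ℕ → Finset V)
    (hA : ∀ p, (A p).card ≤ D.card) (hB : ∀ p, (B p).card ≤ D.card) (g : Label → V × V)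
    (hg : ∀ l ∈ T, g l ∈ adjPairs (insert c D) m (A (f l)) (B (f l)))
    (hinj : ∀ l ∈ T, ∀ l' ∈ T, f l = f l' → g l = g l' → l = l') : T.card ≤ Δ * D.card ^ 2 := by
  refine card_le_of_fibres f hf fun a b =>
    le_trans ?_ (hs.pairs (A (a, b)) (B (a, b)) (hA _) (hB _))
  refine Finset.card_le_card_of_injOn g ?_ ?_
  · intro l hl
    obtain ⟨hl, he⟩ := Finset.mem_filter.1 hl
    rw [← he]
    exact hg l hl
  · intro l hl l' hl' h
    obtain ⟨hl, he⟩ := Finset.mem_filter.1 hl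
    obtain ⟨hl', he'⟩ := Finset.mem_filter.1 hl'
    exact hinj l hl l' hl' (he.trans he'.symm) h

/-- For coincidences of vertices three colours determine the fourth, giving |D|³ labels. This fits
the common shape since |D| ≤ Δ. -/
theorem card_le_of_determined {T : Finset Label} {Δ : ℕ} (hs : IsSparse D c m Δ) (f : Label → ℕ × ℕ)
    (hf : ∀ l ∈ T, f l ∈ D ×ˢ D)
    (g : Label → ℕ) (hg : ∀ l ∈ T, g l ∈ D)
    (hinj : ∀ l ∈ T, ∀ l' ∈ T, f l = f l' → g l = g l' → l = l') : T.card ≤ Δ * D.card ^ 2 := by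
  refine card_le_of_fibres f hf fun a b => le_trans ?_ hs.le
  refine Finset.card_le_card_of_injOn g ?_ ?_
  · intro l hl
    exact hg l (Finset.mem_filter.1 hl).1
  · intro l hl l' hl' h
    obtain ⟨hl, he⟩ := Finset.mem_filter.1 hl
    obtain ⟨hl', he'⟩ := Finset.mem_filter.1 hl'
    exact hinj l hl l' hl' (he.trans he'.symm) h

section

variable {T : Finset Label}

theorem label_mem (hP : IsPalette D c P) (hT : T ⊆ labelBox P) {l : Label} (hl : l ∈ T) :
    l.1 ∈ D ∧ l.2.1 ∈ D ∧ l.2.2.1 ∈ D ∧ l.2.2.2 ∈ D := by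
  obtain ⟨h1, h2, h3, h4⟩ := mem_labelBox.1 (hT hl)
  exact ⟨hP.subset _ h1, hP.subset _ h2, hP.subset _ h3, hP.subset _ h4⟩

theorem label_ext {l l' : Label} (h1 : l.1 = l'.1) (h2 : l.2.1 = l'.2.1)
    (h3 : l.2.2.1 = l'.2.2.1) (h4 : l.2.2.2 = l'.2.2.2) : l = l' :=
  Prod.ext h1 (Prod.ext h2 (Prod.ext h3 h4))

theorem colour_inj (hm : IsMating (insert c D) m) {d d' : ℕ} (hd : d ∈ D) (hd' : d' ∈ D) {v : V}
    (h : m d v = m d' v) : d = d' :=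
  hm.eq_of_eq _ (Finset.mem_insert_of_mem hd) _ (Finset.mem_insert_of_mem hd') v h

variable {Δ : ℕ}

theorem card_top_le (hm : IsMating (insert c D) m) (hP : IsPalette D c P) (hs : IsSparse D c m Δ)
    (hT : T ⊆ labelBox P)
    (h : ∀ l ∈ T, MAdj (insert c D) m (verts m x c l).y₁ (verts m x c l).y₂) :
    T.card ≤ Δ * D.card ^ 2 := by
  refine card_le_of_pairs hs (fun l => l.2.2) (fun l hl => ?_) (fun _ => nbrs D m x)
    (fun _ => nbrs D m x) (fun _ => card_nbrs_le x) (fun _ => card_nbrs_le x)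
    (fun l => ((verts m x c l).y₁, (verts m x c l).y₂)) (fun l hl => ?_) ?_
  · have := label_mem hP hT hl
    exact Finset.mem_product.2 this.2.2
  · have := mem_labelBox.1 (hT hl)
    exact mem_adjPairs.2 ⟨mem_nbrs hP this.1, mem_nbrs hP this.2.1, h l hl⟩
  · intro l hl l' hl' h1 h2
    obtain ⟨a1, a2, -, -⟩ := label_mem hP hT hl
    obtain ⟨b1, b2, -, -⟩ := label_mem hP hT hl'
    simp only [Prod.ext_iff] at h1 h2
    exact label_ext (colour_inj hm a1 b1 h2.1) (colour_inj hm a2 b2 h2.2) h1.1 h1.2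

theorem card_u₁_nbrs_le (hm : IsMating (insert c D) m) (hP : IsPalette D c P)
    (hs : IsSparse D c m Δ) (hT : T ⊆ labelBox P) (h : ∀ l ∈ T, (verts m x c l).u₁ ∈ nbrs D m x) :
    T.card ≤ Δ * D.card ^ 2 := by
  refine card_le_of_pairs hs (fun l => (l.2.1, l.2.2.1)) (fun l hl => ?_)
    (fun _ => nbrs D m x)
    (fun _ => nbrs D m x) (fun _ => card_nbrs_le x) (fun _ => card_nbrs_le x)
    (fun l => ((verts m x c l).v₁, (verts m x c l).u₁)) (fun l hl => ?_) ?_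
  · have := label_mem hP hT hl
    exact Finset.mem_product.2 ⟨this.2.1, this.2.2.1⟩
  · have := mem_labelBox.1 (hT hl)
    exact mem_adjPairs.2 ⟨mem_nbrs hP this.2.2.2, h l hl, mAdj_of_mem (hP.mem this.1) _⟩
  · intro l hl l' hl' h1 h2
    obtain ⟨a1, a2, a3, a4⟩ := label_mem hP hT hl
    obtain ⟨b1, b2, b3, b4⟩ := label_mem hP hT hl'
    simp only [Prod.ext_iff, verts] at h1 h2
    have e4 := colour_inj hm a4 b4 h2.1
    rw [← e4] at h2
    exact label_ext (colour_inj hm a1 b1 h2.2) h1.1 h1.2 e4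

theorem card_far_le (hm : IsMating (insert c D) m) (hP : IsPalette D c P) (hs : IsSparse D c m Δ)
    (hT : T ⊆ labelBox P)
    (h : ∀ l ∈ T, MAdj (insert c D) m (verts m x c l).u₁ (verts m x c l).u₂) :
    T.card ≤ Δ * D.card ^ 2 := by
  refine card_le_of_pairs hs (fun l => l.2.2) (fun l hl => ?_)
    (fun p => nbrs D m (m p.2 x)) (fun p => nbrs D m (m c (m p.2 x)))
    (fun _ => card_nbrs_le _) (fun _ => card_nbrs_le _)
    (fun l => ((verts m x c l).u₁, (verts m x c l).u₂)) (fun l hl => ?_) ?_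
  · have := label_mem hP hT hl
    exact Finset.mem_product.2 this.2.2
  · have := mem_labelBox.1 (hT hl)
    exact mem_adjPairs.2 ⟨mem_nbrs hP this.1, mem_nbrs hP this.2.1, h l hl⟩
  · intro l hl l' hl' h1 h2
    obtain ⟨a1, a2, -, -⟩ := label_mem hP hT hl
    obtain ⟨b1, b2, -, -⟩ := label_mem hP hT hl'
    simp only [Prod.ext_iff, verts] at h1 h2
    rw [← h1.2] at h2
    exact label_ext (colour_inj hm a1 b1 h2.1) (colour_inj hm a2 b2 h2.2) h1.1 h1.2

open Classical in
-- With d₃, d₄ fixed, u₁ is a neighbour of v₁, and its d₂-mate lies in the image of the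
-- neighbourhood of x under colour `c`; the two are adjacent.
theorem card_swap_le (hm : IsMating (insert c D) m) (hP : IsPalette D c P) (hs : IsSparse D c m Δ)
    (hT : T ⊆ labelBox P) (h : ∀ l ∈ T, m c (m l.2.1 (verts m x c l).u₁) ∈ nbrs D m x) :
    T.card ≤ Δ * D.card ^ 2 := by
  refine card_le_of_pairs hs (fun l => l.2.2) (fun l hl => ?_)
    (fun p => nbrs D m (m p.2 x)) (fun _ => (nbrs D m x).image (m c))
    (fun _ => card_nbrs_le _) (fun _ => Finset.card_image_le.trans (card_nbrs_le _))
    (fun l => ((verts m x c l).u₁, m l.2.1 (verts m x c l).u₁)) (fun l hl => ?_) ?_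
  · have := label_mem hP hT hl
    exact Finset.mem_product.2 this.2.2
  · have := mem_labelBox.1 (hT hl)
    refine mem_adjPairs.2 ⟨mem_nbrs hP this.1, ?_, mAdj_of_mem (hP.mem this.2.1) _⟩
    exact Finset.mem_image.2 ⟨_, h l hl, hm.invol _ _⟩
  · intro l hl l' hl' h1 h2
    obtain ⟨a1, a2, -, -⟩ := label_mem hP hT hl
    obtain ⟨b1, b2, -, -⟩ := label_mem hP hT hl'
    simp only [Prod.ext_iff, verts] at h1 h2
    rw [← h1.2] at h2
    have e1 := colour_inj hm a1 b1 h2.1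
    rw [← e1] at h2
    exact label_ext e1 (colour_inj hm a2 b2 h2.2) h1.1 h1.2

theorem card_u₂_y₁_le (hm : IsMating (insert c D) m) (hP : IsPalette D c P)
    (hs : IsSparse D c m Δ) (hT : T ⊆ labelBox P)
    (h : ∀ l ∈ T, (verts m x c l).u₂ = (verts m x c l).y₁) : T.card ≤ Δ * D.card ^ 2 := by
  refine card_le_of_determined hs (fun l => l.2.2) (fun l hl => ?_) (fun l => l.1)
    (fun l hl => (label_mem hP hT hl).1) ?_
  · exact Finset.mem_product.2 (label_mem hP hT hl).2.2
  · intro l hl l' hl' h1 h2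
    obtain ⟨a1, a2, a3, a4⟩ := label_mem hP hT hl
    obtain ⟨b1, b2, b3, b4⟩ := label_mem hP hT hl'
    have k := h l hl
    have k' := h l' hl'
    simp only [Prod.ext_iff, verts] at h1 k k'
    rw [← h1.2, ← h2] at k'
    exact label_ext h2 (colour_inj hm a2 b2 (k.trans k'.symm)) h1.1 h1.2

theorem card_u₁_u₂_le (hm : IsMating (insert c D) m) (hP : IsPalette D c P)
    (hs : IsSparse D c m Δ) (hT : T ⊆ labelBox P)
    (h : ∀ l ∈ T, (verts m x c l).u₁ = (verts m x c l).u₂) : T.card ≤ Δ * D.card ^ 2 := by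
  refine card_le_of_determined hs (fun l => l.2.2) (fun l hl => ?_) (fun l => l.1)
    (fun l hl => (label_mem hP hT hl).1) ?_
  · exact Finset.mem_product.2 (label_mem hP hT hl).2.2
  · intro l hl l' hl' h1 h2
    obtain ⟨a1, a2, a3, a4⟩ := label_mem hP hT hl
    obtain ⟨b1, b2, b3, b4⟩ := label_mem hP hT hl'
    have k := h l hl
    have k' := h l' hl'
    simp only [Prod.ext_iff, verts] at h1 k k'
    rw [← h1.2, ← h2] at k'
    exact label_ext h2 (colour_inj hm a2 b2 (k.symm.trans k')) h1.1 h1.2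

theorem card_v₂_y₁_le (hm : IsMating (insert c D) m) (hP : IsPalette D c P)
    (hs : IsSparse D c m Δ) (hT : T ⊆ labelBox P)
    (h : ∀ l ∈ T, (verts m x c l).v₂ = (verts m x c l).y₁) : T.card ≤ Δ * D.card ^ 2 := by
  refine card_le_of_determined hs (fun l => (l.2.1, l.2.2.1)) (fun l hl => ?_)
    (fun l => l.2.2.2) (fun l hl => (label_mem hP hT hl).2.2.2) ?_
  · exact Finset.mem_product.2 ⟨(label_mem hP hT hl).2.1, (label_mem hP hT hl).2.2.1⟩
  · intro l hl l' hl' h1 h2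
    obtain ⟨a1, a2, a3, a4⟩ := label_mem hP hT hl
    obtain ⟨b1, b2, b3, b4⟩ := label_mem hP hT hl'
    have k := h l hl
    have k' := h l' hl'
    simp only [Prod.ext_iff, verts] at h1 k k'
    rw [← h2] at k'
    exact label_ext (colour_inj hm a1 b1 (k.symm.trans k')) h1.1 h1.2 h2

theorem card_v₂_y₂_le (hm : IsMating (insert c D) m) (hP : IsPalette D c P)
    (hs : IsSparse D c m Δ) (hT : T ⊆ labelBox P)
    (h : ∀ l ∈ T, (verts m x c l).v₂ = (verts m x c l).y₂) : T.card ≤ Δ * D.card ^ 2 := by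
  refine card_le_of_determined hs (fun l => (l.1, l.2.2.1)) (fun l hl => ?_)
    (fun l => l.2.2.2) (fun l hl => (label_mem hP hT hl).2.2.2) ?_
  · exact Finset.mem_product.2 ⟨(label_mem hP hT hl).1, (label_mem hP hT hl).2.2.1⟩
  · intro l hl l' hl' h1 h2
    obtain ⟨a1, a2, a3, a4⟩ := label_mem hP hT hl
    obtain ⟨b1, b2, b3, b4⟩ := label_mem hP hT hl'
    have k := h l hl
    have k' := h l' hl'
    simp only [Prod.ext_iff, verts] at h1 k k'
    rw [← h2] at k'
    exact label_ext h1.1 (colour_inj hm a2 b2 (k.symm.trans k')) h1.2 h2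

theorem card_u₁_y₁_mate_le (hm : IsMating (insert c D) m) (hP : IsPalette D c P)
    (hs : IsSparse D c m Δ) (hT : T ⊆ labelBox P)
    (h : ∀ l ∈ T, (verts m x c l).u₁ = m l.2.2.1 (verts m x c l).y₁) :
    T.card ≤ Δ * D.card ^ 2 := by
  refine card_le_of_determined hs (fun l => (l.2.1, l.2.2.2)) (fun l hl => ?_)
    (fun l => l.1) (fun l hl => (label_mem hP hT hl).1) ?_
  · exact Finset.mem_product.2 ⟨(label_mem hP hT hl).2.1, (label_mem hP hT hl).2.2.2⟩
  · intro l hl l' hl' h1 h2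
    obtain ⟨a1, a2, a3, a4⟩ := label_mem hP hT hl
    obtain ⟨b1, b2, b3, b4⟩ := label_mem hP hT hl'
    have k := h l hl
    have k' := h l' hl'
    simp only [Prod.ext_iff, verts] at h1 k k'
    rw [← h2, ← h1.2] at k'
    exact label_ext h2 h1.1 (colour_inj hm a3 b3 (k.symm.trans k')) h1.2

theorem card_u₁_y₂_mate_le (hm : IsMating (insert c D) m) (hP : IsPalette D c P)
    (hs : IsSparse D c m Δ) (hT : T ⊆ labelBox P)
    (h : ∀ l ∈ T, (verts m x c l).u₁ = m l.2.2.1 (verts m x c l).y₂) :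
    T.card ≤ Δ * D.card ^ 2 := by
  refine card_le_of_determined hs (fun l => (l.1, l.2.2.2)) (fun l hl => ?_)
    (fun l => l.2.1) (fun l hl => (label_mem hP hT hl).2.1) ?_
  · exact Finset.mem_product.2 ⟨(label_mem hP hT hl).1, (label_mem hP hT hl).2.2.2⟩
  · intro l hl l' hl' h1 h2
    obtain ⟨a1, a2, a3, a4⟩ := label_mem hP hT hl
    obtain ⟨b1, b2, b3, b4⟩ := label_mem hP hT hl'
    have k := h l hl
    have k' := h l' hl'
    simp only [Prod.ext_iff, verts] at h1 k k'
    rw [← h2, ← h1.1, ← h1.2] at k'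
    exact label_ext h1.1 h2 (colour_inj hm a3 b3 (k.symm.trans k')) h1.2

theorem card_u₂_y₁_mate_le (hm : IsMating (insert c D) m) (hP : IsPalette D c P)
    (hs : IsSparse D c m Δ) (hT : T ⊆ labelBox P)
    (h : ∀ l ∈ T, (verts m x c l).u₂ = m l.2.2.1 (verts m x c l).y₁) :
    T.card ≤ Δ * D.card ^ 2 := by
  refine card_le_of_determined hs (fun l => (l.2.1, l.2.2.2)) (fun l hl => ?_)
    (fun l => l.1) (fun l hl => (label_mem hP hT hl).1) ?_
  · exact Finset.mem_product.2 ⟨(label_mem hP hT hl).2.1, (label_mem hP hT hl).2.2.2⟩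
  · intro l hl l' hl' h1 h2
    obtain ⟨a1, a2, a3, a4⟩ := label_mem hP hT hl
    obtain ⟨b1, b2, b3, b4⟩ := label_mem hP hT hl'
    have k := h l hl
    have k' := h l' hl'
    simp only [Prod.ext_iff, verts] at h1 k k'
    rw [← h2, ← h1.1, ← h1.2] at k'
    exact label_ext h2 h1.1 (colour_inj hm a3 b3 (k.symm.trans k')) h1.2

theorem card_u₂_y₂_mate_le (hm : IsMating (insert c D) m) (hP : IsPalette D c P)
    (hs : IsSparse D c m Δ) (hT : T ⊆ labelBox P)
    (h : ∀ l ∈ T, (verts m x c l).u₂ = m l.2.2.1 (verts m x c l).y₂) :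
    T.card ≤ Δ * D.card ^ 2 := by
  refine card_le_of_determined hs (fun l => (l.1, l.2.2.2)) (fun l hl => ?_)
    (fun l => l.2.1) (fun l hl => (label_mem hP hT hl).2.1) ?_
  · exact Finset.mem_product.2 ⟨(label_mem hP hT hl).1, (label_mem hP hT hl).2.2.2⟩
  · intro l hl l' hl' h1 h2
    obtain ⟨a1, a2, a3, a4⟩ := label_mem hP hT hl
    obtain ⟨b1, b2, b3, b4⟩ := label_mem hP hT hl'
    have k := h l hl
    have k' := h l' hl'
    simp only [Prod.ext_iff, verts] at h1 k k'
    rw [← h2, ← h1.2] at k'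
    exact label_ext h1.1 h2 (colour_inj hm a3 b3 (k.symm.trans k')) h1.2

end

end ColouredGraph

/-! ### Bad labels: fragile edges, completions and saturation -/

namespace ColouredGraph

variable {V : Type*} {D : Finset ℕ} {c : ℕ} {P : Fin 4 → Finset ℕ} {x : V} {m : ℕ → V → V}
  {Δ : ℕ} {T : Finset Label}

/-- All edges e₃ lie inside the neighbourhood of x, so there are at most Δ of them; 14 is the
threshold 13 plus one. -/
theorem card_fragileEdges_le [DecidableEq (Sym2 V)] (hP : IsPalette D c P)
    (hs : IsSparse D c m Δ) : (fragileEdges m x c P).card ≤ 14 * Δ := by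
  classical
  refine (card_fragile_le _ _ _ _).trans (Nat.mul_le_mul_left _ ?_)
  have h : (gadgetLabels m x c P).image (topEdge m x c) ⊆
      (adjPairs (insert c D) m (nbrs D m x) (nbrs D m x)).image fun p => s(p.1, p.2) := by
    intro e he
    obtain ⟨l, hl, rfl⟩ := Finset.mem_image.1 he
    obtain ⟨hb, -, h3, -⟩ := mem_gadgetLabels.1 hl
    have := mem_labelBox.1 hb
    exact Finset.mem_image.2 ⟨((verts m x c l).y₁, (verts m x c l).y₂), mem_adjPairs.2
      ⟨mem_nbrs hP this.1, mem_nbrs hP this.2.1, _, hP.mem this.2.2.1, h3⟩, rfl⟩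
  exact (Finset.card_le_card h).trans (Finset.card_image_le.trans
    (hs.pairs _ _ (card_nbrs_le x) (card_nbrs_le x)))

open Classical in
/-- The orientations of the edges in a finite set. -/
noncomputable def orientations [Fintype V] (S : Finset (Sym2 V)) : Finset (V × V) :=
  Finset.univ.filter fun p => s(p.1, p.2) ∈ S

theorem mem_orientations [Fintype V] {S : Finset (Sym2 V)} {a b : V} :
    (a, b) ∈ orientations S ↔ s(a, b) ∈ S := by
  simp [orientations]

theorem card_orientations_le [Fintype V] (S : Finset (Sym2 V)) :
    (orientations S).card ≤ 2 * S.card := by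
  classical
  refine Finset.card_le_mul_card_image_of_maps_to (f := fun p : V × V => s(p.1, p.2))
    (fun p hp => (Finset.mem_filter.1 hp).2) 2 ?_
  intro e _
  refine (Finset.card_le_card_of_injOn (t := e.toFinset) Prod.fst ?_ ?_).trans
    (by rw [Sym2.card_toFinset]; split_ifs <;> norm_num)
  · intro p hp
    rw [← (Finset.mem_filter.1 hp).2]
    simp
  · intro p hp p' hp' h
    have h2 := (Finset.mem_filter.1 hp).2.trans (Finset.mem_filter.1 hp').2.symm
    rw [h] at h2
    exact Prod.ext h (Sym2.congr_right.1 h2)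

/-- Two colours and one of the at most 28Δ oriented fragile edges determine the label. -/
theorem card_frag_le [Fintype V] [DecidableEq (Sym2 V)] (hP : IsPalette D c P)
    (hs : IsSparse D c m Δ) (f : Label → ℕ × ℕ) (hf : ∀ l ∈ T, f l ∈ D ×ˢ D) (g : Label → V)
    (hg : ∀ l ∈ T, s(g l, m l.2.2.1 (g l)) ∈ fragileEdges m x c P)
    (hinj : ∀ l ∈ T, ∀ l' ∈ T, f l = f l' → g l = g l' →
      m l.2.2.1 (g l) = m l'.2.2.1 (g l) → l = l') : T.card ≤ 28 * Δ * D.card ^ 2 := by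
  refine card_le_of_fibres f hf fun a b => ?_
  have h1 := card_orientations_le (fragileEdges m x c P)
  have h2 := card_fragileEdges_le (x := x) hP hs
  refine le_trans (Finset.card_le_card_of_injOn (t := orientations (fragileEdges m x c P))
    (fun l => (g l, m l.2.2.1 (g l))) ?_ ?_) (by omega)
  · intro l hl
    exact mem_orientations.2 (hg l (Finset.mem_filter.1 hl).1)
  · intro l hl l' hl' h
    obtain ⟨hl, he⟩ := Finset.mem_filter.1 hl
    obtain ⟨hl', he'⟩ := Finset.mem_filter.1 hl'
    obtain ⟨e1, e2⟩ := Prod.ext_iff.1 h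
    dsimp only at e1 e2
    rw [← e1] at e2
    exact hinj l hl l' hl' (he.trans he'.symm) e1 e2

theorem card_frag_y₁_le [Fintype V] [DecidableEq (Sym2 V)] (hm : IsMating (insert c D) m)
    (hP : IsPalette D c P) (hs : IsSparse D c m Δ) (hT : T ⊆ labelBox P)
    (h : ∀ l ∈ T, s((verts m x c l).y₁, m l.2.2.1 (verts m x c l).y₁) ∈ fragileEdges m x c P) :
    T.card ≤ 28 * Δ * D.card ^ 2 := by
  refine card_frag_le hP hs (fun l => (l.2.1, l.2.2.2)) (fun l hl => ?_) _ h ?_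
  · exact Finset.mem_product.2 ⟨(label_mem hP hT hl).2.1, (label_mem hP hT hl).2.2.2⟩
  · intro l hl l' hl' h1 h2 h3
    obtain ⟨a1, a2, a3, a4⟩ := label_mem hP hT hl
    obtain ⟨b1, b2, b3, b4⟩ := label_mem hP hT hl'
    simp only [Prod.ext_iff] at h1
    exact label_ext (colour_inj hm a1 b1 h2) h1.1 (colour_inj hm a3 b3 h3) h1.2

theorem card_frag_y₂_le [Fintype V] [DecidableEq (Sym2 V)] (hm : IsMating (insert c D) m)
    (hP : IsPalette D c P) (hs : IsSparse D c m Δ) (hT : T ⊆ labelBox P)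
    (h : ∀ l ∈ T, s((verts m x c l).y₂, m l.2.2.1 (verts m x c l).y₂) ∈ fragileEdges m x c P) :
    T.card ≤ 28 * Δ * D.card ^ 2 := by
  refine card_frag_le hP hs (fun l => (l.1, l.2.2.2)) (fun l hl => ?_) _ h ?_
  · exact Finset.mem_product.2 ⟨(label_mem hP hT hl).1, (label_mem hP hT hl).2.2.2⟩
  · intro l hl l' hl' h1 h2 h3
    obtain ⟨a1, a2, a3, a4⟩ := label_mem hP hT hl
    obtain ⟨b1, b2, b3, b4⟩ := label_mem hP hT hl'
    simp only [Prod.ext_iff] at h1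
    exact label_ext h1.1 (colour_inj hm a2 b2 h2) (colour_inj hm a3 b3 h3) h1.2

theorem card_frag_u₁_le [Fintype V] [DecidableEq (Sym2 V)] (hm : IsMating (insert c D) m)
    (hP : IsPalette D c P) (hs : IsSparse D c m Δ) (hT : T ⊆ labelBox P)
    (h : ∀ l ∈ T, s((verts m x c l).u₁, m l.2.2.1 (verts m x c l).u₁) ∈ fragileEdges m x c P) :
    T.card ≤ 28 * Δ * D.card ^ 2 := by
  refine card_frag_le hP hs (fun l => (l.1, l.2.1)) (fun l hl => ?_) _ h ?_
  · exact Finset.mem_product.2 ⟨(label_mem hP hT hl).1, (label_mem hP hT hl).2.1⟩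
  · intro l hl l' hl' h1 h2 h3
    obtain ⟨a1, a2, a3, a4⟩ := label_mem hP hT hl
    obtain ⟨b1, b2, b3, b4⟩ := label_mem hP hT hl'
    simp only [Prod.ext_iff] at h1
    simp only [verts, ← h1.1] at h2
    exact label_ext h1.1 h1.2 (colour_inj hm a3 b3 h3) (colour_inj hm a4 b4 (hm.injective _ h2))

theorem card_frag_u₂_le [Fintype V] [DecidableEq (Sym2 V)] (hm : IsMating (insert c D) m)
    (hP : IsPalette D c P) (hs : IsSparse D c m Δ) (hT : T ⊆ labelBox P)
    (h : ∀ l ∈ T, s((verts m x c l).u₂, m l.2.2.1 (verts m x c l).u₂) ∈ fragileEdges m x c P) :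
    T.card ≤ 28 * Δ * D.card ^ 2 := by
  refine card_frag_le hP hs (fun l => (l.1, l.2.1)) (fun l hl => ?_) _ h ?_
  · exact Finset.mem_product.2 ⟨(label_mem hP hT hl).1, (label_mem hP hT hl).2.1⟩
  · intro l hl l' hl' h1 h2 h3
    obtain ⟨a1, a2, a3, a4⟩ := label_mem hP hT hl
    obtain ⟨b1, b2, b3, b4⟩ := label_mem hP hT hl'
    simp only [Prod.ext_iff] at h1
    simp only [verts, ← h1.2] at h2
    exact label_ext h1.1 h1.2 (colour_inj hm a3 b3 h3)
      (colour_inj hm a4 b4 (hm.injective _ (hm.injective _ h2)))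

/-- The witness `d` and the colour d₄ are free. Given them, d₁, d₂, d₃ are read off from an adjacent
pair between the neighbourhoods of the two ends of the c-edge at `m d x`. -/
theorem card_side_le (hm : IsMating (insert c D) m) (hP : IsPalette D c P)
    (hs : IsSparse D c m Δ) (hT : T ⊆ labelBox P)
    (h : ∀ l ∈ T, ∃ d ∈ P 3, m l.2.2.1 (m l.1 (m d x)) = m l.2.1 (m c (m d x))) :
    T.card ≤ Δ * D.card ^ 2 := by
  classical
  have hsub : T ⊆ (P 3).biUnion fun d =>
      T.filter fun l => m l.2.2.1 (m l.1 (m d x)) = m l.2.1 (m c (m d x)) := by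
    intro l hl
    obtain ⟨d, hd, hh⟩ := h l hl
    exact Finset.mem_biUnion.2 ⟨d, hd, Finset.mem_filter.2 ⟨hl, hh⟩⟩
  refine (Finset.card_le_card hsub).trans ((Finset.card_biUnion_le_card_mul _ _
    (D.card * Δ) ?_).trans ?_)
  · intro d _
    have hb := hs.pairs (nbrs D m (m d x)) (nbrs D m (m c (m d x))) (card_nbrs_le _)
      (card_nbrs_le _)
    refine (Finset.card_le_card_of_injOn (t := D ×ˢ adjPairs (insert c D) m (nbrs D m (m d x))
      (nbrs D m (m c (m d x)))) (fun l => (l.2.2.2, m l.1 (m d x), m l.2.1 (m c (m d x))))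
      ?_ ?_).trans (by rw [Finset.card_product]; exact Nat.mul_le_mul_left _ hb)
    · intro l hl
      obtain ⟨hl, he⟩ := Finset.mem_filter.1 hl
      have hb := mem_labelBox.1 (hT hl)
      refine Finset.mem_product.2 ⟨(label_mem hP hT hl).2.2.2, mem_adjPairs.2
        ⟨mem_nbrs hP hb.1, mem_nbrs hP hb.2.1, ?_⟩⟩
      exact ⟨_, hP.mem hb.2.2.1, he⟩
    · intro l hl l' hl' hh
      obtain ⟨hl, he⟩ := Finset.mem_filter.1 hl
      obtain ⟨hl', he'⟩ := Finset.mem_filter.1 hl'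
      obtain ⟨a1, a2, a3, a4⟩ := label_mem hP hT hl
      obtain ⟨b1, b2, b3, b4⟩ := label_mem hP hT hl'
      simp only [Prod.ext_iff] at hh
      have e1 := colour_inj hm a1 b1 hh.2.1
      have e2 := colour_inj hm a2 b2 hh.2.2
      rw [← e1, ← e2] at he'
      exact label_ext e1 e2 (colour_inj hm a3 b3 (he.trans he'.symm)) hh.1
  · have := Nat.mul_le_mul_right (D.card * Δ) (Finset.card_le_card (hP.subset 3))
    exact this.trans (le_of_eq (by ring))

open Classical in
/-- The labels whose edge `e₃` is present. -/
noncomputable def topLabels (m : ℕ → V → V) (x : V) (c : ℕ) (P : Fin 4 → Finset ℕ) :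
    Finset Label :=
  (labelBox P).filter fun l => m l.2.2.1 (verts m x c l).y₁ = (verts m x c l).y₂

theorem card_topLabels_le (hm : IsMating (insert c D) m) (hP : IsPalette D c P)
    (hs : IsSparse D c m Δ) : (topLabels m x c P).card ≤ D.card * Δ := by
  classical
  have hT : topLabels m x c P ⊆ labelBox P := Finset.filter_subset _ _
  have hb := hs.pairs (nbrs D m x) (nbrs D m x) (card_nbrs_le _) (card_nbrs_le _)
  refine (Finset.card_le_card_of_injOn (t := D ×ˢ adjPairs (insert c D) m (nbrs D m x)
    (nbrs D m x)) (fun l => (l.2.2.2, (verts m x c l).y₁, (verts m x c l).y₂))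
    ?_ ?_).trans (by rw [Finset.card_product]; exact Nat.mul_le_mul_left _ hb)
  · intro l hl
    have hb := mem_labelBox.1 (hT hl)
    exact Finset.mem_product.2 ⟨(label_mem hP hT hl).2.2.2, mem_adjPairs.2
      ⟨mem_nbrs hP hb.1, mem_nbrs hP hb.2.1, _, hP.mem hb.2.2.1, (Finset.mem_filter.1 hl).2⟩⟩
  · intro l hl l' hl' hh
    obtain ⟨a1, a2, a3, a4⟩ := label_mem hP hT hl
    obtain ⟨b1, b2, b3, b4⟩ := label_mem hP hT hl'
    have he := (Finset.mem_filter.1 hl).2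
    have he' := (Finset.mem_filter.1 hl').2
    simp only [Prod.ext_iff] at hh
    rw [← hh.2.1, ← hh.2.2] at he'
    exact label_ext (colour_inj hm a1 b1 hh.2.1) (colour_inj hm a2 b2 hh.2.2)
      (colour_inj hm a3 b3 (he.trans he'.symm)) hh.1

/-- The completed gadget has one of at most |D|Δ labels whose e₃ is present. Its far edge gives d₃
and, up to orientation, the pair (a, b); one further colour `g` then determines the label. -/
theorem card_completes_le (hm : IsMating (insert c D) m) (hP : IsPalette D c P)
    (hs : IsSparse D c m Δ) (a b : Label → V)
    (h : ∀ l ∈ T, Completes m x c P l.2.2.1 (a l) (b l)) (g : Label → ℕ) (hg : ∀ l ∈ T, g l ∈ D)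
    (hinj : ∀ l ∈ T, ∀ l' ∈ T, l.2.2.1 = l'.2.2.1 → g l = g l' → a l = a l' → b l = b l' →
      l = l') : T.card ≤ 2 * Δ * D.card ^ 2 := by
  classical
  have hsub : T ⊆ (topLabels m x c P).biUnion fun l' =>
      T.filter fun l => l'.2.2.1 = l.2.2.1 ∧ farEdge m x c l' = s(a l, b l) := by
    intro l hl
    obtain ⟨l', hl', hd, h3, hf⟩ := h l hl
    rw [← hd] at h3
    exact Finset.mem_biUnion.2 ⟨l', Finset.mem_filter.2 ⟨hl', h3⟩,
      Finset.mem_filter.2 ⟨hl, hd, hf⟩⟩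
  refine (Finset.card_le_card hsub).trans ((Finset.card_biUnion_le_card_mul _ _
    (D.card * 2) ?_).trans ?_)
  · intro l₀ _
    refine (Finset.card_le_card_of_injOn (t := D ×ˢ (farEdge m x c l₀).toFinset)
      (fun l => (g l, a l)) ?_ ?_).trans ?_
    · intro l hl
      obtain ⟨hl, -, he⟩ := Finset.mem_filter.1 hl
      refine Finset.mem_product.2 ⟨hg l hl, ?_⟩
      rw [he]
      simp
    · intro l hl l' hl' hh
      obtain ⟨hl, hd, he⟩ := Finset.mem_filter.1 hl
      obtain ⟨hl', hd', he'⟩ := Finset.mem_filter.1 hl'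
      obtain ⟨e1, e2⟩ := Prod.ext_iff.1 hh
      dsimp only at e1 e2
      refine hinj l hl l' hl' (hd.symm.trans hd') e1 e2 ?_
      have := he.symm.trans he'
      rw [e2] at this
      exact Sym2.congr_right.1 this
    · rw [Finset.card_product, Sym2.card_toFinset]
      refine Nat.mul_le_mul_left _ ?_
      split_ifs <;> norm_num
  · refine (Nat.mul_le_mul_right _ (card_topLabels_le hm hP hs)).trans (le_of_eq (by ring))

theorem card_completes_u_le (hm : IsMating (insert c D) m) (hP : IsPalette D c P)
    (hs : IsSparse D c m Δ) (hT : T ⊆ labelBox P)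
    (h : ∀ l ∈ T, Completes m x c P l.2.2.1 (verts m x c l).u₁ (verts m x c l).u₂) :
    T.card ≤ 2 * Δ * D.card ^ 2 := by
  refine card_completes_le hm hP hs _ _ h (fun l => l.1)
    (fun l hl => (label_mem hP hT hl).1) ?_
  intro l hl l' hl' e3 e1 ha hb
  obtain ⟨a1, a2, a3, a4⟩ := label_mem hP hT hl
  obtain ⟨b1, b2, b3, b4⟩ := label_mem hP hT hl'
  simp only [verts, ← e1] at ha hb
  have e4 := colour_inj hm a4 b4 (hm.injective _ ha)
  rw [← e4] at hb
  exact label_ext e1 (colour_inj hm a2 b2 hb) e3 e4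

theorem card_completes_y_le (hm : IsMating (insert c D) m) (hP : IsPalette D c P)
    (hs : IsSparse D c m Δ) (hT : T ⊆ labelBox P)
    (h : ∀ l ∈ T, Completes m x c P l.2.2.1 (verts m x c l).y₁ (verts m x c l).y₂) :
    T.card ≤ 2 * Δ * D.card ^ 2 := by
  refine card_completes_le hm hP hs _ _ h (fun l => l.2.2.2)
    (fun l hl => (label_mem hP hT hl).2.2.2) ?_
  intro l hl l' hl' e3 e4 ha hb
  obtain ⟨a1, a2, a3, a4⟩ := label_mem hP hT hl
  obtain ⟨b1, b2, b3, b4⟩ := label_mem hP hT hl'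
  exact label_ext (colour_inj hm a1 b1 ha) (colour_inj hm a2 b2 hb) e3 e4

/-- Each saturated c-edge contributes |D| to r, so at most r/|D| are saturated. Each excludes at
most two values of d₄, while the other three colours are free. -/
theorem card_sat_le [Fintype V] (hm : IsMating (insert c D) m) (hP : IsPalette D c P)
    (hr : 2 * labelCount D m x c P ≤ Δ) (hT : T ⊆ labelBox P)
    (h : ∀ l ∈ T, D.card ≤ (satLabels m x c P (baseEdge m x c l)).card) :
    T.card ≤ Δ * D.card ^ 2 := by
  classical
  let E := (colourEdges m c).filter fun e => D.card ≤ (satLabels m x c P e).card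
  let S := D.filter fun d => s(m d x, m c (m d x)) ∈ E
  have hE : E.card * D.card ≤ labelCount D m x c P := by
    rw [labelCount, ← smul_eq_mul, ← Finset.sum_const]
    refine (Finset.sum_le_sum fun e he => ?_).trans
      (Finset.sum_le_sum_of_subset (Finset.filter_subset _ _))
    rw [min_eq_left (Finset.mem_filter.1 he).2]
  have hS : S.card ≤ 2 * E.card := by
    refine (Finset.card_le_card_of_injOn (t := orientations E) (fun d => (m d x, m c (m d x)))
      ?_ ?_).trans (card_orientations_le E)
    · intro d hd
      exact mem_orientations.2 (Finset.mem_filter.1 hd).2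
    · intro d hd d' hd' hh
      exact colour_inj hm (Finset.mem_filter.1 hd).1 (Finset.mem_filter.1 hd').1
        (Prod.ext_iff.1 hh).1
  have hTS : T ⊆ D ×ˢ D ×ˢ D ×ˢ S := by
    intro l hl
    obtain ⟨a1, a2, a3, a4⟩ := label_mem hP hT hl
    have hmem : baseEdge m x c l ∈ E := by
      refine Finset.mem_filter.2 ⟨?_, h l hl⟩
      simp only [colourEdges, Finset.mem_image, Finset.mem_univ, true_and]
      exact ⟨_, rfl⟩
    exact Finset.mem_product.2 ⟨a1, Finset.mem_product.2 ⟨a2, Finset.mem_product.2 ⟨a3,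
      Finset.mem_filter.2 ⟨a4, hmem⟩⟩⟩⟩
  refine (Finset.card_le_card hTS).trans ?_
  simp only [Finset.card_product]
  calc D.card * (D.card * (D.card * S.card)) ≤ D.card * (D.card * (D.card * (2 * E.card))) := by
        gcongr
    _ = 2 * (E.card * D.card) * D.card ^ 2 := by ring
    _ ≤ 2 * labelCount D m x c P * D.card ^ 2 := by gcongr
    _ ≤ Δ * D.card ^ 2 := by gcongr

theorem card_union_le_add {α : Type*} [DecidableEq α] {s t : Finset α} {a b : ℕ}
    (hs : s.card ≤ a) (ht : t.card ≤ b) : (s ∪ t).card ≤ a + b :=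
  (Finset.card_union_le _ _).trans (add_le_add hs ht)

open Classical in
theorem card_not_goodLabel_le [Fintype V] (hm : IsMating (insert c D) m) (hP : IsPalette D c P)
    (hs : IsSparse D c m Δ) (hr : 2 * labelCount D m x c P ≤ Δ) :
    ((labelBox P).filter fun l => ¬ GoodLabel D m x c P l).card ≤ 130 * Δ * D.card ^ 2 := by
  have hsub : ∀ p : Label → Prop, (labelBox P).filter p ⊆ labelBox P :=
    fun p => Finset.filter_subset _ _
  have hmem : ∀ p : Label → Prop, ∀ l ∈ (labelBox P).filter p, p l :=
    fun p l hl => (Finset.mem_filter.1 hl).2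
  have k1 := card_top_le (x := x) hm hP hs (hsub _) (hmem fun l =>
    MAdj (insert c D) m (verts m x c l).y₁ (verts m x c l).y₂)
  have k2 := card_far_le (x := x) hm hP hs (hsub _) (hmem fun l =>
    MAdj (insert c D) m (verts m x c l).u₁ (verts m x c l).u₂)
  have k3 := card_u₁_nbrs_le (x := x) hm hP hs (hsub _) (hmem fun l =>
    (verts m x c l).u₁ ∈ nbrs D m x)
  have k4 := card_u₂_y₁_le (x := x) hm hP hs (hsub _) (hmem fun l =>
    (verts m x c l).u₂ = (verts m x c l).y₁)
  have k5 := card_u₁_u₂_le (x := x) hm hP hs (hsub _) (hmem fun l =>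
    (verts m x c l).u₁ = (verts m x c l).u₂)
  have k6 := card_v₂_y₁_le (x := x) hm hP hs (hsub _) (hmem fun l =>
    (verts m x c l).v₂ = (verts m x c l).y₁)
  have k7 := card_v₂_y₂_le (x := x) hm hP hs (hsub _) (hmem fun l =>
    (verts m x c l).v₂ = (verts m x c l).y₂)
  have k8 := card_u₁_y₁_mate_le (x := x) hm hP hs (hsub _) (hmem fun l =>
    (verts m x c l).u₁ = m l.2.2.1 (verts m x c l).y₁)
  have k9 := card_u₁_y₂_mate_le (x := x) hm hP hs (hsub _) (hmem fun l =>
    (verts m x c l).u₁ = m l.2.2.1 (verts m x c l).y₂)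
  have k10 := card_u₂_y₁_mate_le (x := x) hm hP hs (hsub _) (hmem fun l =>
    (verts m x c l).u₂ = m l.2.2.1 (verts m x c l).y₁)
  have k11 := card_u₂_y₂_mate_le (x := x) hm hP hs (hsub _) (hmem fun l =>
    (verts m x c l).u₂ = m l.2.2.1 (verts m x c l).y₂)
  have k12 := card_frag_y₁_le (x := x) hm hP hs (hsub _) (hmem fun l =>
    s((verts m x c l).y₁, m l.2.2.1 (verts m x c l).y₁) ∈ fragileEdges m x c P)
  have k13 := card_frag_y₂_le (x := x) hm hP hs (hsub _) (hmem fun l =>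
    s((verts m x c l).y₂, m l.2.2.1 (verts m x c l).y₂) ∈ fragileEdges m x c P)
  have k14 := card_frag_u₁_le (x := x) hm hP hs (hsub _) (hmem fun l =>
    s((verts m x c l).u₁, m l.2.2.1 (verts m x c l).u₁) ∈ fragileEdges m x c P)
  have k15 := card_frag_u₂_le (x := x) hm hP hs (hsub _) (hmem fun l =>
    s((verts m x c l).u₂, m l.2.2.1 (verts m x c l).u₂) ∈ fragileEdges m x c P)
  have k16 := card_side_le (x := x) hm hP hs (hsub _) (hmem fun l =>
    ∃ d ∈ P 3, m l.2.2.1 (m l.1 (m d x)) = m l.2.1 (m c (m d x)))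
  have k17 := card_swap_le (x := x) hm hP hs (hsub _) (hmem fun l =>
    m c (m l.2.1 (verts m x c l).u₁) ∈ nbrs D m x)
  have k18 := card_completes_u_le (x := x) hm hP hs (hsub _) (hmem fun l =>
    Completes m x c P l.2.2.1 (verts m x c l).u₁ (verts m x c l).u₂)
  have k19 := card_completes_y_le (x := x) hm hP hs (hsub _) (hmem fun l =>
    Completes m x c P l.2.2.1 (verts m x c l).y₁ (verts m x c l).y₂)
  have k20 := card_sat_le (x := x) hm hP hr (hsub _) (hmem fun l =>
    D.card ≤ (satLabels m x c P (baseEdge m x c l)).card)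
  -- The constant 130 is 4·28 for the fragile edges, 2·2 for the completions, and 14 for the
  -- remaining conditions.
  have key :=
    card_union_le_add k1
      (card_union_le_add k2
      (card_union_le_add k3
      (card_union_le_add k4
      (card_union_le_add k5
      (card_union_le_add k6
      (card_union_le_add k7
      (card_union_le_add k8
      (card_union_le_add k9
      (card_union_le_add k10
      (card_union_le_add k11
      (card_union_le_add k12
      (card_union_le_add k13
      (card_union_le_add k14
      (card_union_le_add k15
      (card_union_le_add k16
      (card_union_le_add k17
      (card_union_le_add k18
      (card_union_le_add k19 k20))))))))))))))))))
  refine (Finset.card_le_card ?_).trans (key.trans (le_of_eq (by ring)))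
  intro l hl
  obtain ⟨hb, hl⟩ := Finset.mem_filter.1 hl
  by_contra hh
  simp only [Finset.mem_union, Finset.mem_filter, hb, true_and, not_or] at hh
  obtain ⟨k1, k2, k3, k4, k5, k6, k7, k8, k9, k10, k11, k12, k13, k14, k15, k16, k17, k18, k19,
    k20⟩ := hh
  exact hl ⟨k1, k2, k3, k4, k5, k6, k7, ⟨k8, k9⟩, ⟨k10, k11⟩, k12, k13, k14, k15,
    fun d hd he => k16 ⟨d, hd, he⟩, k17, k18, k19, not_le.1 k20⟩

end ColouredGraph

/-! ### Most switchings are good -/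

namespace ColouredGraph

variable {V : Type*} [Fintype V] {D : Finset ℕ} {c : ℕ} {P : Fin 4 → Finset ℕ} {x : V}
  {m : ℕ → V → V} {Δ : ℕ}

open Classical in
-- If a = u₁, then d₁ determines d₄ (through u₁) and d₂ (through the edge y₁y₂ of colour `d`), hence
-- z = u₂. If a = u₂, the colour d₂ plays the same role.
theorem card_completes_filter_le (hm : IsMating (insert c D) m) (hP : IsPalette D c P) (d : ℕ)
    (a : V) : (Finset.univ.filter fun z => Completes m x c P d a z).card ≤ 2 * D.card := by
  let S : Finset V := Finset.univ.filter fun z => ∃ l ∈ labelBox P,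
    m d (verts m x c l).y₁ = (verts m x c l).y₂ ∧ (verts m x c l).u₁ = a ∧ (verts m x c l).u₂ = z
  let S' : Finset V := Finset.univ.filter fun z => ∃ l ∈ labelBox P,
    m d (verts m x c l).y₁ = (verts m x c l).y₂ ∧ (verts m x c l).u₂ = a ∧ (verts m x c l).u₁ = z
  have hsub : (Finset.univ.filter fun z => Completes m x c P d a z) ⊆ S ∪ S' := by
    intro z hz
    obtain ⟨l, hl, -, h3, hf⟩ := (Finset.mem_filter.1 hz).2
    rcases Sym2.eq_iff.1 hf with ⟨h1, h2⟩ | ⟨h1, h2⟩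
    · exact Finset.mem_union_left _ (Finset.mem_filter.2 ⟨Finset.mem_univ _, l, hl, h3, h1, h2⟩)
    · exact Finset.mem_union_right _ (Finset.mem_filter.2 ⟨Finset.mem_univ _, l, hl, h3, h2, h1⟩)
  have hS : S.card ≤ D.card := by
    refine Finset.card_le_card_of_forall_subsingleton (fun z d₁ => ∃ l ∈ labelBox P, l.1 = d₁ ∧
      m d (verts m x c l).y₁ = (verts m x c l).y₂ ∧ (verts m x c l).u₁ = a ∧
      (verts m x c l).u₂ = z) ?_ ?_
    · intro z hz
      obtain ⟨l, hl, h⟩ := (Finset.mem_filter.1 hz).2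
      exact ⟨l.1, (label_mem hP subset_rfl hl).1, l, hl, rfl, h⟩
    · rintro d₁ - z ⟨-, l, hl, rfl, h3, h1, rfl⟩ z' ⟨-, l', hl', e1, h3', h1', rfl⟩
      obtain ⟨a1, a2, a3, a4⟩ := label_mem hP subset_rfl hl
      obtain ⟨b1, b2, b3, b4⟩ := label_mem hP subset_rfl hl'
      simp only [verts, e1] at h3 h1 h3' h1' ⊢
      have e4 := colour_inj hm a4 b4 (hm.injective _ (h1.trans h1'.symm))
      have e2 := colour_inj hm a2 b2 (h3.symm.trans h3')
      rw [e4, e2]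
  have hS' : S'.card ≤ D.card := by
    refine Finset.card_le_card_of_forall_subsingleton (fun z d₂ => ∃ l ∈ labelBox P, l.2.1 = d₂ ∧
      m d (verts m x c l).y₁ = (verts m x c l).y₂ ∧ (verts m x c l).u₂ = a ∧
      (verts m x c l).u₁ = z) ?_ ?_
    · intro z hz
      obtain ⟨l, hl, h⟩ := (Finset.mem_filter.1 hz).2
      exact ⟨l.2.1, (label_mem hP subset_rfl hl).2.1, l, hl, rfl, h⟩
    · rintro d₁ - z ⟨-, l, hl, rfl, h3, h1, rfl⟩ z' ⟨-, l', hl', e2, h3', h1', rfl⟩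
      obtain ⟨a1, a2, a3, a4⟩ := label_mem hP subset_rfl hl
      obtain ⟨b1, b2, b3, b4⟩ := label_mem hP subset_rfl hl'
      simp only [verts, e2] at h3 h1 h3' h1' ⊢
      have e4 := colour_inj hm a4 b4
        (hm.injective _ (hm.injective _ (h1.trans h1'.symm)))
      have e1 := colour_inj hm a1 b1 (hm.injective _ (h3.trans h3'.symm))
      rw [e4, e1]
  have := (Finset.card_le_card hsub).trans (card_union_le_add hS hS')
  omega

open Classical in
theorem card_filter_comp_le {d : ℕ} (hm : IsMating (insert c D) m) (p : V → Prop) :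
    (Finset.univ.filter fun z => p (m d z)).card ≤ (Finset.univ.filter p).card :=
  Finset.card_le_card_of_injOn (m d)
    (fun _ hz => Finset.mem_filter.2 ⟨Finset.mem_univ _, (Finset.mem_filter.1 hz).2⟩)
    (hm.injective d).injOn

open Classical in
-- Every condition on z excludes only O(|D|) vertices. The conditions on `m d z` cost no more than
-- those on z, as `m d` is injective.
theorem card_not_avoids_le (hm : IsMating (insert c D) m) (hP : IsPalette D c P)
    (d d₁ d₂ : ℕ) (a b : V) :
    (Finset.univ.filter fun z => ¬ Avoids D m x c P d d₁ d₂ a b z).card ≤ 12 * D.card + 6 := by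
  have hc : (insert c D).card ≤ D.card + 1 := Finset.card_insert_le _ _
  have hadj : ∀ v, (Finset.univ.filter fun z => MAdj (insert c D) m v z).card ≤ D.card + 1 := by
    intro v
    refine le_trans (Finset.card_le_card (t := (insert c D).image fun d => m d v) ?_)
      (Finset.card_image_le.trans hc)
    intro z hz
    exact Finset.mem_image.2 (Finset.mem_filter.1 hz).2
  have hmem : ∀ S : Finset V, (Finset.univ.filter fun z => m d z ∈ S).card ≤ S.card := fun S =>
    Finset.card_le_card_of_injOn (m d) (fun _ hz => (Finset.mem_filter.1 hz).2)
      (hm.injective d).injOn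
  have hside : (sideVerts m x c P d₁ d₂).card ≤ 2 * D.card := by
    have h3 := Finset.card_le_card (hP.subset 3)
    have := card_union_le_add
      (Finset.card_image_le (s := P 3) (f := fun d => m d₁ (m d x)))
      (Finset.card_image_le (s := P 3) (f := fun d => m d₂ (m c (m d x))))
    rw [sideVerts]
    omega
  have k1 : ({a, b, m d a, m d b} : Finset V).card ≤ 4 := Finset.card_le_four
  have k2 := hadj a
  have k3 := (card_filter_comp_le (d := d) hm _).trans (hadj b)
  have k4 := card_nbrs_le (D := D) (m := m) x
  have k5 := (hmem (nbrs D m x)).trans k4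
  have k7 := (hmem (sideVerts m x c P d₁ d₂)).trans hside
  have k8 := card_completes_filter_le (x := x) hm hP d a
  have k9 := (card_filter_comp_le (d := d) hm _).trans (card_completes_filter_le (x := x) hm hP d b)
  have key := card_union_le_add k1 (card_union_le_add k2 (card_union_le_add k3
    (card_union_le_add k4 (card_union_le_add k5 (card_union_le_add hside (card_union_le_add k7
      (card_union_le_add k8 k9)))))))
  refine (Finset.card_le_card ?_).trans (key.trans (le_of_eq (by ring)))
  intro z hz
  have hz := (Finset.mem_filter.1 hz).2
  by_contra hh
  simp only [Finset.mem_union, Finset.mem_filter, Finset.mem_univ, true_and, not_or,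
    Finset.mem_insert, Finset.mem_singleton] at hh
  obtain ⟨h1, h2, h3, h4, h5, h6, h7, h8, h9⟩ := hh
  exact hz ⟨h1, h2, h3, h4, h5, h6, h7, h8, h9⟩

theorem card_labelBox_le (hP : IsPalette D c P) : (labelBox P).card ≤ D.card ^ 4 := by
  rw [labelBox, Finset.card_product, Finset.card_product, Finset.card_product]
  calc _ ≤ D.card * (D.card * (D.card * D.card)) := by
        gcongr <;> exact hP.subset _
    _ = _ := by ring

/-- Most switchings are good. -/
theorem card_goodSwitches (hm : IsMating (insert c D) m) (hP : IsPalette D c P)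
    (hs : IsSparse D c m Δ) (hr : 2 * labelCount D m x c P ≤ Δ) (hD : 1 ≤ D.card)
    (hDn : D.card ≤ Fintype.card V) :
    (labelBox P).card * Fintype.card V ^ 2 ≤ (goodSwitches D m x c P).card +
      (186 * Δ * D.card ^ 2 * Fintype.card V ^ 2 + 42 * D.card ^ 5 * Fintype.card V) := by
  classical
  let B : Finset (Label × V × V) := labelBox P ×ˢ Finset.univ ×ˢ Finset.univ
  have hB : B.card = (labelBox P).card * Fintype.card V ^ 2 := by
    simp only [B, Finset.card_product, Finset.card_univ]
    ring
  have hl : ∀ t ∈ B, t.1 ∈ labelBox P := fun t ht => (Finset.mem_product.1 ht).1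
  have hbox := card_labelBox_le hP
  have hfrag := (card_orientations_le (fragileEdges m x c P)).trans
    (Nat.mul_le_mul_left 2 (card_fragileEdges_le hP hs))
  let B1 : Finset (Label × V × V) :=
    ((labelBox P).filter fun l => ¬ GoodLabel D m x c P l) ×ˢ Finset.univ ×ˢ Finset.univ
  have k1 : B1.card ≤ 130 * Δ * D.card ^ 2 * Fintype.card V ^ 2 := by
    simp only [B1, Finset.card_product, Finset.card_univ, ← sq]
    exact Nat.mul_le_mul_right _ (card_not_goodLabel_le hm hP hs hr)
  let B2 := B.filter fun t => ¬ Avoids D m x c P t.1.2.2.1 t.1.1 t.1.2.1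
    (m t.1.2.2.1 (verts m x c t.1).y₁) (m t.1.2.2.1 (verts m x c t.1).y₂) t.2.1
  have k2 : B2.card ≤ 18 * D.card * (D.card ^ 4 * Fintype.card V) := by
    refine (Finset.card_le_mul_card_image_of_maps_to (f := fun t => (t.1, t.2.2))
      (t := labelBox P ×ˢ Finset.univ) ?_ (18 * D.card) ?_).trans ?_
    · intro t ht
      exact Finset.mem_product.2 ⟨hl t (Finset.mem_filter.1 ht).1, Finset.mem_univ _⟩
    · rintro ⟨l, w⟩ -
      refine (Finset.card_le_card_of_injOn (fun t => t.2.1) ?_ ?_).trans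
        ((card_not_avoids_le hm hP l.2.2.1 l.1 l.2.1 (m l.2.2.1 (verts m x c l).y₁)
          (m l.2.2.1 (verts m x c l).y₂) (x := x)).trans (by omega))
      · intro t ht₀
        obtain ⟨ht, he⟩ := Finset.mem_filter.1 ht₀
        clear ht₀
        obtain ⟨rfl, rfl⟩ := Prod.ext_iff.1 he
        exact Finset.mem_filter.2 ⟨Finset.mem_univ _, (Finset.mem_filter.1 ht).2⟩
      · intro t ht t' ht' hh
        have e := Prod.ext_iff.1 ((Finset.mem_filter.1 ht).2.trans (Finset.mem_filter.1 ht').2.symm)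
        exact Prod.ext e.1 (Prod.ext hh e.2)
    · rw [Finset.card_product, Finset.card_univ]
      gcongr
  let B3 := B.filter fun t => ¬ (Avoids D m x c P t.1.2.2.1 t.1.1 t.1.2.1
    (m t.1.2.2.1 (verts m x c t.1).u₁) (m t.1.2.2.1 (verts m x c t.1).u₂) t.2.2 ∧
    t.2.2 ∉ ({(verts m x c t.1).y₁, m t.1.2.2.1 (verts m x c t.1).y₁, (verts m x c t.1).y₂,
      m t.1.2.2.1 (verts m x c t.1).y₂, t.2.1, m t.1.2.2.1 t.2.1} : Finset V))
  have k3 : B3.card ≤ 24 * D.card * (D.card ^ 4 * Fintype.card V) := by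
    refine (Finset.card_le_mul_card_image_of_maps_to (f := fun t => (t.1, t.2.1))
      (t := labelBox P ×ˢ Finset.univ) ?_ (24 * D.card) ?_).trans ?_
    · intro t ht
      exact Finset.mem_product.2 ⟨hl t (Finset.mem_filter.1 ht).1, Finset.mem_univ _⟩
    · rintro ⟨l, z⟩ -
      refine (Finset.card_le_card_of_injOn (fun t => t.2.2) ?_ ?_).trans
        ((card_union_le_add (card_not_avoids_le hm hP l.2.2.1 l.1 l.2.1
          (m l.2.2.1 (verts m x c l).u₁) (m l.2.2.1 (verts m x c l).u₂) (x := x))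
          (Finset.card_le_six (a := (verts m x c l).y₁) (b := m l.2.2.1 (verts m x c l).y₁)
            (c := (verts m x c l).y₂) (d := m l.2.2.1 (verts m x c l).y₂) (e := z)
            (f := m l.2.2.1 z))).trans (by omega))
      · intro t ht₀
        obtain ⟨ht, he⟩ := Finset.mem_filter.1 ht₀
        clear ht₀
        obtain ⟨rfl, rfl⟩ := Prod.ext_iff.1 he
        have hh := (Finset.mem_filter.1 ht).2
        rw [not_and_or, not_not] at hh
        exact Finset.mem_union.2 (hh.imp (fun h => Finset.mem_filter.2 ⟨Finset.mem_univ _, h⟩) id)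
      · intro t ht t' ht' hh
        have e := Prod.ext_iff.1 ((Finset.mem_filter.1 ht).2.trans (Finset.mem_filter.1 ht').2.symm)
        exact Prod.ext e.1 (Prod.ext e.2 hh)
    · rw [Finset.card_product, Finset.card_univ]
      gcongr
  let B4 := B.filter fun t => s(t.2.1, m t.1.2.2.1 t.2.1) ∈ fragileEdges m x c P
  have k4 : B4.card ≤ 28 * Δ * (D.card ^ 3 * Fintype.card V) := by
    refine (Finset.card_le_mul_card_image_of_maps_to
      (f := fun t => (t.1.1, t.1.2.1, t.1.2.2.2, t.2.2))
      (t := D ×ˢ D ×ˢ D ×ˢ Finset.univ) ?_ (28 * Δ) ?_).trans ?_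
    · intro t ht
      have := label_mem hP subset_rfl (hl t (Finset.mem_filter.1 ht).1)
      exact Finset.mem_product.2 ⟨this.1, Finset.mem_product.2 ⟨this.2.1, Finset.mem_product.2
        ⟨this.2.2.2, Finset.mem_univ _⟩⟩⟩
    · intro p _
      refine (Finset.card_le_card_of_injOn (fun t => (t.2.1, m t.1.2.2.1 t.2.1)) ?_ ?_).trans
        (hfrag.trans (by omega))
      · intro t ht
        obtain ⟨ht, he⟩ := Finset.mem_filter.1 ht
        exact mem_orientations.2 (Finset.mem_filter.1 ht).2
      · intro t ht t' ht' hh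
        obtain ⟨ht, he⟩ := Finset.mem_filter.1 ht
        obtain ⟨ht', he'⟩ := Finset.mem_filter.1 ht'
        have a := label_mem hP subset_rfl (hl t (Finset.mem_filter.1 ht).1)
        have b := label_mem hP subset_rfl (hl t' (Finset.mem_filter.1 ht').1)
        have e := he.trans he'.symm
        simp only [Prod.ext_iff] at e hh
        obtain ⟨f1, f2⟩ := hh
        rw [← f1] at f2
        exact Prod.ext (label_ext e.1 e.2.1 (colour_inj hm a.2.2.1 b.2.2.1 f2) e.2.2.1)
          (Prod.ext f1 e.2.2.2)
    · simp only [Finset.card_product, Finset.card_univ]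
      exact le_of_eq (by ring)
  let B5 := B.filter fun t => s(t.2.2, m t.1.2.2.1 t.2.2) ∈ fragileEdges m x c P
  have k5 : B5.card ≤ 28 * Δ * (D.card ^ 3 * Fintype.card V) := by
    refine (Finset.card_le_mul_card_image_of_maps_to
      (f := fun t => (t.1.1, t.1.2.1, t.1.2.2.2, t.2.1))
      (t := D ×ˢ D ×ˢ D ×ˢ Finset.univ) ?_ (28 * Δ) ?_).trans ?_
    · intro t ht
      have := label_mem hP subset_rfl (hl t (Finset.mem_filter.1 ht).1)
      exact Finset.mem_product.2 ⟨this.1, Finset.mem_product.2 ⟨this.2.1, Finset.mem_product.2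
        ⟨this.2.2.2, Finset.mem_univ _⟩⟩⟩
    · intro p _
      refine (Finset.card_le_card_of_injOn (fun t => (t.2.2, m t.1.2.2.1 t.2.2)) ?_ ?_).trans
        (hfrag.trans (by omega))
      · intro t ht
        obtain ⟨ht, he⟩ := Finset.mem_filter.1 ht
        exact mem_orientations.2 (Finset.mem_filter.1 ht).2
      · intro t ht t' ht' hh
        obtain ⟨ht, he⟩ := Finset.mem_filter.1 ht
        obtain ⟨ht', he'⟩ := Finset.mem_filter.1 ht'
        have a := label_mem hP subset_rfl (hl t (Finset.mem_filter.1 ht).1)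
        have b := label_mem hP subset_rfl (hl t' (Finset.mem_filter.1 ht').1)
        have e := he.trans he'.symm
        simp only [Prod.ext_iff] at e hh
        obtain ⟨f1, f2⟩ := hh
        rw [← f1] at f2
        exact Prod.ext (label_ext e.1 e.2.1 (colour_inj hm a.2.2.1 b.2.2.1 f2) e.2.2.1)
          (Prod.ext e.2.2.2 f1)
    · simp only [Finset.card_product, Finset.card_univ]
      exact le_of_eq (by ring)
  have hcover : B ⊆ goodSwitches D m x c P ∪ (B1 ∪ (B2 ∪ (B3 ∪ (B4 ∪ B5)))) := by
    intro t ht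
    by_contra hh
    simp only [Finset.mem_union, not_or] at hh
    obtain ⟨h0, h1, h2, h3, h4, h5⟩ := hh
    refine h0 (Finset.mem_filter.2 ⟨ht, ?_⟩)
    have g1 : GoodLabel D m x c P t.1 := by
      by_contra hg
      exact h1 (Finset.mem_product.2 ⟨Finset.mem_filter.2 ⟨hl t ht, hg⟩, by simp⟩)
    have g2 := not_not.1 fun hg => h2 (Finset.mem_filter.2 ⟨ht, hg⟩)
    have g3 := not_not.1 fun hg => h3 (Finset.mem_filter.2 ⟨ht, hg⟩)
    have g4 := fun hg => h4 (Finset.mem_filter.2 ⟨ht, hg⟩)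
    have g5 := fun hg => h5 (Finset.mem_filter.2 ⟨ht, hg⟩)
    have g3' := g3.2
    simp only [Finset.mem_insert, Finset.mem_singleton, not_or] at g3'
    exact ⟨g1, g2, g3.1, g4, g5, g3'⟩
  have key := (Finset.card_le_card hcover).trans (card_union_le_add le_rfl
    (card_union_le_add k1 (card_union_le_add k2 (card_union_le_add k3 (card_union_le_add k4 k5)))))
  rw [hB] at key
  -- With |D| ≤ n the two fragile-edge terms for z and w merge into the main one, 186 = 130 + 28 +
  -- 28, while 42 = 18 + 24 collects the failures of avoidance.
  have h6 : Δ * D.card ^ 3 * Fintype.card V ≤ Δ * D.card ^ 2 * Fintype.card V ^ 2 := by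
    calc Δ * D.card ^ 3 * Fintype.card V = Δ * D.card ^ 2 * (D.card * Fintype.card V) := by ring
      _ ≤ Δ * D.card ^ 2 * (Fintype.card V * Fintype.card V) := by gcongr
      _ = _ := by ring
  nlinarith [h6, key]

end ColouredGraph

/-! ### Sets of small additive energy and their discrepancy -/

section Energy

variable {Γ : Type*} [AddCommGroup Γ] [Fintype Γ] [DecidableEq Γ]

/-- The number of representations of `t` as a difference of two elements of `S`. -/
def diffCount (S : Finset Γ) (t : Γ) : ℕ := (Finset.univ.filter fun s => s ∈ S ∧ s + t ∈ S).card

/-- The additive energy as a count of parallelograms (t, s, s'), ready for averaging over S. -/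
theorem sum_diffCount_sq (S : Finset Γ) : ∑ t, diffCount S t ^ 2 =
    (Finset.univ.filter fun p : Γ × Γ × Γ =>
      (p.2.1 ∈ S ∧ p.2.1 + p.1 ∈ S) ∧ (p.2.2 ∈ S ∧ p.2.2 + p.1 ∈ S)).card := by
  rw [Finset.card_eq_sum_card_fiberwise (f := Prod.fst) (t := Finset.univ)
    (fun _ _ => Finset.mem_univ _)]
  refine Finset.sum_congr rfl fun t _ => ?_
  rw [sq, diffCount, ← Finset.card_product]
  refine Finset.card_bij (fun p _ => (t, p)) ?_ ?_ ?_
  · intro p hp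
    simp only [Finset.mem_product, Finset.mem_filter, Finset.mem_univ, true_and] at hp ⊢
    exact ⟨hp, trivial⟩
  · intro p _ p' _ h
    exact (Prod.ext_iff.1 h).2
  · rintro ⟨t', p⟩ hp
    simp only [Finset.mem_filter, Finset.mem_univ, true_and] at hp
    obtain ⟨hp, rfl⟩ := hp
    exact ⟨p, by simpa using hp, rfl⟩

theorem card_powersetCard_superset_le {α : Type*} [Fintype α] [DecidableEq α] (M : ℕ)
    (T : Finset α) :
    ((Finset.powersetCard M Finset.univ).filter fun S => T ⊆ S).card ≤
      (Fintype.card α - T.card).choose (M - T.card) := by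
  rw [← Finset.card_univ, ← Finset.card_sdiff_of_subset (Finset.subset_univ T),
    ← Finset.card_powersetCard]
  refine Finset.card_le_card_of_injOn (fun S => S \ T) ?_ ?_
  · intro S hS
    obtain ⟨hS, hTS⟩ := Finset.mem_filter.1 hS
    refine Finset.mem_powersetCard.2
        ⟨Finset.sdiff_subset_sdiff (Finset.subset_univ _) subset_rfl, ?_⟩
    rw [Finset.card_sdiff_of_subset hTS, (Finset.mem_powersetCard.1 hS).2]
  · intro S hS S' hS' h
    have h1 := (Finset.mem_filter.1 hS).2
    have h2 := (Finset.mem_filter.1 hS').2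
    dsimp only at h
    rw [← Finset.sdiff_union_of_subset h1, h, Finset.sdiff_union_of_subset h2]

/-- The ratio of the binomial coefficients is (M - i)/(k - i) ≤ M/k. Four steps bound by (M/k)⁴ the
probability that a random M-set contains four given elements. -/
theorem choose_sub_mul_le {k M : ℕ} (hM : M ≤ k) {i : ℕ} (hi : i < M) :
    (k - (i + 1)).choose (M - (i + 1)) * k ≤ M * (k - i).choose (M - i) := by
  obtain ⟨a, rfl⟩ := Nat.exists_eq_add_of_lt hi
  obtain ⟨b, rfl⟩ := Nat.exists_eq_add_of_le hM
  have e1 : i + a + 1 + b - (i + 1) = a + b := by omega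
  have e2 : i + a + 1 - (i + 1) = a := by omega
  have e3 : i + a + 1 + b - i = a + b + 1 := by omega
  have e4 : i + a + 1 - i = a + 1 := by omega
  rw [e1, e2, e3, e4]
  have h := Nat.add_one_mul_choose_eq (a + b) a
  have h1 : (a + b).choose a * ((a + b + 1) * (i + a + 1 + b)) ≤
      (i + a + 1) * ((a + b + 1).choose (a + 1)) * (a + b + 1) := by
    calc (a + b).choose a * ((a + b + 1) * (i + a + 1 + b))
        = ((a + b + 1) * (a + b).choose a) * (i + a + 1 + b) := by ring
      _ = (a + b + 1).choose (a + 1) * ((a + 1) * (i + a + 1 + b)) := by rw [h]; ring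
      _ ≤ (a + b + 1).choose (a + 1) * ((i + a + 1) * (a + b + 1)) :=
          Nat.mul_le_mul_left _ (by nlinarith [Nat.zero_le (i * b)])
      _ = _ := by ring
  refine Nat.le_of_mul_le_mul_right (c := a + b + 1) ?_ (Nat.succ_pos _)
  calc _ = (a + b).choose a * ((a + b + 1) * (i + a + 1 + b)) := by ring
    _ ≤ _ := h1

theorem choose_sub_four_mul_le {k M : ℕ} (hM : M ≤ k) (h4 : 4 ≤ M) :
    (k - 4).choose (M - 4) * k ^ 4 ≤ M ^ 4 * k.choose M := by
  have h1 := choose_sub_mul_le hM (i := 0) (by omega)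
  have h2 := choose_sub_mul_le hM (i := 1) (by omega)
  have h3 := choose_sub_mul_le hM (i := 2) (by omega)
  have h4' := choose_sub_mul_le hM (i := 3) (by omega)
  simp only [Nat.zero_add, Nat.sub_zero, Nat.reduceAdd] at h1 h2 h3 h4'
  calc (k - 4).choose (M - 4) * k ^ 4 = (k - 4).choose (M - 4) * k * k ^ 3 := by ring
    _ ≤ M * (k - 3).choose (M - 3) * k ^ 3 := by gcongr
    _ = M * k ^ 2 * ((k - 3).choose (M - 3) * k) := by ring
    _ ≤ M * k ^ 2 * (M * (k - 2).choose (M - 2)) := by gcongr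
    _ = M ^ 2 * k * ((k - 2).choose (M - 2) * k) := by ring
    _ ≤ M ^ 2 * k * (M * (k - 1).choose (M - 1)) := by gcongr
    _ = M ^ 3 * ((k - 1).choose (M - 1) * k) := by ring
    _ ≤ M ^ 3 * (M * k.choose M) := by gcongr
    _ = _ := by ring

/-- There is a set of any given size with almost minimal additive energy. -/
theorem exists_energy_le {M : ℕ} (hM : M ≤ Fintype.card Γ) (h4 : 4 ≤ M) :
    ∃ S : Finset Γ, S.card = M ∧
      Fintype.card Γ * ∑ t, diffCount S t ^ 2 ≤ M ^ 4 + 4 * Fintype.card Γ ^ 3 := by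
  set k := Fintype.card Γ with hk
  let U := Finset.powersetCard M (Finset.univ : Finset Γ)
  have hU : U.card = k.choose M := by rw [Finset.card_powersetCard, Finset.card_univ]
  let quad : Γ × Γ × Γ → Finset Γ := fun p => {p.2.1, p.2.1 + p.1, p.2.2, p.2.2 + p.1}
  -- The triples for which s, s + t, s', s' + t are not distinct: t = 0, s' = s, s' = s + t, or s =
  -- s' + t. For them the trivial probability bound 1 suffices, as there are only 4k² of them.
  let degen : Finset (Γ × Γ × Γ) :=
    ((Finset.univ : Finset (Γ × Γ)).image fun q => (0, q.1, q.2)) ∪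
    (((Finset.univ : Finset (Γ × Γ)).image fun q => (q.1, q.2, q.2)) ∪
    (((Finset.univ : Finset (Γ × Γ)).image fun q => (q.1, q.2, q.2 + q.1)) ∪
    ((Finset.univ : Finset (Γ × Γ)).image fun q => (q.1, q.2 + q.1, q.2))))
  have hdegen : degen.card ≤ 4 * k ^ 2 := by
    have h : ∀ f : Γ × Γ → Γ × Γ × Γ,
        ((Finset.univ : Finset (Γ × Γ)).image f).card ≤ k ^ 2 := fun f =>
      Finset.card_image_le.trans (by rw [Finset.card_univ, Fintype.card_prod, sq])
    have := ColouredGraph.card_union_le_add (h fun q => (0, q.1, q.2))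
      (ColouredGraph.card_union_le_add (h fun q => (q.1, q.2, q.2))
      (ColouredGraph.card_union_le_add (h fun q => (q.1, q.2, q.2 + q.1))
        (h fun q => (q.1, q.2 + q.1, q.2))))
    exact this.trans (le_of_eq (by ring))
  have hquad : ∀ p ∉ degen, (quad p).card = 4 := by
    rintro ⟨t, s, s'⟩ hp
    simp only [degen, Finset.mem_union, Finset.mem_image, Finset.mem_univ, true_and, not_or,
      Prod.exists, Prod.mk.injEq, not_exists, not_and] at hp
    obtain ⟨h1, h2, h3, h4⟩ := hp
    have t0 : t ≠ 0 := fun h => h1 s s' h.symm rfl rfl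
    have n1 : s ≠ s' := fun h => h2 t s rfl rfl h
    have n2 : s + t ≠ s' := fun h => h3 t s rfl rfl h
    have n3 : s' + t ≠ s := fun h => h4 t s' rfl h rfl
    simp only [quad]
    rw [Finset.card_insert_of_notMem, Finset.card_insert_of_notMem, Finset.card_insert_of_notMem,
      Finset.card_singleton]
    · simpa using t0
    · simp only [Finset.mem_insert, Finset.mem_singleton, not_or, add_left_inj]
      exact ⟨n2, n1⟩
    · simp only [Finset.mem_insert, Finset.mem_singleton, not_or]
      exact ⟨by simpa using t0, n1, n3.symm⟩
  have hswap : ∑ S ∈ U, ∑ t, diffCount S t ^ 2 =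
      ∑ p : Γ × Γ × Γ, (U.filter fun S => quad p ⊆ S).card := by
    simp_rw [sum_diffCount_sq, Finset.card_filter]
    rw [Finset.sum_comm]
    refine Finset.sum_congr rfl fun p _ => Finset.sum_congr rfl fun S _ => ?_
    congr 1
    simp only [quad, Finset.insert_subset_iff, Finset.singleton_subset_iff, eq_iff_iff]
    tauto
  have hbound : k * ∑ S ∈ U, ∑ t, diffCount S t ^ 2 ≤ (M ^ 4 + 4 * k ^ 3) * U.card := by
    rw [hswap, ← Finset.sum_add_sum_compl degen]
    have b1 : ∑ p ∈ degen, (U.filter fun S => quad p ⊆ S).card ≤ 4 * k ^ 2 * U.card := by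
      refine (Finset.sum_le_card_nsmul _ _ U.card
        fun p _ => Finset.card_le_card (Finset.filter_subset _ _)).trans ?_
      rw [smul_eq_mul]
      exact Nat.mul_le_mul_right _ hdegen
    have b2 : ∑ p ∈ degenᶜ, (U.filter fun S => quad p ⊆ S).card ≤
        k ^ 3 * (k - 4).choose (M - 4) := by
      refine (Finset.sum_le_card_nsmul _ _ ((k - 4).choose (M - 4)) fun p hp => ?_).trans ?_
      · have h := hquad p (Finset.mem_compl.1 hp)
        have := card_powersetCard_superset_le M (quad p)
        rwa [h] at this
      · rw [smul_eq_mul]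
        refine Nat.mul_le_mul_right _ ((Finset.card_le_univ _).trans ?_)
        rw [Fintype.card_prod, Fintype.card_prod]
        exact le_of_eq (by ring)
    have b3 := choose_sub_four_mul_le hM h4
    rw [hU] at *
    nlinarith
  have hne : U.Nonempty := by
    rw [← Finset.card_pos, hU]
    exact Nat.choose_pos hM
  rw [Finset.mul_sum] at hbound
  obtain ⟨S, hS, h⟩ := Finset.exists_le_of_sum_le (s := U)
      (f := fun S => k * ∑ t, diffCount S t ^ 2)
    (g := fun _ => M ^ 4 + 4 * k ^ 3) hne (by rw [Finset.sum_const, smul_eq_mul]; linarith)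
  exact ⟨S, (Finset.mem_powersetCard.1 hS).2, h⟩

/-- The number of pairs in `X × Y` whose difference lies in `S`. -/
def diffPairs (S X Y : Finset Γ) : Finset (Γ × Γ) := (X ×ˢ Y).filter fun p => p.2 - p.1 ∈ S

/-- Cauchy–Schwarz over Y bounds the squared discrepancy by autocorrelations F of the balanced
indicator of S. Two further applications over X reduce to the sum of F², which is the energy minus
its minimum M⁴/k, at most 4k². -/
theorem diffPairs_discrepancy {S : Finset Γ} {M : ℕ} (hS : S.card = M)
    (hE : Fintype.card Γ * ∑ t, diffCount S t ^ 2 ≤ M ^ 4 + 4 * Fintype.card Γ ^ 3)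
    (X Y : Finset Γ) :
    ((diffPairs S X Y).card - (M : ℝ) * X.card * Y.card / Fintype.card Γ) ^ 4 ≤
      4 * (Y.card : ℝ) ^ 2 * (X.card : ℝ) ^ 3 * (Fintype.card Γ : ℝ) ^ 2 := by
  set k := Fintype.card Γ with hk
  have hkpos : (0 : ℝ) < k := by
    exact_mod_cast Fintype.card_pos
  let g : Γ → ℝ := fun s => if s ∈ S then 1 else 0
  let h : Γ → ℝ := fun s => g s - M / k
  let F : Γ → ℝ := fun t => ∑ s, h s * h (s + t)
  have hg : ∑ s, g s = M := by
    simp [g, hS]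
  have hgt : ∀ t, ∑ s, g (s + t) = M := fun t => by
    rw [← hg]
    exact Fintype.sum_equiv (Equiv.addRight t) _ _ fun _ => rfl
  have hF : ∀ t, F t = diffCount S t - (M : ℝ) ^ 2 / k := by
    intro t
    have h1 : ∑ s, g s * g (s + t) = diffCount S t := by
      rw [diffCount, Finset.card_filter]
      push_cast
      refine Finset.sum_congr rfl fun s _ => ?_
      simp only [g]
      split_ifs <;> simp_all
    have h2 : F t = ∑ s, g s * g (s + t) - M / k * ∑ s, g s - M / k * ∑ s, g (s + t) +
        ∑ _s : Γ, (M / k : ℝ) ^ 2 := by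
      simp only [F, h, Finset.mul_sum, ← Finset.sum_sub_distrib, ← Finset.sum_add_distrib]
      exact Finset.sum_congr rfl fun s _ => by ring
    rw [h2, h1, hg, hgt, Finset.sum_const, Finset.card_univ, nsmul_eq_mul, ← hk]
    field_simp
    ring
  have hc : ∑ t, (diffCount S t : ℝ) = (M : ℝ) ^ 2 := by
    have : ∀ t, (diffCount S t : ℝ) = ∑ s, g s * g (s + t) := by
      intro t
      rw [diffCount, Finset.card_filter]
      push_cast
      refine Finset.sum_congr rfl fun s _ => ?_
      simp only [g]
      split_ifs <;> simp_all
    simp_rw [this]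
    rw [Finset.sum_comm]
    have h3 : ∀ s, ∑ t, g (s + t) = M := fun s => by
      rw [← hg]
      exact Fintype.sum_equiv (Equiv.addLeft s) _ _ fun _ => rfl
    simp_rw [← Finset.mul_sum, h3, ← Finset.sum_mul, hg]
    ring
  have hF2 : ∑ t, F t ^ 2 ≤ 4 * (k : ℝ) ^ 2 := by
    have h1 : ∑ t, F t ^ 2 = ∑ t, (diffCount S t : ℝ) ^ 2 -
        2 * ((M : ℝ) ^ 2 / k) * ∑ t, (diffCount S t : ℝ) + ∑ _t : Γ, ((M : ℝ) ^ 2 / k) ^ 2 := by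
      simp only [hF, Finset.mul_sum, ← Finset.sum_sub_distrib, ← Finset.sum_add_distrib]
      exact Finset.sum_congr rfl fun s _ => by ring
    rw [h1, hc, Finset.sum_const, Finset.card_univ, nsmul_eq_mul, ← hk]
    have h2 : (k : ℝ) * ∑ t, (diffCount S t : ℝ) ^ 2 ≤ (M : ℝ) ^ 4 + 4 * (k : ℝ) ^ 3 := by
      exact_mod_cast hE
    have h3 : ∑ t, (diffCount S t : ℝ) ^ 2 ≤ (M : ℝ) ^ 4 / k + 4 * (k : ℝ) ^ 2 := by
      rw [← sub_nonneg]
      have : (M : ℝ) ^ 4 / k + 4 * (k : ℝ) ^ 2 - ∑ t, (diffCount S t : ℝ) ^ 2 =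
          ((M : ℝ) ^ 4 + 4 * (k : ℝ) ^ 3 - k * ∑ t, (diffCount S t : ℝ) ^ 2) / k := by
        field_simp
      rw [this]
      exact div_nonneg (sub_nonneg.2 h2) hkpos.le
    have h4 : (k : ℝ) * ((M : ℝ) ^ 2 / k) ^ 2 = (M : ℝ) ^ 4 / k := by
      field_simp
    have h5 : 2 * ((M : ℝ) ^ 2 / k) * (M : ℝ) ^ 2 = 2 * ((M : ℝ) ^ 4 / k) := by ring
    rw [h4, h5]
    linarith
  have hsum : ((diffPairs S X Y).card - (M : ℝ) * X.card * Y.card / k) =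
      ∑ y ∈ Y, ∑ x ∈ X, h (y - x) := by
    rw [diffPairs, Finset.card_filter, Finset.sum_product_right]
    push_cast
    simp only [h, g, Finset.sum_sub_distrib, Finset.sum_const, nsmul_eq_mul]
    ring
  have hsq : (∑ y ∈ Y, ∑ x ∈ X, h (y - x)) ^ 2 ≤ Y.card * ∑ x ∈ X, ∑ x' ∈ X, F (x - x') := by
    refine (sq_sum_le_card_mul_sum_sq).trans ?_
    refine mul_le_mul_of_nonneg_left ?_ (Nat.cast_nonneg _)
    refine (Finset.sum_le_univ_sum_of_nonneg fun y => sq_nonneg _).trans (le_of_eq ?_)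
    simp_rw [sq, Finset.sum_mul_sum]
    rw [Finset.sum_comm]
    refine Finset.sum_congr rfl fun x _ => ?_
    rw [Finset.sum_comm]
    refine Finset.sum_congr rfl fun x' _ => ?_
    refine Fintype.sum_equiv (Equiv.subRight x) _ _ fun y => ?_
    simp only [Equiv.subRight_apply]
    congr 2
    abel
  have herr : (∑ x ∈ X, ∑ x' ∈ X, F (x - x')) ^ 2 ≤ (X.card : ℝ) ^ 3 * (4 * (k : ℝ) ^ 2) := by
    refine (sq_sum_le_card_mul_sum_sq).trans ?_
    have h1 : ∀ x ∈ X, (∑ x' ∈ X, F (x - x')) ^ 2 ≤ X.card * (4 * (k : ℝ) ^ 2) := by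
      intro x _
      refine (sq_sum_le_card_mul_sum_sq).trans ?_
      refine mul_le_mul_of_nonneg_left ?_ (Nat.cast_nonneg _)
      refine (Finset.sum_le_univ_sum_of_nonneg fun x' => sq_nonneg _).trans
          (le_trans (le_of_eq ?_) hF2)
      exact Fintype.sum_equiv (Equiv.subLeft x) _ _ fun _ => rfl
    have h2 := Finset.sum_le_sum h1
    rw [Finset.sum_const, nsmul_eq_mul] at h2
    calc _ ≤ (X.card : ℝ) * (X.card * (X.card * (4 * (k : ℝ) ^ 2))) :=
          mul_le_mul_of_nonneg_left h2 (Nat.cast_nonneg _)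
      _ = _ := by ring
  rw [hsum]
  calc (∑ y ∈ Y, ∑ x ∈ X, h (y - x)) ^ 4 = ((∑ y ∈ Y, ∑ x ∈ X, h (y - x)) ^ 2) ^ 2 := by ring
    _ ≤ (Y.card * ∑ x ∈ X, ∑ x' ∈ X, F (x - x')) ^ 2 :=
        pow_le_pow_left₀ (sq_nonneg _) hsq 2
    _ = (Y.card : ℝ) ^ 2 * (∑ x ∈ X, ∑ x' ∈ X, F (x - x')) ^ 2 := by ring
    _ ≤ (Y.card : ℝ) ^ 2 * ((X.card : ℝ) ^ 3 * (4 * (k : ℝ) ^ 2)) :=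
        mul_le_mul_of_nonneg_left herr (sq_nonneg _)
    _ = _ := by ring

end Energy

/-! ### A quasirandom bipartite Cayley graph -/

namespace ColouredGraph

variable {V Γ : Type*}

section Side

variable [Fintype Γ]

open Classical in
/-- The elements of `Γ` corresponding to the vertices of `A` on one side. -/
noncomputable def side (e : V ≃ Γ × Bool) (A : Finset V) (b : Bool) : Finset Γ :=
  Finset.univ.filter fun g => e.symm (g, b) ∈ A

theorem mem_side {e : V ≃ Γ × Bool} {A : Finset V} {b : Bool} {g : Γ} :
    g ∈ side e A b ↔ e.symm (g, b) ∈ A := by simp [side]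

theorem card_side_add (e : V ≃ Γ × Bool) (A : Finset V) :
    (side e A false).card + (side e A true).card = A.card := by
  classical
  have h : A = ((side e A false).image fun g => e.symm (g, false)) ∪
      ((side e A true).image fun g => e.symm (g, true)) := by
    ext v
    obtain ⟨⟨g, b⟩, rfl⟩ := e.symm.surjective v
    cases b <;> simp [mem_side]
  have hd : Disjoint ((side e A false).image fun g => e.symm (g, false))
      ((side e A true).image fun g => e.symm (g, true)) := by
    refine Finset.disjoint_left.2 fun v hv hv' => ?_
    obtain ⟨g, -, rfl⟩ := Finset.mem_image.1 hv
    obtain ⟨g', -, h⟩ := Finset.mem_image.1 hv'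
    simp at h
  have hi : ∀ b, Function.Injective fun g : Γ => e.symm (g, b) := fun b g g' h => by
    simpa using h
  conv_rhs => rw [h]
  rw [Finset.card_union_of_disjoint hd, Finset.card_image_of_injective _ (hi _),
    Finset.card_image_of_injective _ (hi _)]

end Side

variable [AddCommGroup Γ]

open Classical in
/-- The matchings of the bipartite Cayley graph on `Γ × Bool` with connection elements `φ d`. -/
noncomputable def cayleyMating (E : Finset ℕ) (e : V ≃ Γ × Bool) (φ : ℕ → Γ) (d : ℕ) (v : V) : V :=
  if d ∈ E then
    e.symm (if (e v).2 then ((e v).1 - φ d, false) else ((e v).1 + φ d, true))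
  else v

theorem isMating_cayleyMating {E : Finset ℕ} (e : V ≃ Γ × Bool) {φ : ℕ → Γ}
    (hφ : Set.InjOn φ E) : IsMating E (cayleyMating E e φ) where
  invol d v := by
    by_cases hd : d ∈ E
    · cases h : (e v).2 <;> simp [cayleyMating, hd, h]
      · rw [← h, Prod.mk.eta, e.symm_apply_apply]
      · rw [← h, Prod.mk.eta, e.symm_apply_apply]
    · simp [cayleyMating, hd]
  ne d hd v hv := by
    have h := congrArg (fun w => (e w).2) hv
    cases h' : (e v).2 <;> simp [cayleyMating, hd, h'] at h
  eq_of_eq d hd d' hd' v h := by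
    refine hφ hd hd' ?_
    cases h' : (e v).2 <;> simpa [cayleyMating, hd, hd', h'] using h
  eq_self d hd v := by simp [cayleyMating, hd]

variable [Fintype Γ]

/-- Every edge joins the two sides with difference in the connection set, and its end in A lies on
either side. -/
theorem edgeCount_cayley_le [DecidableEq Γ] {E : Finset ℕ} (e : V ≃ Γ × Bool) {φ : ℕ → Γ}
    (hφ : Set.InjOn φ E) (A B : Finset V) :
    (isMating_cayleyMating e hφ).toColouredGraph.edgeCount A B ≤
      (diffPairs (E.image φ) (side e A false) (side e B true)).card +
      (diffPairs (E.image φ) (side e B false) (side e A true)).card := by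
  classical
  refine le_trans ?_ (Finset.card_union_le _ _)
  refine le_trans ?_ (Finset.card_image_le
    (f := fun p : Γ × Γ => s(e.symm (p.1, false), e.symm (p.2, true))))
  rw [edgeCount, ← Set.ncard_coe_finset]
  refine Set.ncard_le_ncard ?_ (Finset.finite_toSet _)
  rintro _ ⟨hadj, a, ha, b, hb, rfl⟩
  have hadj' := (adj_iff _).1 (SimpleGraph.mem_edgeSet _ |>.1 hadj)
  rw [IsMating.mate_toColouredGraph] at hadj'
  obtain ⟨d, hd, h⟩ := hadj'
  rw [Finset.mem_coe, Finset.mem_image]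
  obtain ⟨⟨g, s⟩, rfl⟩ := e.symm.surjective a
  subst h
  cases s
  · refine ⟨(g, g + φ d), Finset.mem_union_left _ ?_, ?_⟩
    · rw [diffPairs, Finset.mem_filter, Finset.mem_product, mem_side, mem_side]
      refine ⟨⟨ha, ?_⟩, Finset.mem_image.2 ⟨d, hd, by simp⟩⟩
      simpa [cayleyMating, hd] using hb
    · simp [cayleyMating, hd]
  · refine ⟨(g - φ d, g), Finset.mem_union_right _ ?_, ?_⟩
    · rw [diffPairs, Finset.mem_filter, Finset.mem_product, mem_side, mem_side]
      refine ⟨⟨?_, ha⟩, Finset.mem_image.2 ⟨d, hd, by simp⟩⟩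
      simpa [cayleyMating, hd] using hb
    · simp [cayleyMating, hd]

/-- There are coloured graphs with few edges between any two sets of moderate size. -/
theorem exists_edgeCount_lt [Fintype V] {E : Finset ℕ} {k q : ℕ} (hV : Fintype.card V = 2 * k)
    (hE : E.card = q + 1) (hq : 3 ≤ q) (hk : q + 1 ≤ k) (hqk : 4 * k ^ 6 ≤ q ^ 7) :
    ∃ G : ColouredGraph V E, ∀ A B : Finset V, A.card = q → B.card = q →
      (G.edgeCount A B : ℝ) < 4 * (q : ℝ) ^ 3 / k := by
  classical
  have : NeZero k := ⟨by omega⟩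
  obtain ⟨S, hS, henergy⟩ := exists_energy_le (Γ := ZMod k) (M := q + 1)
    (by rwa [ZMod.card]) (by omega)
  obtain ⟨ψ⟩ : Nonempty (E ≃ S) := Fintype.card_eq.1 (by simp [hE, hS])
  obtain ⟨e⟩ : Nonempty (V ≃ ZMod k × Bool) := Fintype.card_eq.1 (by
    rw [hV, Fintype.card_prod, ZMod.card, Fintype.card_bool, mul_comm])
  let φ : ℕ → ZMod k := fun d => if h : d ∈ E then ψ ⟨d, h⟩ else 0
  have hφ : Set.InjOn φ E := by
    intro d hd d' hd' h
    rw [Finset.mem_coe] at hd hd'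
    simp only [φ, dif_pos hd, dif_pos hd'] at h
    simpa using ψ.injective (Subtype.ext h)
  have himage : E.image φ = S := by
    refine Finset.eq_of_subset_of_card_le ?_ ?_
    · intro g hg
      obtain ⟨d, hd, rfl⟩ := Finset.mem_image.1 hg
      simp only [φ, dif_pos hd]
      exact (ψ ⟨d, hd⟩).2
    · rw [Finset.card_image_of_injOn hφ, hS, hE]
  refine ⟨(isMating_cayleyMating e hφ).toColouredGraph, fun A B hA hB => ?_⟩
  have hle := edgeCount_cayley_le e hφ A B
  rw [himage] at hle
  have hk0 : (0 : ℝ) < k := by exact_mod_cast (by omega : 0 < k)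
  have hq3 : (3 : ℝ) ≤ q := by exact_mod_cast hq
  have hqk' : 4 * (k : ℝ) ^ 6 ≤ (q : ℝ) ^ 7 := by exact_mod_cast hqk
  have key : ∀ X Y : Finset (ZMod k), X.card ≤ q → Y.card ≤ q →
      ((diffPairs S X Y).card : ℝ) ≤ ((q : ℝ) + 1) * X.card * Y.card / k + (q : ℝ) ^ 3 / k := by
    intro X Y hX hY
    have h1 := diffPairs_discrepancy hS henergy X Y
    rw [ZMod.card] at h1
    push_cast at h1
    have hX' : (X.card : ℝ) ≤ q := by exact_mod_cast hX
    have hY' : (Y.card : ℝ) ≤ q := by exact_mod_cast hY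
    -- The hypothesis 4k⁶ ≤ q⁷ says exactly that 4q⁵k² ≤ (q³/k)⁴, so the discrepancy is at most
    -- q³/k.
    have h2 : 4 * (Y.card : ℝ) ^ 2 * (X.card : ℝ) ^ 3 * (k : ℝ) ^ 2 ≤ ((q : ℝ) ^ 3 / k) ^ 4 := by
      rw [div_pow, le_div_iff₀ (by positivity)]
      calc 4 * (Y.card : ℝ) ^ 2 * (X.card : ℝ) ^ 3 * (k : ℝ) ^ 2 * (k : ℝ) ^ 4
          ≤ 4 * (q : ℝ) ^ 2 * (q : ℝ) ^ 3 * (k : ℝ) ^ 2 * (k : ℝ) ^ 4 := by gcongr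
        _ = (q : ℝ) ^ 5 * (4 * (k : ℝ) ^ 6) := by ring
        _ ≤ (q : ℝ) ^ 5 * (q : ℝ) ^ 7 := by gcongr
        _ = _ := by ring
    have h3 := le_of_pow_le_pow_left₀ (n := 4) (by norm_num) (by positivity)
      ((Even.pow_abs (by decide) _).le.trans (h1.trans h2))
    linarith [le_abs_self (((diffPairs S X Y).card : ℝ) - ((q : ℝ) + 1) * X.card * Y.card / k)]
  have hA' := card_side_add e A
  have hB' := card_side_add e B
  have k1 := key (side e A false) (side e B true) (by omega) (by omega)
  have k2 := key (side e B false) (side e A true) (by omega) (by omega)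
  set a := (side e A false).card
  set a' := (side e A true).card
  set b := (side e B false).card
  set b' := (side e B true).card
  have hab : (a : ℝ) * b' + b * a' ≤ (q : ℝ) ^ 2 := by
    have : a * b' + b * a' ≤ q ^ 2 := by
      calc a * b' + b * a' ≤ (a + a') * (b + b') := by nlinarith [Nat.zero_le (a * b)]
        _ = q ^ 2 := by rw [hA', hB', hA, hB, sq]
    exact_mod_cast this
  have hsum : ((isMating_cayleyMating e hφ).toColouredGraph.edgeCount A B : ℝ) ≤
      ((q : ℝ) + 1) * (a * b' + b * a') / k + 2 * (q : ℝ) ^ 3 / k := by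
    calc ((isMating_cayleyMating e hφ).toColouredGraph.edgeCount A B : ℝ)
        ≤ (diffPairs S (side e A false) (side e B true)).card +
          (diffPairs S (side e B false) (side e A true)).card := by exact_mod_cast hle
      _ ≤ _ := add_le_add k1 k2
      _ = _ := by ring
  refine hsum.trans_lt ?_
  rw [← add_div, div_lt_div_iff_of_pos_right hk0]
  have : ((q : ℝ) + 1) * (a * b' + b * a') ≤ (q + 1) * (q : ℝ) ^ 2 := by gcongr
  -- The main term is at most (q + 1)q² and the two errors 2q³, so q > 1 gives the strict bound 4q³.
  nlinarith [mul_pos (by positivity : (0 : ℝ) < (q : ℝ) ^ 2) (by linarith : (0 : ℝ) < q - 1)]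

section Nonempty

variable [Fintype V] {D : Finset ℕ} {c : ℕ} {P : Fin 4 → Finset ℕ}

theorem two_mul_card_colourEdges_le {G : ColouredGraph V (insert c D)} :
    2 * (colourEdges G.mate c).card ≤ Fintype.card V := by
  classical
  rw [← Finset.card_univ]
  refine Finset.mul_card_image_le_card (f := fun v => s(v, G.mate c v)) _ 2 fun e he => ?_
  obtain ⟨v, -, rfl⟩ := Finset.mem_image.1 he
  have hne : v ≠ G.mate c v := (G.isMating.ne c (Finset.mem_insert_self _ _) v).symm
  rw [← Finset.card_pair hne]
  refine Finset.card_le_card fun w hw => ?_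
  rw [Finset.mem_filter]
  refine ⟨Finset.mem_univ _, ?_⟩
  rcases Finset.mem_insert.1 hw with rfl | hw
  · rfl
  · rw [Finset.mem_singleton.1 hw, G.isMating.invol, Sym2.eq_swap]

/-- Each of the at most n/2 edges of colour `c` contributes at most |D|. Hence the range of s in the
relaxed class covers every value of r. -/
theorem gadgetCount_le (hP : IsPalette D c P) (x : V) (G : ColouredGraph V (insert c D)) :
    gadgetCount x P G ≤ Fintype.card V * D.card / 2 := by
  rw [gadgetCount_eq hP, Nat.le_div_iff_mul_le (by norm_num)]
  have h : labelCount D G.mate x c P ≤ (colourEdges G.mate c).card * D.card := by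
    rw [← smul_eq_mul]
    exact Finset.sum_le_card_nsmul _ _ _ fun e _ => min_le_left _ _
  calc _ ≤ (colourEdges G.mate c).card * D.card * 2 := Nat.mul_le_mul_right _ h
    _ = 2 * (colourEdges G.mate c).card * D.card := by ring
    _ ≤ _ := Nat.mul_le_mul_right _ two_mul_card_colourEdges_le

theorem relaxedQuasirandom_nonempty (hP : IsPalette D c P) (x : V) {k : ℕ}
    (hV : Fintype.card V = 2 * k) (hq : 3 ≤ D.card) (hk : D.card + 1 ≤ k)
    (hqk : 4 * k ^ 6 ≤ D.card ^ 7) : (relaxedQuasirandom (V := V) D c x P).Nonempty := by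
  obtain ⟨G, hG⟩ := exists_edgeCount_lt hV (Finset.card_insert_of_notMem hP.notMem) hq hk hqk
  refine ⟨G, Set.mem_iUnion₂.2 ⟨gadgetCount x P G, ?_, rfl, fun A B hA hB => ?_⟩⟩
  · exact Finset.mem_range.2 (Nat.lt_succ_of_le (gadgetCount_le hP x G))
  · refine (hG A B hA hB).trans_le ?_
    have : (4 * (D.card : ℝ) ^ 3 / k) = 8 * (D.card : ℝ) ^ 3 / (Fintype.card V : ℝ) := by
      rw [hV]
      push_cast
      rw [show 8 * (D.card : ℝ) ^ 3 = 2 * (4 * (D.card : ℝ) ^ 3) by ring,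
        mul_div_mul_left _ _ two_ne_zero]
    rw [this]
    have : (0 : ℝ) ≤ 6 * (gadgetCount x P G : ℝ) := by positivity
    linarith

end Nonempty

end ColouredGraph

/-! ### Growth of consecutive levels -/

namespace ColouredGraph

section Sparse

variable {V : Type*} [Fintype V] {D : Finset ℕ} {c s : ℕ} {P : Fin 4 → Finset ℕ}
  {G : ColouredGraph V (insert c D)}

theorem card_adjPairs_le (A B : Finset V) :
    (adjPairs (insert c D) G.mate A B).card ≤ 2 * G.edgeCount A B := by
  classical
  have hf := Set.toFinite {e : Sym2 V | e ∈ G.graph.edgeSet ∧ ∃ a ∈ A, ∃ b ∈ B, e = s(a, b)}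
  rw [edgeCount, Set.ncard_eq_toFinset_card _ hf]
  refine (Finset.card_le_card ?_).trans (card_orientations_le _)
  rintro ⟨a, b⟩ h
  obtain ⟨ha, hb, hab⟩ := mem_adjPairs.1 h
  rw [mem_orientations, Set.Finite.mem_toFinset]
  exact ⟨G.adj_iff.2 hab, a, ha, b, hb, rfl⟩

/-- Smaller sets are enlarged to size |D|, and ordered pairs cost a factor 2 against edges, which
doubles 8|D|³/n + 6s. -/
theorem isSparse_of_mem (hG : G ∈ quasirandomLevel V D c s) (hD : D.card ≤ Fintype.card V)
    (hD' : 1 ≤ D.card) (hV : Fintype.card V ≤ 16 * D.card ^ 2) :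
    IsSparse D c G.mate ⌊16 * (D.card : ℝ) ^ 3 / Fintype.card V + 12 * s⌋₊ where
  pairs A B hA hB := by
    obtain ⟨A', hA1, hA2⟩ := Finset.exists_superset_card_eq hA hD
    obtain ⟨B', hB1, hB2⟩ := Finset.exists_superset_card_eq hB hD
    have h1 := hG A' B' hA2 hB2
    refine Nat.le_floor ?_
    have h2 : (adjPairs (insert c D) G.mate A B).card ≤
        (adjPairs (insert c D) G.mate A' B').card := by
      refine Finset.card_le_card ?_
      rintro ⟨a, b⟩ h
      obtain ⟨ha, hb, hab⟩ := mem_adjPairs.1 h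
      exact mem_adjPairs.2 ⟨hA1 ha, hB1 hb, hab⟩
    have h3 : ((adjPairs (insert c D) G.mate A B).card : ℝ) ≤ 2 * G.edgeCount A' B' := by
      exact_mod_cast h2.trans (card_adjPairs_le A' B')
    calc ((adjPairs (insert c D) G.mate A B).card : ℝ) ≤ 2 * G.edgeCount A' B' := h3
      _ ≤ 2 * (8 * (D.card : ℝ) ^ 3 / Fintype.card V + 6 * s) := by gcongr
      _ = _ := by ring
  le := by
    refine Nat.le_floor ?_
    have h0 : (0 : ℝ) < Fintype.card V := by exact_mod_cast (by omega : 0 < Fintype.card V)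
    have h1 : (Fintype.card V : ℝ) ≤ 16 * (D.card : ℝ) ^ 2 := by exact_mod_cast hV
    have h2 : (D.card : ℝ) ≤ 16 * (D.card : ℝ) ^ 3 / Fintype.card V := by
      rw [le_div_iff₀ h0]
      calc (D.card : ℝ) * Fintype.card V ≤ D.card * (16 * (D.card : ℝ) ^ 2) := by gcongr
        _ = _ := by ring
    have h3 : (0 : ℝ) ≤ 12 * s := by positivity
    linarith

/-- Consecutive levels grow by a factor of at least eight. -/
theorem eight_mul_ncard_level_le (hP : IsPalette D c P) (x : V) {μ : ℝ} (hμ : 0 < μ)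
    (hμ' : μ ≤ 1 / 2 ^ 40) (hbox : (D.card : ℝ) ^ 4 / 2 ^ 12 ≤ (labelBox P).card)
    (h1 : μ * Fintype.card V / 2 ≤ D.card) (h2 : (D.card : ℝ) ≤ 2 * μ * Fintype.card V)
    (hD : 1 ≤ D.card) (hDV : D.card ≤ Fintype.card V) (hV : Fintype.card V ≤ 16 * D.card ^ 2)
    (hs : (s : ℝ) ≤ μ ^ 4 * (Fintype.card V : ℝ) ^ 2 / 2 ^ 22)
    (hlarge : 2 ^ 21 ≤ μ ^ 4 * (Fintype.card V : ℝ) ^ 2) :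
    8 * (level (D := D) (c := c) x P s).ncard ≤ (level (D := D) (c := c) x P (s + 1)).ncard := by
  have hN : 0 < Fintype.card V := by omega
  have key : ∀ G ∈ level (c := c) (D := D) x P s,
      8 * (s + 1) * Fintype.card V ^ 4 ≤ (goodSwitches D G.mate x c P).card := by
    intro G hG
    have hsp := isSparse_of_mem hG.2 hDV hD hV
    set Δ := ⌊16 * (D.card : ℝ) ^ 3 / Fintype.card V + 12 * s⌋₊ with hΔ
    have hΔle : (Δ : ℝ) ≤ 16 * (D.card : ℝ) ^ 3 / Fintype.card V + 12 * s :=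
      Nat.floor_le (by positivity)
    have hr : 2 * labelCount D G.mate x c P ≤ Δ := by
      rw [← gadgetCount_eq hP, show gadgetCount x P G = s from hG.1]
      refine Nat.le_floor ?_
      push_cast
      have : (0 : ℝ) ≤ 16 * (D.card : ℝ) ^ 3 / Fintype.card V := by positivity
      have : (0 : ℝ) ≤ s := by positivity
      linarith
    have hgood := card_goodSwitches (x := x) G.isMating hP hsp hr hD hDV
    have hgood' : ((labelBox P).card : ℝ) * (Fintype.card V : ℝ) ^ 2 ≤
        (goodSwitches D G.mate x c P).card +
        (186 * Δ * (D.card : ℝ) ^ 2 * (Fintype.card V : ℝ) ^ 2 +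
          42 * (D.card : ℝ) ^ 5 * Fintype.card V) := by exact_mod_cast hgood
    have hN' : (0 : ℝ) < Fintype.card V := by exact_mod_cast hN
    set N : ℝ := (Fintype.card V : ℝ)
    set q : ℝ := (D.card : ℝ)
    have hq : 0 ≤ q := Nat.cast_nonneg _
    have b1 : 186 * Δ * q ^ 2 * N ^ 2 ≤ 186 * 16 * q ^ 5 * N + 186 * 12 * (s * q ^ 2 * N ^ 2) := by
      calc 186 * Δ * q ^ 2 * N ^ 2 ≤ 186 * (16 * q ^ 3 / N + 12 * s) * q ^ 2 * N ^ 2 := by gcongr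
        _ = _ := by field_simp
    have b2 : q ^ 5 * N ≤ 2 * μ * (q ^ 4 * N ^ 2) := by
      calc q ^ 5 * N = q ^ 4 * N * q := by ring
        _ ≤ q ^ 4 * N * (2 * μ * N) := by gcongr
        _ = _ := by ring
    have b3 : (s : ℝ) * q ^ 2 * N ^ 2 ≤ μ ^ 2 / 2 ^ 20 * (q ^ 4 * N ^ 2) := by
      calc (s : ℝ) * q ^ 2 * N ^ 2 ≤ μ ^ 4 * N ^ 2 / 2 ^ 22 * q ^ 2 * N ^ 2 := by gcongr
        _ = μ ^ 2 / 2 ^ 20 * ((μ * N / 2) ^ 2 * q ^ 2 * N ^ 2) := by ring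
        _ ≤ μ ^ 2 / 2 ^ 20 * (q ^ 2 * q ^ 2 * N ^ 2) := by gcongr
        _ = _ := by ring
    have b4 : μ ^ 2 ≤ 1 := by
      have : μ ≤ 1 := hμ'.trans (by norm_num)
      exact pow_le_one₀ hμ.le this
    have hW : 0 ≤ q ^ 4 * N ^ 2 := by positivity
    have c1 : q ^ 5 * N ≤ 2 / 2 ^ 40 * (q ^ 4 * N ^ 2) := by
      refine b2.trans (mul_le_mul_of_nonneg_right ?_ hW)
      linarith
    have c2 : (s : ℝ) * q ^ 2 * N ^ 2 ≤ 1 / 2 ^ 40 * (q ^ 4 * N ^ 2) := by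
      refine b3.trans (mul_le_mul_of_nonneg_right ?_ hW)
      have : μ ^ 2 ≤ 1 / 2 ^ 40 * (1 / 2 ^ 40) := by rw [sq]; gcongr
      norm_num at this ⊢
      linarith
    have c3 : q ^ 4 / 2 ^ 12 * N ^ 2 ≤ (labelBox P).card * N ^ 2 := by gcongr
    have c4 : μ ^ 4 / 2 ^ 17 * N ^ 6 ≤ q ^ 4 * N ^ 2 / 2 ^ 13 := by
      calc μ ^ 4 / 2 ^ 17 * N ^ 6 = (μ * N / 2) ^ 4 * N ^ 2 / 2 ^ 13 := by ring
        _ ≤ _ := by gcongr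
    have c5 : (s : ℝ) * N ^ 4 ≤ μ ^ 4 / 2 ^ 22 * N ^ 6 := by
      calc (s : ℝ) * N ^ 4 ≤ μ ^ 4 * N ^ 2 / 2 ^ 22 * N ^ 4 := by gcongr
        _ = _ := by ring
    have c6 : 2 ^ 21 * N ^ 4 ≤ μ ^ 4 * N ^ 6 := by
      calc 2 ^ 21 * N ^ 4 ≤ μ ^ 4 * N ^ 2 * N ^ 4 := by gcongr
        _ = _ := by ring
    -- There are at least q⁴N²/2¹² candidates, and the losses c1, c2 are far below half of that
    -- since μ ≤ 2⁻⁴⁰. The remainder, essentially μ⁴N⁶/2¹⁷ by c4, exceeds 8sN⁴ + 8N⁴ by c5 and c6.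
    have : 8 * ((s : ℝ) + 1) * N ^ 4 ≤ (goodSwitches D G.mate x c P).card := by
      norm_num at c1 c2 c3 c4 c5 c6 ⊢
      nlinarith
    simp only [N] at this
    exact_mod_cast this
  have h := ncard_level_mul_le hP key
  have hpos : 0 < (s + 1) * Fintype.card V ^ 4 := by positivity
  refine Nat.le_of_mul_le_mul_right ?_ hpos
  calc _ = (level (D := D) (c := c) x P s).ncard * (8 * (s + 1) * Fintype.card V ^ 4) := by ring
    _ ≤ _ := h

end Sparse

section Palette

variable {D : Finset ℕ} {c : ℕ} {P : Fin 4 → Finset ℕ}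

theorem isPalette_of_isEquitableFourPartition (hP : IsEquitableFourPartition D P) (hc : c ∉ D) :
    IsPalette D c P where
  notMem := hc
  subset i _ hd := (hP.2.1 _).2 ⟨i, hd⟩
  disjoint := hP.1

/-- Once |D| ≥ 8, rounding |D|/4 down leaves at least |D|/8 colours in each part. -/
theorem le_card_labelBox (hP : IsEquitableFourPartition D P) (hD : 8 ≤ D.card) :
    (D.card : ℝ) ^ 4 / 2 ^ 12 ≤ (labelBox P).card := by
  have h : ∀ i, (D.card : ℝ) / 8 ≤ (P i).card := by
    intro i
    have h8 : (8 : ℚ) ≤ D.card := by exact_mod_cast hD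
    have : (D.card : ℚ) / 8 ≤ (P i).card := by
      rcases hP.2.2 i with h | h
      · rw [h]
        have := Nat.lt_floor_add_one ((D.card : ℚ) / 4)
        linarith
      · rw [h]
        have := Nat.le_ceil ((D.card : ℚ) / 4)
        linarith
    have h2 : (((D.card : ℚ) / 8 : ℚ) : ℝ) ≤ (((P i).card : ℚ) : ℝ) := by exact_mod_cast this
    simpa using h2
  simp only [labelBox, Finset.card_product]
  push_cast
  calc (D.card : ℝ) ^ 4 / 2 ^ 12
      = D.card / 8 * (D.card / 8 * (D.card / 8 * (D.card / 8))) := by ring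
    _ ≤ _ := by
      gcongr
      exacts [h 0, h 1, h 2, h 3]

end Palette

end ColouredGraph

/-! ### Geometric growth and the exponential tail -/

section Tail

theorem sum_range_succ_le_two_mul {a : ℕ → ℕ} {k : ℕ} (h : ∀ s < k, 8 * a s ≤ a (s + 1)) :
    ∑ s ∈ Finset.range (k + 1), a s ≤ 2 * a k := by
  induction k with
  | zero => simp; omega
  | succ k ih =>
    have h1 := ih fun s hs => h s (by omega)
    have h2 := h k (by omega)
    rw [Finset.sum_range_succ]
    omega

theorem pow_mul_le_of_ratio {a : ℕ → ℕ} {k : ℕ} (h : ∀ s < 2 * k, 8 * a s ≤ a (s + 1)) {j : ℕ}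
    (hj : j ≤ k) : 8 ^ j * a k ≤ a (k + j) := by
  induction j with
  | zero => simp
  | succ j ih =>
    have h1 := ih (by omega)
    have h2 := h (k + j) (by omega)
    rw [pow_succ, ← add_assoc]
    linarith

/-- For K ≥ 1 one has K/2 ≤ ⌊K⌋, and 2·e^k ≤ 2^k·4^k. The factor 2 absorbs the geometric sum of the
lower levels. -/
theorem two_mul_exp_le {K : ℝ} (hK : 1 ≤ K) : 2 * Real.exp (K / 2) ≤ 8 ^ ⌊K⌋₊ := by
  have h1 : 1 ≤ ⌊K⌋₊ := Nat.le_floor (by simpa using hK)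
  have h2 := Nat.lt_floor_add_one K
  set k := ⌊K⌋₊
  have h3 : (1 : ℝ) ≤ k := by exact_mod_cast h1
  have h4 : Real.exp (K / 2) ≤ Real.exp k := Real.exp_le_exp.2 (by linarith)
  have h5 : Real.exp k = Real.exp 1 ^ k := by rw [← Real.exp_nat_mul, mul_one]
  have h6 : (2 : ℝ) ≤ 2 ^ k := le_self_pow₀ (by norm_num) (by omega)
  have h7 : Real.exp 1 ≤ 4 := by linarith [Real.exp_one_lt_d9]
  calc 2 * Real.exp (K / 2) ≤ 2 ^ k * Real.exp 1 ^ k := by rw [← h5]; gcongr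
    _ ≤ 2 ^ k * 4 ^ k := by gcongr
    _ = 8 ^ k := by rw [← mul_pow]; norm_num

end Tail

open ProbabilityTheory MeasureTheory in
-- Conditioning the uniform measure is a ratio of cardinalities, so the probabilistic statement
-- reduces to counting.
theorem cond_uniformOn_univ_le {Ω : Type*} [Finite Ω] [MeasurableSpace Ω]
    [DiscreteMeasurableSpace Ω] {Q E : Set Ω} {δ : ℝ} (hδ : 0 ≤ δ)
    (h : ((Q ∩ E).ncard : ℝ) ≤ δ * Q.ncard) :
    cond (uniformOn (Set.univ : Set Ω)) Q E ≤ ENNReal.ofReal δ := by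
  have hm : ∀ S : Set Ω, MeasurableSet S := fun S => MeasurableSet.of_discrete
  have hcount : ∀ S : Set Ω, Measure.count S = (S.ncard : ENNReal) := fun S => by
    rw [Measure.count_apply_finite S (Set.toFinite S), Set.ncard_eq_toFinset_card]
  rw [uniformOn, cond_cond_eq_cond_inter (hm _) (hm _), Set.univ_inter, cond_apply (hm _), hcount,
    hcount, mul_comm, ← div_eq_mul_inv]
  refine ENNReal.div_le_of_le_mul ?_
  rw [← ENNReal.ofReal_natCast, ← ENNReal.ofReal_natCast, ← ENNReal.ofReal_mul hδ]
  exact ENNReal.ofReal_le_ofReal h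

namespace ColouredGraph

variable {V : Type*} [Fintype V] {D : Finset ℕ} {c : ℕ} {P : Fin 4 → Finset ℕ}

/-- Geometric growth of the levels makes the lower ones negligible. -/
theorem ncard_relaxedQuasirandom_inter_le (x : V) {K : ℝ} (hK : 1 ≤ K)
    (hKn : 2 * ⌊K⌋₊ ≤ Fintype.card V * D.card / 2)
    (hratio : ∀ s < 2 * ⌊K⌋₊,
      8 * (level (D := D) (c := c) x P s).ncard ≤ (level (D := D) (c := c) x P (s + 1)).ncard) :
    ((relaxedQuasirandom D c x P ∩ {G | (gadgetCount x P G : ℝ) ≤ K}).ncard : ℝ) ≤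
      Real.exp (-(K / 2)) * (relaxedQuasirandom D c x P).ncard := by
  classical
  set k := ⌊K⌋₊
  have h1 : relaxedQuasirandom D c x P ∩ {G | (gadgetCount x P G : ℝ) ≤ K} ⊆
      ⋃ s ∈ Finset.range (k + 1), level x P s := by
    rintro G ⟨hQ, hG⟩
    obtain ⟨s, -, hs⟩ := Set.mem_iUnion₂.1 hQ
    have hs1 : gadgetCount x P G = s := hs.1
    refine Set.mem_iUnion₂.2 ⟨s, Finset.mem_range.2 (Nat.lt_succ_of_le (Nat.le_floor ?_)), hs⟩
    rw [← hs1]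
    exact hG
  have h2 : (relaxedQuasirandom D c x P ∩ {G | (gadgetCount x P G : ℝ) ≤ K}).ncard ≤
      ∑ s ∈ Finset.range (k + 1), (level (D := D) (c := c) x P s).ncard := by
    refine (Set.ncard_le_ncard h1 (Set.toFinite _)).trans ?_
    exact Finset.set_ncard_biUnion_le _ _
  have h3 := sum_range_succ_le_two_mul
    (a := fun s => (level (D := D) (c := c) x P s).ncard) (k := k)
    fun s hs => hratio s (by omega)
  have h4 := pow_mul_le_of_ratio
    (a := fun s => (level (D := D) (c := c) x P s).ncard) hratio le_rfl
  -- Only the single level 2k is needed to bound the class from below; `hKn` ensures that 2k is an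
  -- admissible value of s.
  have h5 : (level (D := D) (c := c) x P (k + k)).ncard ≤ (relaxedQuasirandom D c x P).ncard := by
    refine Set.ncard_le_ncard (fun G hG => ?_) (Set.toFinite _)
    exact Set.mem_iUnion₂.2 ⟨k + k, Finset.mem_range.2 (by omega), hG⟩
  set L := (relaxedQuasirandom D c x P ∩ {G | (gadgetCount x P G : ℝ) ≤ K}).ncard
  set Q := (relaxedQuasirandom D c x P).ncard
  have h6 : (8 : ℝ) ^ k * L ≤ 2 * Q := by
    have : 8 ^ k * L ≤ 2 * Q := by
      calc 8 ^ k * L ≤ 8 ^ k * (2 * (level (D := D) (c := c) x P k).ncard) :=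
            Nat.mul_le_mul_left _ (h2.trans h3)
        _ = 2 * (8 ^ k * (level (D := D) (c := c) x P k).ncard) := by ring
        _ ≤ 2 * Q := Nat.mul_le_mul_left _ (h4.trans h5)
    exact_mod_cast this
  have h7 := two_mul_exp_le hK
  rw [Real.exp_neg, inv_mul_eq_div, le_div_iff₀ (Real.exp_pos _)]
  have h8 : 2 * Real.exp (K / 2) * L ≤ 8 ^ k * L := by gcongr
  linarith

end ColouredGraph

/-! ### Choice of constants and conclusion -/

theorem mainTheorem6 :
    ∃ μ₀ : ℝ, 0 < μ₀ ∧ μ₀ < 1 ∧ ∀ μ : ℝ, 0 < μ → μ ≤ μ₀ →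
      ∃ n₀ : ℕ, ∀ n : ℕ, n₀ ≤ n → Even n →
        ∀ (V : Type*) [Fintype V], Fintype.card V = n →
        ∀ D : Finset ℕ, D ⊆ Finset.Icc 1 (n - 1) →
          (D.card = ⌊μ * (n : ℝ)⌋₊ ∨ D.card = ⌈μ * (n : ℝ)⌉₊) →
        ∀ x : V, ∀ c ∈ Finset.Icc 1 (n - 1), c ∉ D →
        ∀ P : Fin 4 → Finset ℕ, IsEquitableFourPartition D P →
          (relaxedQuasirandom D c x P).Nonempty ∧
          (ProbabilityTheory.cond
            (ProbabilityTheory.uniformOn (Set.univ : Set (ColouredGraph V (insert c D))))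
            (relaxedQuasirandom D c x P))
              {G | (gadgetCount x P G : ℝ) ≤ μ ^ 4 * (n : ℝ) ^ 2 / 2 ^ 23}
            ≤ ENNReal.ofReal (Real.exp (-(μ ^ 4 * (n : ℝ) ^ 2 / 2 ^ 24))) := by
  -- The power μ⁷ is dictated by the condition 4k⁶ ≤ |D|⁷ of the Cayley construction. The bound 2³⁰
  -- ≤ μ⁷n then gives all weaker largeness conditions.
  refine ⟨1 / 2 ^ 40, by norm_num, by norm_num, fun μ hμ hμ' => ⟨⌈2 ^ 30 / μ ^ 7⌉₊, ?_⟩⟩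
  rintro n hn ⟨k, hk⟩ V _ hV D - hD x c - hc P hP
  have hpal := ColouredGraph.isPalette_of_isEquitableFourPartition hP hc
  have hμ1 : μ ≤ 1 := hμ'.trans (by norm_num)
  have hn7 : 2 ^ 30 ≤ μ ^ 7 * n := by
    have := (Nat.le_ceil _).trans (Nat.cast_le (α := ℝ).2 hn)
    rw [div_le_iff₀ (by positivity)] at this
    linarith
  have hn0 : (0 : ℝ) ≤ n := Nat.cast_nonneg _
  have hpow : ∀ i ≤ 7, 2 ^ 30 ≤ μ ^ i * n := fun i hi =>
    hn7.trans (mul_le_mul_of_nonneg_right (pow_le_pow_of_le_one hμ.le hμ1 hi) hn0)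
  have hn1 := hpow 1 (by norm_num)
  have hn2 := hpow 2 (by norm_num)
  rw [pow_one] at hn1
  have hlow : μ * n / 2 ≤ (D.card : ℝ) := by
    rcases hD with h | h <;> rw [h]
    · have := Nat.lt_floor_add_one (μ * n)
      linarith
    · have := Nat.le_ceil (μ * n)
      linarith
  have hupp : (D.card : ℝ) ≤ 2 * μ * n := by
    rcases hD with h | h <;> rw [h]
    · have := Nat.floor_le (a := μ * n) (by positivity)
      linarith
    · have := Nat.ceil_lt_add_one (a := μ * n) (by positivity)
      linarith
  have hD8 : 8 ≤ D.card := by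
    have : (8 : ℝ) ≤ D.card := by linarith
    exact_mod_cast this
  have hkn : (n : ℝ) = 2 * k := by rw [hk]; push_cast; ring
  have hDk : D.card + 1 ≤ k := by
    have : (D.card : ℝ) + 1 ≤ k := by
      have : μ * n ≤ 1 / 2 ^ 40 * n := by gcongr
      norm_num at this
      linarith
    exact_mod_cast this
  have hD7 : 4 * k ^ 6 ≤ D.card ^ 7 := by
    have : 4 * (k : ℝ) ^ 6 ≤ (D.card : ℝ) ^ 7 := by
      calc 4 * (k : ℝ) ^ 6 = 8 * (n : ℝ) ^ 6 / 2 ^ 7 := by rw [hkn]; ring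
        _ ≤ (μ ^ 7 * n) * (n : ℝ) ^ 6 / 2 ^ 7 := by gcongr; linarith
        _ = (μ * n / 2) ^ 7 := by ring
        _ ≤ _ := by gcongr
    exact_mod_cast this
  have hD2 : Fintype.card V ≤ 16 * D.card ^ 2 := by
    rw [hV]
    have : (n : ℝ) ≤ 16 * (D.card : ℝ) ^ 2 := by
      calc (n : ℝ) = 1 * n := (one_mul _).symm
        _ ≤ (4 * (μ ^ 2 * n)) * n := by gcongr; linarith
        _ = 16 * (μ * n / 2) ^ 2 := by ring
        _ ≤ _ := by gcongr
    exact_mod_cast this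
  have hlarge : 2 ^ 23 ≤ μ ^ 4 * (n : ℝ) ^ 2 := by
    calc (2 : ℝ) ^ 23 ≤ (2 ^ 30) ^ 2 := by norm_num
      _ ≤ (μ ^ 2 * n) ^ 2 := by gcongr
      _ = _ := by ring
  refine ⟨ColouredGraph.relaxedQuasirandom_nonempty hpal x (k := k) (by omega) (by omega) hDk hD7,
    cond_uniformOn_univ_le (Real.exp_pos _).le ?_⟩
  rw [show μ ^ 4 * (n : ℝ) ^ 2 / 2 ^ 24 = μ ^ 4 * (n : ℝ) ^ 2 / 2 ^ 23 / 2 by ring]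
  set K := μ ^ 4 * (n : ℝ) ^ 2 / 2 ^ 23 with hK
  have hK1 : 1 ≤ K := by
    rw [hK, le_div_iff₀ (by norm_num)]
    linarith
  have hfloor : (⌊K⌋₊ : ℝ) ≤ K := Nat.floor_le (by linarith)
  refine ColouredGraph.ncard_relaxedQuasirandom_inter_le x hK1 ?_ fun s hs => ?_
  · rw [hV, Nat.le_div_iff_mul_le (by norm_num)]
    have h1 : (n : ℝ) * (μ * n / 2) ≤ n * D.card := by gcongr
    have h2 : μ ^ 4 * (n : ℝ) ^ 2 ≤ μ * (n : ℝ) ^ 2 := by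
      gcongr
      exact pow_le_of_le_one hμ.le hμ1 (by norm_num)
    have : 2 * (⌊K⌋₊ : ℝ) * 2 ≤ n * D.card := by
      calc 2 * (⌊K⌋₊ : ℝ) * 2 ≤ 2 * K * 2 := by gcongr
        _ = μ ^ 4 * (n : ℝ) ^ 2 / 2 ^ 21 := by rw [hK]; ring
        _ ≤ μ * (n : ℝ) ^ 2 / 2 := by gcongr; norm_num
        _ = n * (μ * n / 2) := by ring
        _ ≤ _ := h1
    exact_mod_cast this
  · refine ColouredGraph.eight_mul_ncard_level_le hpal x hμ hμ'
      (ColouredGraph.le_card_labelBox hP hD8) ?_ ?_ (by omega) (by omega) hD2 ?_ ?_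
    · rwa [hV]
    · rwa [hV]
    -- Growth is needed up to level 2⌊K⌋ ≤ μ⁴n²/2²², twice the threshold of the theorem.
    · rw [hV]
      have : (s : ℝ) ≤ 2 * (⌊K⌋₊ : ℝ) := by exact_mod_cast hs.le
      calc (s : ℝ) ≤ 2 * K := by linarith
        _ = _ := by rw [hK]; ring
    · rw [hV]
      norm_num at hlarge ⊢
      linarith
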